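/- Let $d\ge 0$ be an integer and write points of $\mathbb R^{2d+1}$ as $(z,t)$ with $z\in\mathbb R^{2d}$, $t\in\mathbb R$. Let $A_0=L^2(\mathbb R^{2d+1})$ with its usual norm $\|\cdot\|_0$. For $0<s\le 1$ let $A_s$ be the space of those tempered distributions $f$ on $\mathbb R^{2d+1}$ that are given by functions and satisfy $$\|f\|_s^2=\int_{\mathbb R^{2d}\times(\mathbb R\setminus\{0\})}|f(z,t)|^2\,|t|^{-2s}\,dz\,dt+\int_{\mathbb R^{2d+1}}|D^sf(z,t)|^2\,dz\,dt<\infty .$$ Here, for $s=1$, $D^1=D$ is the distributional derivative in $t$. For $0<s<1$, $D^s$ is the Fourier multiplier $|\lambda|^s$, where $\lambda$ is the frequency variable dual to $t$ (with respect to the kernel $e^{i\lambda t}$): $D^sf=g\in L^2(\mathbb R^{2d+1})$ means that $\widehat g=|\lambda|^s\widehat f$, in the sense that $\langle\widehat g,\varphi\rangle=\langle\widehat f,|\lambda|^s\varphi\rangle$ for all Schwartz functions $\varphi$ such that $|\lambda|^s\varphi$ is a Schwartz function. Let $S=\{0\le\operatorname{Re}w\le1\}$. Let $\mathcal F(A_0,A_1)$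 be the space of functions $F:S\to A_0+A_1$ that are bounded and continuous on $S$ and holomorphic in its interior for the norm $\|v\|=\inf\{\|v_0\|_0+\|v_1\|_1: v=v_0+v_1\}$ of $A_0+A_1$, and such that, for $j=0,1$, $y\mapsto F(j+iy)$ is a continuous function from $\mathbb R$ to $A_j$ tending to $0$ in $A_j$ as $|y|\to\infty$. Put $\|F\|_{\mathcal F}=\max_{j=0,1}\sup_{y\in\mathbb R}\|F(j+iy)\|_j$. The complex interpolation space is $[A_0,A_1]_s=\{F(s):F\in\mathcal F(A_0,A_1)\}$, with norm $\|f\|_{[A_0,A_1]_s}=\inf\{\|F\|_{\mathcal F}:F\in\mathcal F(A_0,A_1),\ F(s)=f\}$. Then, for every $0<s<1$, $[A_0,A_1]_s=A_s$ as sets, and the norms are equivalent: there are constants $c,C>0$, depending only on $d$ and $s$, such that $$c\,\|f\|_s\le\|f\|_{[A_0,A_1]_s}\le C\,\|f\|_s\qquad\text{for all } f\in A_s .$$ -/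

import Mathlib

open MeasureTheory Filter Topology SchwartzMap FourierTransform LineDeriv
open scoped ENNReal NNReal

/-! ### Calderón's complex interpolation method

A normed space `A` contained in a complex vector space `V` is represented by its norm
`N : V → ℝ≥0∞`, extended by `N v = ∞` for `v ∉ A`. -/

namespace ComplexInterpolation

variable {V : Type*} [AddCommGroup V] [Module ℂ V]

/-- The norm of the sum space `A₀ + A₁`:
`‖v‖ = inf {‖v₀‖₀ + ‖v₁‖₁ : v = v₀ + v₁}` (and `∞` if `v ∉ A₀ + A₁`). -/
noncomputable def sumNorm (N₀ N₁ : V → ℝ≥0∞) (v : V) : ℝ≥0∞ :=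
  ⨅ (p : V × V) (_ : p.1 + p.2 = v), N₀ p.1 + N₁ p.2

/-- The closed strip `0 ≤ Re z ≤ 1`. -/
def strip : Set ℂ := {z | 0 ≤ z.re ∧ z.re ≤ 1}

/-- The open strip `0 < Re z < 1`. -/
def openStrip : Set ℂ := {z | 0 < z.re ∧ z.re < 1}

/-- A continuous curve `ℝ → A` vanishing at infinity, where `A` is the space with norm `N`. -/
structure IsBoundaryCurve (N : V → ℝ≥0∞) (γ : ℝ → V) : Prop where
  finite : ∀ y, N (γ y) < ∞
  continuous : ∀ y, Tendsto (fun y' => N (γ y' - γ y)) (𝓝 y) (𝓝 0)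
  vanishing : Tendsto (fun y => N (γ y)) (cocompact ℝ) (𝓝 0)

/-- The Calderón class `𝓕(A₀, A₁)`: functions on the closed strip with values in `A₀ + A₁`, bounded
and continuous on the closed strip and holomorphic in the open strip for the norm of `A₀ + A₁`,
whose restrictions to the lines `Re z = 0` and `Re z = 1` are continuous curves in `A₀` and in `A₁`,
respectively, which tend to `0` at infinity. -/
structure IsAdmissible (N₀ N₁ : V → ℝ≥0∞) (F : ℂ → V) : Prop where
  bounded : ∃ C : ℝ≥0, ∀ z ∈ strip, sumNorm N₀ N₁ (F z) ≤ C
  continuous : ∀ z ∈ strip,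
    Tendsto (fun w => sumNorm N₀ N₁ (F w - F z)) (𝓝[strip] z) (𝓝 0)
  holomorphic : ∀ z ∈ openStrip, ∃ F' : V, sumNorm N₀ N₁ F' < ∞ ∧
    Tendsto (fun w => sumNorm N₀ N₁ ((w - z)⁻¹ • (F w - F z) - F')) (𝓝[≠] z) (𝓝 0)
  left : IsBoundaryCurve N₀ (fun y : ℝ => F (y * Complex.I))
  right : IsBoundaryCurve N₁ (fun y : ℝ => F (1 + y * Complex.I))

/-- The norm of `𝓕(A₀, A₁)`: the larger of `sup ‖F(iy)‖₀` and `sup ‖F(1 + iy)‖₁`. -/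
noncomputable def stripNorm (N₀ N₁ : V → ℝ≥0∞) (F : ℂ → V) : ℝ≥0∞ :=
  max (⨆ y : ℝ, N₀ (F (y * Complex.I))) (⨆ y : ℝ, N₁ (F (1 + y * Complex.I)))

/-- The underlying set of the complex interpolation space `[A₀, A₁]_θ`. -/
def interpSpace (N₀ N₁ : V → ℝ≥0∞) (θ : ℝ) : Set V :=
  {v | ∃ F : ℂ → V, IsAdmissible N₀ N₁ F ∧ F θ = v}

/-- The norm of the complex interpolation space `[A₀, A₁]_θ`:
`‖v‖ = inf {‖F‖ : F ∈ 𝓕(A₀, A₁), F θ = v}`. -/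
noncomputable def interpNorm (N₀ N₁ : V → ℝ≥0∞) (θ : ℝ) (v : V) : ℝ≥0∞ :=
  ⨅ (F : ℂ → V) (_ : IsAdmissible N₀ N₁ F ∧ F θ = v), stripNorm N₀ N₁ F

end ComplexInterpolation

/-! ### The spaces `A_s` -/

namespace HardySobolev

/-- `ℝ^{2d+1}`, whose points are written `(z, t)` with `z ∈ ℝ^{2d}` and `t ∈ ℝ` the last
coordinate. -/
abbrev E (d : ℕ) : Type := EuclideanSpace ℝ (Fin (2 * d + 1))

/-- The last coordinate `t` of the point `(z, t)`. -/
def tCoord {d : ℕ} (x : E d) : ℝ := x (Fin.last (2 * d))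

/-- The unit vector in the direction of the last coordinate. -/
noncomputable def tDir (d : ℕ) : E d := EuclideanSpace.single (Fin.last (2 * d)) 1

/-- The tempered distribution `u` is (integration against) the function `f`. -/
def IsRepresentedBy {d : ℕ} (u : 𝓢'(E d, ℂ)) (f : E d → ℂ) : Prop :=
  AEStronglyMeasurable f volume ∧
    ∀ φ : 𝓢(E d, ℂ), Integrable (fun x => φ x * f x) volume ∧ u φ = ∫ x, φ x * f x

/-- `g = D^s u` for a tempered distribution `u` and a function `g ∈ L²(ℝ^{2d+1})`.

For `s = 1`, `D` is the distributional derivative in the last variable. Otherwise `D^s` is the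
Fourier multiplier `|λ|^s`, `λ` being the frequency of the last variable; with Mathlib's
normalization of the Fourier transform, `λ = 2π ξ_t`. The equation `𝓕 g = |λ|^s 𝓕 u` is tested
against all Schwartz functions `φ` for which the product `χ = |λ|^s φ` is again a Schwartz function.
As the multiplier is smooth exactly off the null set `λ = 0`, these `φ` contain all the test
functions supported off this set, and so the equation determines `g ∈ L²`. -/
def IsFracDeriv {d : ℕ} (s : ℝ) (u : 𝓢'(E d, ℂ)) (g : Lp ℂ 2 (volume : Measure (E d))) : Prop :=
  if s = 1 then ∂_{tDir d} u = (g : 𝓢'(E d, ℂ))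
  else ∀ φ χ : 𝓢(E d, ℂ),
    (∀ ξ, χ ξ = ((|2 * Real.pi * tCoord ξ| ^ s : ℝ) : ℂ) * φ ξ) →
      (𝓕 u) χ = (𝓕 (g : 𝓢'(E d, ℂ))) φ

/-- `∫_{t ≠ 0} |u(z,t)|² |t|^{-2s} dz dt`, which is `∞` if the distribution `u` is not a function. -/
noncomputable def weightedSq {d : ℕ} (s : ℝ) (u : 𝓢'(E d, ℂ)) : ℝ≥0∞ :=
  ⨅ (f : E d → ℂ) (_ : IsRepresentedBy u f),
    ∫⁻ x in {x : E d | tCoord x ≠ 0}, ‖f x‖ₑ ^ 2 * ENNReal.ofReal (|tCoord x| ^ (-2 * s))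

/-- `∫ |D^s u(z,t)|² dz dt`, which is `∞` if `D^s u` is not in `L²(ℝ^{2d+1})`. -/
noncomputable def fracDerivSq {d : ℕ} (s : ℝ) (u : 𝓢'(E d, ℂ)) : ℝ≥0∞ :=
  ⨅ (g : Lp ℂ 2 (volume : Measure (E d))) (_ : IsFracDeriv s u g), ‖g‖ₑ ^ 2

/-- The norm of `A_0 = L²(ℝ^{2d+1})`, extended by `∞` to all tempered distributions. -/
noncomputable def normL2 {d : ℕ} (u : 𝓢'(E d, ℂ)) : ℝ≥0∞ :=
  ⨅ (g : Lp ℂ 2 (volume : Measure (E d))) (_ : (g : 𝓢'(E d, ℂ)) = u), ‖g‖ₑ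

/-- The norm of `A_s`, `0 ≤ s ≤ 1`, extended by `∞` to all tempered distributions: the `L²` norm for
`s = 0`, and
`‖u‖_s² = ∫_{t ≠ 0} |u(z,t)|² |t|^{-2s} dz dt + ∫ |D^s u(z,t)|² dz dt` for `s ≠ 0`. -/
noncomputable def normA (d : ℕ) (s : ℝ) (u : 𝓢'(E d, ℂ)) : ℝ≥0∞ :=
  if s = 0 then normL2 u else (weightedSq s u + fracDerivSq s u) ^ (1 / 2 : ℝ)

/-- The space `A_s` of the tempered distributions with finite norm. -/
def A (d : ℕ) (s : ℝ) : Set 𝓢'(E d, ℂ) := {u | normA d s u < ∞}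

end HardySobolev

/-!
The two inclusions have different proofs. Throughout, a Schwartz function is called annular if it
is supported in `a ≤ |t| ≤ b` for some `0 < a < b`; multiplication by `|t|^z` acts on annular
functions, and they are dense in every weighted space `L²(|t|^{2 Re z})`. Frequencies are
normalized by the kernel `e^{-2πi λt}`, so `D^s` is multiplication by `(2π|λ|)^s`. The last
coordinate on the Fourier side is called `λ` in this comment, and `t` below.

**`[A_0, A_1]_s ⊆ A_s`** (`normA_le_of_isAdmissible`). Let `F` be admissible. The three lines
theorem (`norm_le_of_isAdmissible`) is applied to `w ↦ ⟨F w, |t|^{-w} φ⟩` and to `w ↦ ⟨𝓕 (F w),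
|λ|^w φ⟩`, with `φ` annular (`enorm_apply_le_of_isAdmissible`). By Riesz representation on weighted
`L²` (`exists_memLp_of_annular_bound`), the first estimate gives the weighted norm of `F s`, and
the second shows that `𝓕 (F s) = |λ|^{-s} k` off `λ = 0`, with `k ∈ L²`. Elements of `A_0 + A_1`
are tame, i.e. bounded by `‖φ‖₂ + ‖t φ‖₂`; hence the last identity holds on all test functions
vanishing on `λ = 0` (`fourier_apply_of_vanish`), and `D^s (F s) ∈ L²`.

**`A_s ⊆ [A_0, A_1]_s`** (`exists_isAdmissible`). Let `𝓕 u = |λ|^{-s} k` off `λ = 0`. The natural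
candidate is `F z = 𝓕⁻ (e^{(z-s)²} |λ|^{-z} k)`. Two things are wrong with it on `Re z = 1`:
`|λ|^{-1}` may be too singular at `λ = 0`, and a function with `t`-derivative in `L²` need not have
`F z / t ∈ L²`. Both are cured by Hardy's inequality (`hardy`) if only the part odd in `t` is kept:
odd test functions vanish on `λ = 0`, and odd functions vanish on `t = 0` (`oddDistr`,
`isSynthesis_oddDistr`). This handles the odd part of `u`. The even part is `sgn t` times the odd
part of `sgn(t) u`; as multiplication by `sgn t` is bounded on `A_0` and on `A_1`
(`IsSgnMul.normA_one_le`), the same family works for it, provided that `sgn(t) u` again has `D^s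
(sgn(t) u) ∈ L²`.

The last point is `exists_fourier_sgnMul`, by real interpolation. At each scale `r`, the function
`sgn(t) u` is split into a part `p` in `L²` and a part with `t`-derivative `q` in `L²`
(`exists_scale_split`): `sgn t` is replaced by a smooth function varying at the scale `r`, and `u`
by its frequencies below `1/r`. On the dyadic band `|λ| ∼ 1/r` this bounds the Fourier transform of
`sgn(t) u` by `|p̂| + r |q̂|`, and the bounds can be summed over `r = 2^n` because `∫₀^∞ y^{-2s}
min(1, y)² dy/y` is finite (`exists_tsum_dyadic_le`).
-/

namespace HardySobolev

open scoped ContDiff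

variable {d : ℕ}

/-! ### The last coordinate, its powers and logarithmic cutoffs -/

lemma continuous_tCoord : Continuous (tCoord : E d → ℝ) :=
  (EuclideanSpace.proj (𝕜 := ℝ) (Fin.last (2 * d)) : E d →L[ℝ] ℝ).continuous

@[fun_prop]
lemma measurable_tCoord : Measurable (tCoord : E d → ℝ) := continuous_tCoord.measurable

@[fun_prop]
lemma hasTemperateGrowth_tCoord : (tCoord : E d → ℝ).HasTemperateGrowth :=
  (EuclideanSpace.proj (𝕜 := ℝ) (Fin.last (2 * d)) : E d →L[ℝ] ℝ).hasTemperateGrowth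

@[simp] lemma tCoord_add (x y : E d) : tCoord (x + y) = tCoord x + tCoord y := rfl

@[simp] lemma tCoord_smul (r : ℝ) (x : E d) : tCoord (r • x) = r * tCoord x := rfl

@[simp] lemma tCoord_tDir : tCoord (tDir d) = 1 := by simp [tCoord, tDir]

@[simp] lemma norm_tDir : ‖tDir d‖ = 1 := by simp [tDir]

lemma inner_tDir (x : E d) : inner ℝ x (tDir d) = tCoord x := by
  simp [tDir, tCoord, EuclideanSpace.inner_single_right]

lemma ae_tCoord_ne_zero : ∀ᵐ x : E d, tCoord x ≠ 0 := by
  have h := Measure.addHaar_submodule (volume : Measure (E d))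
    (LinearMap.ker ((EuclideanSpace.proj (𝕜 := ℝ) (Fin.last (2 * d)) : E d →L[ℝ] ℝ) : E d →ₗ[ℝ] ℝ))
    (by
      intro h
      have h1 : tDir d ∈ (⊤ : Submodule ℝ (E d)) := trivial
      rw [← h, LinearMap.mem_ker] at h1
      exact one_ne_zero ((tCoord_tDir (d := d)).symm.trans h1))
  rw [ae_iff]
  convert! h using 2
  ext x
  simp [tCoord]

/-- A smooth bump function on `ℝ`, equal to `1` on `[-1, 1]` and supported in `[-2, 2]`. -/
noncomputable def logBump : ContDiffBump (0 : ℝ) := ⟨1, 2, one_pos, one_lt_two⟩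

/-- The cutoff `t ↦ β(log |t| / (n + 1))`, set to be `0` at `t = 0`. It is smooth with compact
support in `ℝ ∖ {0}`, tends to `1` off `0`, and satisfies `|t θₙ'(t)| = O(1 / n)`: multiplying by it
changes derivatives only by an error that Hardy's inequality controls. -/
noncomputable def theta (n : ℕ) (t : ℝ) : ℝ :=
  if t = 0 then 0 else logBump (Real.log t / (n + 1))

lemma theta_nonneg (n : ℕ) (t : ℝ) : 0 ≤ theta n t := by
  unfold theta; split_ifs
  · rfl
  · exact logBump.nonneg

lemma theta_le_one (n : ℕ) (t : ℝ) : theta n t ≤ 1 := by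
  unfold theta; split_ifs
  · exact zero_le_one
  · exact logBump.le_one

@[simp] lemma theta_zero (n : ℕ) : theta n 0 = 0 := by simp [theta]

lemma theta_eq_one {n : ℕ} {t : ℝ} (ht : t ≠ 0) (h : |Real.log t| ≤ n + 1) : theta n t = 1 := by
  rw [theta, if_neg ht]
  apply logBump.one_of_mem_closedBall
  have : (0 : ℝ) < n + 1 := by positivity
  rw [mem_closedBall_zero_iff, Real.norm_eq_abs, abs_div, abs_of_pos this, div_le_iff₀ this]
  simpa [logBump] using h

lemma abs_log_lt_of_theta_ne_zero {n : ℕ} {t : ℝ} (h : theta n t ≠ 0) :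
    t ≠ 0 ∧ |Real.log t| < 2 * (n + 1) := by
  by_cases ht : t = 0
  · simp [ht] at h
  refine ⟨ht, ?_⟩
  rw [theta, if_neg ht] at h
  by_contra! h1
  apply h
  apply logBump.zero_of_le_dist
  have : (0 : ℝ) < n + 1 := by positivity
  rw [dist_zero_right, Real.norm_eq_abs, abs_div, abs_of_pos this, le_div_iff₀ this]
  simpa [logBump] using h1

lemma eventually_theta_eq_one {t : ℝ} (ht : t ≠ 0) : ∀ᶠ n in atTop, theta n t = 1 := by
  filter_upwards [eventually_ge_atTop ⌈|Real.log t|⌉₊] with n hn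
  refine theta_eq_one ht ?_
  have := Nat.ceil_le.mp hn
  linarith

lemma theta_eq_zero_near {n : ℕ} : ∀ᶠ t in 𝓝 (0 : ℝ), theta n t = 0 := by
  filter_upwards [Metric.ball_mem_nhds (0 : ℝ) (Real.exp_pos (-(2 * (n + 1))))] with t ht
  by_contra h
  obtain ⟨h0, h1⟩ := abs_log_lt_of_theta_ne_zero h
  rw [mem_ball_zero_iff, Real.norm_eq_abs, ← Real.log_lt_iff_lt_exp (abs_pos.2 h0),
    Real.log_abs] at ht
  have := neg_abs_le (Real.log t)
  linarith

lemma theta_eventuallyEq {n : ℕ} {t : ℝ} (ht : t ≠ 0) :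
    theta n =ᶠ[𝓝 t] fun t => logBump (Real.log t / (n + 1)) := by
  filter_upwards [isOpen_ne.mem_nhds ht] with r hr
  rw [theta, if_neg hr]

lemma hasCompactSupport_theta_mul (n : ℕ) (g : ℝ → ℂ) :
    HasCompactSupport fun t => (theta n t : ℂ) * g t := by
  refine HasCompactSupport.intro (isCompact_closedBall (0 : ℝ) (Real.exp (2 * (n + 1)))) ?_
  intro t ht
  by_cases h : theta n t = 0
  · simp [h]
  obtain ⟨h0, h1⟩ := abs_log_lt_of_theta_ne_zero h
  exfalso; apply ht
  rw [mem_closedBall_zero_iff, Real.norm_eq_abs, ← Real.log_le_iff_le_exp (abs_pos.2 h0),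
    Real.log_abs]
  exact (le_abs_self _).trans h1.le

lemma contDiff_theta_mul (n : ℕ) {g : ℝ → ℂ} (hg : ∀ t ≠ 0, ContDiffAt ℝ ∞ g t) :
    ContDiff ℝ ∞ fun t => (theta n t : ℂ) * g t := by
  rw [contDiff_iff_contDiffAt]
  intro t
  by_cases ht : t = 0
  · subst ht
    refine (contDiffAt_const (c := (0 : ℂ))).congr_of_eventuallyEq ?_
    filter_upwards [theta_eq_zero_near (n := n)] with t ht
    simp [ht]
  · refine ContDiffAt.mul ?_ (hg t ht)
    have h1 : ContDiffAt ℝ ∞ (theta n) t := by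
      refine ContDiffAt.congr_of_eventuallyEq ?_ (theta_eventuallyEq ht)
      exact logBump.contDiff.contDiffAt.comp t
        ((Real.contDiffAt_log.2 ht).div_const _)
    exact Complex.ofRealCLM.contDiff.contDiffAt.comp t h1

lemma hasTemperateGrowth_theta_mul (n : ℕ) {g : ℝ → ℂ} (hg : ∀ t ≠ 0, ContDiffAt ℝ ∞ g t) :
    (fun x : E d => (theta n (tCoord x) : ℂ) * g (tCoord x)).HasTemperateGrowth :=
  ((hasCompactSupport_theta_mul n g).hasTemperateGrowth (contDiff_theta_mul n hg)).comp
    hasTemperateGrowth_tCoord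

lemma exists_deriv_theta_bound : ∃ C : ℝ≥0, ∀ n : ℕ, ∀ t ≠ 0,
    ∃ θ' : ℝ, HasDerivAt (theta n) θ' t ∧ |t * θ'| ≤ C / (n + 1) := by
  have hc : Continuous (deriv logBump) := logBump.contDiff (n := 1) |>.continuous_deriv le_rfl
  obtain ⟨C, hC⟩ := hc.bounded_above_of_compact_support logBump.hasCompactSupport.deriv
  refine ⟨C.toNNReal, fun n t ht => ?_⟩
  have h1 : HasDerivAt (fun t => logBump (Real.log t / (n + 1)))
      (deriv logBump (Real.log t / (n + 1)) * (t⁻¹ / (n + 1))) t := by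
    have h0 : HasDerivAt logBump (deriv logBump (Real.log t / (n + 1))) (Real.log t / (n + 1)) :=
      ((logBump.contDiff (n := 1)).differentiable one_ne_zero _).hasDerivAt
    exact HasDerivAt.comp (h₂ := logBump) t h0 ((Real.hasDerivAt_log ht).div_const _)
  refine ⟨_, h1.congr_of_eventuallyEq (theta_eventuallyEq ht), ?_⟩
  have h2 : t * (deriv logBump (Real.log t / (n + 1)) * (t⁻¹ / (n + 1)))
      = deriv logBump (Real.log t / (n + 1)) / (n + 1) := by
    field_simp
  have h3 : (0 : ℝ) < n + 1 := by positivity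
  rw [h2, abs_div, abs_of_pos h3]
  gcongr
  exact (hC _).trans (Real.le_coe_toNNReal C)

/-- Multiplication of Schwartz functions by `θₙ(t) g(t)`, for `g` smooth off `0` (a junk value
otherwise). -/
noncomputable def annMul (n : ℕ) (g : ℝ → ℂ) : 𝓢(E d, ℂ) →L[ℂ] 𝓢(E d, ℂ) :=
  SchwartzMap.smulLeftCLM ℂ (fun x : E d => (theta n (tCoord x) : ℂ) * g (tCoord x))

lemma annMul_apply (n : ℕ) {g : ℝ → ℂ} (hg : ∀ t ≠ 0, ContDiffAt ℝ ∞ g t) (φ : 𝓢(E d, ℂ))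
    (x : E d) : annMul n g φ x = (theta n (tCoord x) : ℂ) * g (tCoord x) * φ x := by
  rw [annMul, SchwartzMap.smulLeftCLM_apply_apply (hasTemperateGrowth_theta_mul n hg), smul_eq_mul]

/-- The cutoff `φ ↦ θₙ(t) φ`. -/
noncomputable abbrev annCut (n : ℕ) : 𝓢(E d, ℂ) →L[ℂ] 𝓢(E d, ℂ) := annMul n (fun _ => 1)

@[simp] lemma annCut_apply (n : ℕ) (φ : 𝓢(E d, ℂ)) (x : E d) :
    annCut n φ x = (theta n (tCoord x) : ℂ) * φ x := by
  rw [annMul_apply n (fun _ _ => contDiffAt_const)]; simp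

/-- Schwartz functions supported in `e⁻ⁿ ≤ |t| ≤ eⁿ` for some `n`. -/
def annular (d : ℕ) : Submodule ℂ 𝓢(E d, ℂ) where
  carrier := {φ | ∃ n : ℕ, ∀ x, φ x ≠ 0 → tCoord x ≠ 0 ∧ |Real.log (tCoord x)| ≤ n}
  add_mem' := by
    rintro φ ψ ⟨n, hn⟩ ⟨m, hm⟩
    refine ⟨max n m, fun x hx => ?_⟩
    by_cases h : φ x = 0
    · have : ψ x ≠ 0 := by
        intro h'; apply hx; simp [h, h']
      exact ⟨(hm x this).1, (hm x this).2.trans (by simp)⟩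
    · exact ⟨(hn x h).1, (hn x h).2.trans (by simp)⟩
  zero_mem' := ⟨0, fun x hx => (hx rfl).elim⟩
  smul_mem' := by
    rintro c φ ⟨n, hn⟩
    exact ⟨n, fun x hx => hn x (fun h => hx (by simp [h]))⟩

lemma annMul_mem_annular (n : ℕ) {g : ℝ → ℂ} (hg : ∀ t ≠ 0, ContDiffAt ℝ ∞ g t)
    (φ : 𝓢(E d, ℂ)) : annMul n g φ ∈ annular d := by
  refine ⟨2 * (n + 1), fun x hx => ?_⟩
  rw [annMul_apply n hg] at hx
  have : theta n (tCoord x) ≠ 0 := by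
    intro h; simp [h] at hx
  obtain ⟨h0, h1⟩ := abs_log_lt_of_theta_ne_zero this
  exact ⟨h0, by push_cast; exact h1.le⟩

lemma annCut_mem_annular (n : ℕ) (φ : 𝓢(E d, ℂ)) : annCut n φ ∈ annular d :=
  annMul_mem_annular n (fun _ _ => contDiffAt_const) φ

lemma exists_annMul_apply_of_annular {φ : 𝓢(E d, ℂ)} (hφ : φ ∈ annular d) :
    ∃ n₀ : ℕ, ∀ n ≥ n₀, ∀ g : ℝ → ℂ, (∀ t ≠ 0, ContDiffAt ℝ ∞ g t) →
      ∀ x, annMul n g φ x = g (tCoord x) * φ x := by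
  obtain ⟨n₀, hn⟩ := hφ
  refine ⟨n₀, fun n hn' g hg x => ?_⟩
  rw [annMul_apply n hg]
  by_cases h : φ x = 0
  · simp [h]
  · have : (n₀ : ℝ) ≤ n := by exact_mod_cast hn'
    rw [theta_eq_one (hn x h).1 ((hn x h).2.trans (by linarith))]; simp

lemma annular_apply_eq_zero {φ : 𝓢(E d, ℂ)} (hφ : φ ∈ annular d) {x : E d} (hx : tCoord x = 0) :
    φ x = 0 := by
  obtain ⟨n, hn⟩ := hφ
  by_contra h
  exact (hn x h).1 hx

/-! #### Complex powers of `|t|` -/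

/-- The complex power `|t|^z`. At `t = 0` it is `0` or `1`; this value is immaterial, since
`t = 0` is a null set. -/
noncomputable def pw (z : ℂ) (t : ℝ) : ℂ := ((|t| : ℝ) : ℂ) ^ z

lemma pw_eq_exp (z : ℂ) {t : ℝ} (ht : t ≠ 0) : pw z t = Complex.exp (Real.log t * z) := by
  rw [pw, Complex.cpow_def_of_ne_zero (by simpa using ht), ← Complex.ofReal_log (abs_nonneg t),
    Real.log_abs]

lemma contDiffAt_pw (z : ℂ) (t : ℝ) (ht : t ≠ 0) : ContDiffAt ℝ ∞ (pw z) t := by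
  have h : pw z =ᶠ[𝓝 t] fun t => Complex.exp (Real.log t * z) := by
    filter_upwards [isOpen_ne.mem_nhds ht] with r hr using pw_eq_exp z hr
  refine ContDiffAt.congr_of_eventuallyEq ?_ h
  have h1 : ContDiffAt ℝ ∞ (fun t : ℝ => ((Real.log t : ℝ) : ℂ)) t :=
    Complex.ofRealCLM.contDiff.contDiffAt.comp t (Real.contDiffAt_log.2 ht)
  exact (h1.mul contDiffAt_const).cexp

lemma norm_pw (z : ℂ) {t : ℝ} (ht : t ≠ 0) : ‖pw z t‖ = |t| ^ z.re := by
  rw [pw, Complex.norm_cpow_eq_rpow_re_of_pos (abs_pos.2 ht)]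

lemma pw_add (z w : ℂ) {t : ℝ} (ht : t ≠ 0) : pw (z + w) t = pw z t * pw w t := by
  rw [pw, Complex.cpow_add _ _ (by simpa using ht)]; rfl

@[simp] lemma pw_zero (t : ℝ) : pw 0 t = 1 := by simp [pw]

lemma pw_one (t : ℝ) : pw 1 t = |t| := by simp [pw]

lemma pw_neg_mul_pw (z : ℂ) {t : ℝ} (ht : t ≠ 0) : pw (-z) t * pw z t = 1 := by
  rw [← pw_add _ _ ht]; simp

lemma pw_ofReal (r t : ℝ) : pw r t = ((|t| ^ r : ℝ) : ℂ) := by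
  rw [pw, Complex.ofReal_cpow (abs_nonneg t)]

@[fun_prop]
lemma measurable_pw (z : ℂ) : Measurable (pw z) := by
  unfold pw; fun_prop

/-! ### Weighted `L²` norms and annular test functions -/

/-- The `L²` norm of a function on `ℝ^{2d+1}`. -/
noncomputable abbrev l2 (f : E d → ℂ) : ℝ≥0∞ := eLpNorm f 2 volume

/-- The product `|t|^z f`. -/
noncomputable def wt (z : ℂ) (f : E d → ℂ) : E d → ℂ := fun x => pw z (tCoord x) * f x

lemma eLpNorm_two_sq {α F : Type*} [MeasurableSpace α] [NormedAddCommGroup F] (μ : Measure α)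
    (f : α → F) : eLpNorm f 2 μ ^ 2 = ∫⁻ x, ‖f x‖ₑ ^ 2 ∂μ := by
  have := eLpNorm_nnreal_pow_eq_lintegral (f := f) (μ := μ) (p := 2) two_ne_zero
  simpa using this

lemma l2_le_of_sq_le {f : E d → ℂ} {M : ℝ≥0∞} (h : l2 f ^ 2 ≤ M ^ 2) : l2 f ≤ M :=
  (ENNReal.pow_le_pow_left_iff two_ne_zero).1 h

lemma enorm_integral_mul_le {f g : E d → ℂ} (hf : AEStronglyMeasurable f)
    (hg : AEStronglyMeasurable g) : ‖∫ x, f x * g x‖ₑ ≤ l2 f * l2 g := by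
  have h1 := eLpNorm_smul_le_mul_eLpNorm (p := 2) (q := 2) (r := 1) (μ := volume) hg hf
  rw [eLpNorm_one_eq_lintegral_enorm] at h1
  exact (enorm_integral_le_lintegral_enorm _).trans h1

lemma integrable_mul_of_memLp {f g : E d → ℂ} (hf : MemLp f 2) (hg : MemLp g 2) :
    Integrable fun x => f x * g x := hf.integrable_mul hg

lemma enorm_toLp (φ : 𝓢(E d, ℂ)) : ‖φ.toLp 2 (volume : Measure (E d))‖ₑ = l2 φ := by
  rw [Lp.enorm_def, eLpNorm_congr_ae (φ.coeFn_toLp 2 volume)]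

lemma l2_mono {f g : E d → ℂ} (h : ∀ᵐ x, ‖f x‖ ≤ ‖g x‖) : l2 f ≤ l2 g := eLpNorm_mono_ae h

lemma l2_const_mul (c : ℂ) (f : E d → ℂ) : l2 (fun x => c * f x) = ‖c‖ₑ * l2 f :=
  eLpNorm_const_smul c f 2 volume

lemma aestronglyMeasurable_pw (z : ℂ) :
    AEStronglyMeasurable (fun x : E d => pw z (tCoord x)) volume :=
  ((measurable_pw z).comp measurable_tCoord).aestronglyMeasurable

lemma aestronglyMeasurable_wt (z : ℂ) {f : E d → ℂ} (hf : AEStronglyMeasurable f) :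
    AEStronglyMeasurable (wt z f) := (aestronglyMeasurable_pw z).mul hf

lemma aestronglyMeasurable_schwartz (φ : 𝓢(E d, ℂ)) :
    AEStronglyMeasurable (φ : E d → ℂ) volume := φ.continuous.aestronglyMeasurable

lemma wt_wt (z w : ℂ) (f : E d → ℂ) : wt z (wt w f) =ᵐ[volume] wt (z + w) f := by
  filter_upwards [ae_tCoord_ne_zero] with x hx
  simp only [wt]; rw [pw_add z w hx, mul_assoc]

lemma wt_zero (f : E d → ℂ) : wt 0 f = f := by ext; simp [wt]

lemma wt_neg_wt (z : ℂ) (f : E d → ℂ) : wt (-z) (wt z f) =ᵐ[volume] f := by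
  have := wt_wt (-z) z f
  simpa [wt_zero] using this

lemma wt_wt_neg (z : ℂ) (f : E d → ℂ) : wt z (wt (-z) f) =ᵐ[volume] f := by
  have := wt_wt z (-z) f
  simpa [wt_zero] using this

lemma l2_wt_congr_re {z w : ℂ} (h : z.re = w.re) (f : E d → ℂ) : l2 (wt z f) = l2 (wt w f) := by
  refine eLpNorm_congr_norm_ae ?_
  filter_upwards [ae_tCoord_ne_zero] with x hx
  simp only [wt, norm_mul, norm_pw _ hx, h]

lemma l2_wt_one (f : E d → ℂ) : l2 (wt 1 f) = l2 fun x => (tCoord x : ℂ) * f x := by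
  refine eLpNorm_congr_norm_ae (ae_of_all _ fun x => ?_)
  simp [wt, pw_one]

lemma lintegral_weight_eq (s : ℝ) (f : E d → ℂ) :
    ∫⁻ x in {x : E d | tCoord x ≠ 0}, ‖f x‖ₑ ^ 2 * ENNReal.ofReal (|tCoord x| ^ (-2 * s))
      = l2 (wt (-s) f) ^ 2 := by
  rw [eLpNorm_two_sq]
  have hm : MeasurableSet {x : E d | tCoord x ≠ 0} :=
    (measurable_tCoord (measurableSet_singleton 0)).compl
  rw [setLIntegral_congr_fun (g := fun x => ‖wt (-s) f x‖ₑ ^ 2) hm]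
  · rw [Measure.restrict_eq_self_of_ae_mem]
    exact ae_tCoord_ne_zero
  · intro x hx
    simp only [wt, enorm_mul, mul_pow]
    rw [mul_comm]
    congr 1
    rw [← ofReal_norm, norm_pw _ hx, ← ENNReal.ofReal_pow (by positivity), ← Real.rpow_natCast,
      ← Real.rpow_mul (abs_nonneg _)]
    congr 2
    simp; ring

lemma weightedSq_eq (s : ℝ) (u : 𝓢'(E d, ℂ)) :
    weightedSq s u = ⨅ (f : E d → ℂ) (_ : IsRepresentedBy u f), l2 (wt (-s) f) ^ 2 := by
  simp_rw [weightedSq, lintegral_weight_eq]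

@[fun_prop]
lemma measurable_theta (n : ℕ) : Measurable (theta n) := by
  unfold theta
  exact Measurable.ite (measurableSet_singleton 0) measurable_const
    (logBump.continuous.measurable.comp (Real.measurable_log.div_const _))

/-- Logarithmic cutoffs near `t = 0` and `t = ∞` change an `L²` function little. -/
lemma tendsto_l2_one_sub_theta {f : E d → ℂ} (hf : MemLp f 2) :
    Tendsto (fun n => l2 fun x => (1 - theta n (tCoord x) : ℂ) * f x) atTop (𝓝 0) := by
  have h : Tendsto (fun n : ℕ => ∫⁻ x : E d, ‖(1 - theta n (tCoord x) : ℂ) * f x‖ₑ ^ 2) atTop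
      (𝓝 (∫⁻ _ : E d, 0)) := by
    refine tendsto_lintegral_of_dominated_convergence' (fun x => ‖f x‖ₑ ^ 2) ?_ ?_ ?_ ?_
    · intro n
      have h2 : Measurable fun x : E d => (1 - theta n (tCoord x) : ℂ) :=
        measurable_const.sub (Complex.measurable_ofReal.comp
          ((measurable_theta n).comp measurable_tCoord))
      exact (h2.aemeasurable.mul hf.1.aemeasurable).enorm.pow_const 2
    · intro n
      refine ae_of_all _ fun x => ?_
      refine pow_le_pow_left' ?_ 2
      rw [enorm_mul]
      refine mul_le_of_le_one_left' ?_
      rw [← ofReal_norm, ← Complex.ofReal_one, ← Complex.ofReal_sub, Complex.norm_real,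
        Real.norm_eq_abs, ENNReal.ofReal_le_one, abs_of_nonneg (sub_nonneg.2 (theta_le_one _ _))]
      linarith [theta_nonneg n (tCoord x)]
    · rw [← eLpNorm_two_sq]
      exact ENNReal.pow_ne_top hf.2.ne
    · filter_upwards [ae_tCoord_ne_zero] with x hx
      refine tendsto_const_nhds.congr' ?_
      filter_upwards [eventually_theta_eq_one hx] with n hn
      simp [hn]
  have h2 : Tendsto (fun n : ℕ => (l2 fun x : E d => (1 - theta n (tCoord x) : ℂ) * f x) ^ 2)
      atTop (𝓝 0) := by
    simp_rw [eLpNorm_two_sq]; simpa using h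
  have h3 := (ENNReal.continuous_rpow_const (y := (1 / 2 : ℝ))).tendsto 0 |>.comp h2
  simp only [ENNReal.zero_rpow_of_pos (show (0 : ℝ) < 1 / 2 by norm_num)] at h3
  refine h3.congr fun n => ?_
  simp only [Function.comp, ← ENNReal.rpow_natCast, ← ENNReal.rpow_mul]
  norm_num

/-- On annular functions the weight `|t|^z` acts within the Schwartz space. -/
lemma exists_schwartz_wt (z : ℂ) {φ : 𝓢(E d, ℂ)} (hφ : φ ∈ annular d) :
    ∃ ψ ∈ annular d, (ψ : E d → ℂ) = wt z φ := by
  obtain ⟨n, hn⟩ := exists_annMul_apply_of_annular hφ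
  refine ⟨annMul n (pw z) φ, annMul_mem_annular n (contDiffAt_pw z) φ, ?_⟩
  ext x
  exact hn n le_rfl _ (contDiffAt_pw z) x

lemma memLp_wt_annular (z : ℂ) {φ : 𝓢(E d, ℂ)} (hφ : φ ∈ annular d) : MemLp (wt z φ) 2 := by
  obtain ⟨ψ, -, hψ⟩ := exists_schwartz_wt z hφ
  rw [← hψ]; exact ψ.memLp 2

/-- The class of `|t|^z φ` in `L²`, for annular `φ`. -/
noncomputable def wtToLp (z : ℂ) : annular d →ₗ[ℂ] Lp ℂ 2 (volume : Measure (E d)) where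
  toFun φ := (memLp_wt_annular z φ.2).toLp
  map_add' φ ψ := by
    rw [← MemLp.toLp_add]
    refine MemLp.toLp_congr _ _ (ae_of_all _ fun x => ?_)
    simp [wt, mul_add]
  map_smul' c φ := by
    rw [RingHom.id_apply, ← MemLp.toLp_const_smul]
    refine MemLp.toLp_congr _ _ (ae_of_all _ fun x => ?_)
    simp [wt]; ring

lemma enorm_wtToLp (z : ℂ) (φ : annular d) : ‖wtToLp z φ‖ₑ = l2 (wt z (φ : 𝓢(E d, ℂ))) :=
  Lp.enorm_toLp (hf := memLp_wt_annular z φ.2)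

lemma wtToLp_apply (z : ℂ) (φ : annular d) : wtToLp z φ = (memLp_wt_annular z φ.2).toLp := rfl

/-- A Schwartz function `ψ` is the limit in `L²` of `|t|^z φₙ` with `φₙ = θₙ(t) |t|^{-z} ψ`
annular. -/
lemma denseRange_wtToLp (z : ℂ) : DenseRange (wtToLp (d := d) z) := by
  have h : Set.range (SchwartzMap.toLpCLM ℝ ℂ 2 (volume : Measure (E d)))
      ⊆ closure (Set.range (wtToLp (d := d) z)) := by
    rintro _ ⟨ψ, rfl⟩
    have hmem : ∀ n, annMul n (pw (-z)) ψ ∈ annular d :=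
      fun n => annMul_mem_annular n (contDiffAt_pw (-z)) ψ
    refine mem_closure_of_tendsto (f := fun n => wtToLp z ⟨_, hmem n⟩) (b := atTop) ?_
      (Eventually.of_forall fun n => Set.mem_range_self _)
    rw [tendsto_iff_edist_tendsto_0]
    refine (tendsto_l2_one_sub_theta (ψ.memLp 2)).congr fun n => ?_
    rw [edist_comm, SchwartzMap.toLpCLM_apply, wtToLp_apply, SchwartzMap.toLp,
      Lp.edist_toLp_toLp]
    refine eLpNorm_congr_ae ?_
    filter_upwards [ae_tCoord_ne_zero] with x hx
    have h1 := pw_neg_mul_pw z hx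
    simp only [Pi.sub_apply, wt, annMul_apply n (contDiffAt_pw (-z))]
    linear_combination (theta n (tCoord x) : ℂ) * ψ x * h1
  have h2 := SchwartzMap.denseRange_toLpCLM (F := ℂ) (E := E d) (p := 2) (by simp)
    (μ := volume)
  intro x
  exact closure_minimal h isClosed_closure (h2 x)

/-- Riesz representation on weighted `L²`: a linear functional on the annular functions which is
bounded by the norm of `L²(|t|^{2 Re z})` is integration against `|t|^z k`, with `k ∈ L²`. -/
theorem exists_memLp_of_annular_bound (L : 𝓢(E d, ℂ) →ₗ[ℂ] ℂ) (z : ℂ) (M : ℝ≥0)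
    (h : ∀ φ ∈ annular d, ‖L φ‖ₑ ≤ M * l2 (wt z φ)) :
    ∃ k : E d → ℂ, MemLp k 2 ∧ l2 k ≤ M ∧ ∀ φ ∈ annular d, L φ = ∫ x, φ x * wt z k x := by
  set f : annular d →ₗ[ℂ] ℂ := L ∘ₗ (annular d).subtype with hf
  have hb : ∀ φ : annular d, ‖f φ‖ ≤ M * ‖wtToLp z φ‖ := by
    intro φ
    have h1 := h φ φ.2
    rw [← enorm_wtToLp z φ] at h1
    rw [← ofReal_norm, ← ofReal_norm, ← ENNReal.ofReal_coe_nnreal,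
      ← ENNReal.ofReal_mul (by positivity)] at h1
    exact (ENNReal.ofReal_le_ofReal_iff (by positivity)).1 h1
  set ℓ : Lp ℂ 2 (volume : Measure (E d)) →L[ℂ] ℂ := f.extendOfNorm (wtToLp z) with hℓ
  have hℓ1 : ∀ φ : annular d, ℓ (wtToLp z φ) = L φ := fun φ =>
    LinearMap.extendOfNorm_eq (denseRange_wtToLp z) ⟨M, hb⟩ φ
  have hℓ2 : ‖ℓ‖ ≤ M := LinearMap.opNorm_extendOfNorm_le (denseRange_wtToLp z) M.2 hb
  set y := (InnerProductSpace.toDual ℂ (Lp ℂ 2 (volume : Measure (E d)))).symm ℓ with hy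
  have hk : MemLp (star (y : E d → ℂ)) 2 := (Lp.memLp y).star
  refine ⟨star (y : E d → ℂ), hk, ?_, ?_⟩
  · rw [l2, eLpNorm_congr_norm_ae (g := y) (ae_of_all _ fun x => by simp), ← Lp.enorm_def,
      ← ofReal_norm, hy, LinearIsometryEquiv.norm_map]
    exact (ENNReal.ofReal_le_ofReal hℓ2).trans (by simp)
  · intro φ hφ
    rw [← hℓ1 ⟨φ, hφ⟩, ← InnerProductSpace.toDual_symm_apply, ← hy, L2.inner_def]
    refine integral_congr_ae ?_
    filter_upwards [(memLp_wt_annular z hφ).coeFn_toLp] with x hx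
    change inner ℂ (y x) (((memLp_wt_annular z hφ).toLp : E d → ℂ) x) = _
    rw [hx]
    simp only [wt, RCLike.inner_apply, Pi.star_apply, RCLike.star_def]
    ring

/-! #### Functions determined by their annular moments -/

lemma annular_of_hasCompactSupport {g : E d → ℂ} (hg : ContDiff ℝ ∞ g) (hc : HasCompactSupport g)
    (hU : tsupport g ⊆ {x | tCoord x ≠ 0}) : hc.toSchwartzMap hg ∈ annular d := by
  have h1 : ContinuousOn (fun x : E d => |Real.log (tCoord x)|) (tsupport g) := by
    refine ContinuousOn.abs (ContinuousOn.log continuous_tCoord.continuousOn ?_)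
    intro x hx; exact hU hx
  obtain ⟨C, hC⟩ := hc.isCompact.bddAbove_image h1
  refine ⟨⌈C⌉₊, fun x hx => ?_⟩
  have hx' : x ∈ tsupport g := subset_tsupport g hx
  exact ⟨hU hx', (hC ⟨x, hx', rfl⟩).trans (Nat.le_ceil C)⟩

lemma locallyIntegrable_of_forall_integrable {f : E d → ℂ}
    (hf : ∀ φ : 𝓢(E d, ℂ), Integrable fun x => φ x * f x) : LocallyIntegrable f := by
  intro x
  let b : ContDiffBump x := ⟨1, 2, one_pos, one_lt_two⟩
  have hb1 : HasCompactSupport (Complex.ofRealCLM ∘ b) := b.hasCompactSupport.comp_left rfl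
  have hb2 : ContDiff ℝ ∞ (Complex.ofRealCLM ∘ b) := Complex.ofRealCLM.contDiff.comp b.contDiff
  refine ⟨Metric.closedBall x 1, Metric.closedBall_mem_nhds x one_pos, ?_⟩
  refine ((hf (hb1.toSchwartzMap hb2)).integrableOn (s := Metric.closedBall x 1)).congr_fun ?_
    Metric.isClosed_closedBall.measurableSet
  intro y hy
  have : b y = 1 := b.one_of_mem_closedBall hy
  simp [this]

/-- Annular moments determine a function: the hyperplane `t = 0` is a null set. -/
theorem ae_eq_zero_of_annular {f : E d → ℂ}
    (hf : ∀ φ : 𝓢(E d, ℂ), Integrable fun x => φ x * f x)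
    (h0 : ∀ φ ∈ annular d, ∫ x, φ x * f x = 0) : f =ᵐ[volume] 0 := by
  have hU : IsOpen {x : E d | tCoord x ≠ 0} := isOpen_ne_fun continuous_tCoord continuous_const
  have h := hU.ae_eq_zero_of_integral_contDiff_smul_eq_zero (μ := volume) (f := f)
    ((locallyIntegrable_of_forall_integrable hf).locallyIntegrableOn _) ?_
  · filter_upwards [h, ae_tCoord_ne_zero] with x hx hx' using hx hx'
  · intro g hg hc hs
    have hc' : HasCompactSupport (Complex.ofRealCLM ∘ g) := hc.comp_left rfl
    have hg' : ContDiff ℝ ∞ (Complex.ofRealCLM ∘ g) := Complex.ofRealCLM.contDiff.comp hg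
    have hs' : tsupport (Complex.ofRealCLM ∘ g) ⊆ {x | tCoord x ≠ 0} :=
      (closure_mono (by intro x hx hx'; apply hx; simp [hx'])).trans hs
    have := h0 _ (annular_of_hasCompactSupport hg' hc' hs')
    simpa using this

theorem ae_eq_of_annular {f g : E d → ℂ}
    (hf : ∀ φ : 𝓢(E d, ℂ), Integrable fun x => φ x * f x)
    (hg : ∀ φ : 𝓢(E d, ℂ), Integrable fun x => φ x * g x)
    (h : ∀ φ ∈ annular d, ∫ x, φ x * f x = ∫ x, φ x * g x) : f =ᵐ[volume] g := by
  have h1 : (fun x => f x - g x) =ᵐ[volume] 0 := by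
    refine ae_eq_zero_of_annular (fun φ => ?_) fun φ hφ => ?_
    · simp_rw [mul_sub]; exact (hf φ).sub (hg φ)
    · simp_rw [mul_sub]
      rw [integral_sub (hf φ) (hg φ), h φ hφ, sub_self]
  filter_upwards [h1] with x hx using sub_eq_zero.1 hx

/-! ### The norms of `A₀`, `A₁`, `A_s` through test functions -/

lemma memLp_schwartz (φ : 𝓢(E d, ℂ)) : MemLp φ 2 (volume : Measure (E d)) := φ.memLp 2

lemma l2_schwartz_lt_top (φ : 𝓢(E d, ℂ)) : l2 φ < ⊤ := (memLp_schwartz φ).2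

/-- Passing to the limit `M → N` in an estimate; used because the norms are infima. -/
lemma le_mul_of_forall_gt {x N l : ℝ≥0∞} (hN : N ≠ ⊤) (hl : l ≠ ⊤)
    (h : ∀ M : ℝ≥0, N < M → x ≤ M * l) : x ≤ N * l := by
  refine ENNReal.le_mul_of_forall_lt (.inr hl) (.inl hN) fun a ha b hb => ?_
  by_cases hat : a = ⊤
  · subst hat
    rw [ENNReal.top_mul (ne_bot_of_gt hb)]; exact le_top
  · lift a to ℝ≥0 using hat
    exact (h a ha).trans (by gcongr)

lemma lp_apply_eq_integral (g : Lp ℂ 2 (volume : Measure (E d))) (φ : 𝓢(E d, ℂ)) :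
    (g : 𝓢'(E d, ℂ)) φ = ∫ x, φ x * g x := by
  simp [Lp.toTemperedDistribution_apply]

lemma fourier_lp_apply (g : Lp ℂ 2 (volume : Measure (E d))) (φ : 𝓢(E d, ℂ)) :
    (𝓕 (g : 𝓢'(E d, ℂ))) φ = ∫ x, φ x * (𝓕 g : Lp ℂ 2 (volume : Measure (E d))) x := by
  rw [Lp.fourier_toTemperedDistribution_eq, lp_apply_eq_integral]

lemma l2_fourier (φ : 𝓢(E d, ℂ)) : l2 (𝓕 φ : 𝓢(E d, ℂ)) = l2 φ := by
  rw [← enorm_toLp, ← enorm_toLp, ← ofReal_norm, ← ofReal_norm, norm_fourier_toL2_eq]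

lemma l2_fourierInv (φ : 𝓢(E d, ℂ)) : l2 (𝓕⁻ φ : 𝓢(E d, ℂ)) = l2 φ := by
  rw [← l2_fourier (𝓕⁻ φ), FourierTransform.fourier_fourierInv_eq]

/-- Multiplication of Schwartz functions by the last coordinate. -/
noncomputable def mulT : 𝓢(E d, ℂ) →L[ℂ] 𝓢(E d, ℂ) :=
  SchwartzMap.smulLeftCLM ℂ (fun x : E d => (tCoord x : ℂ))

lemma hasTemperateGrowth_tCoord_complex :
    (fun x : E d => (tCoord x : ℂ)).HasTemperateGrowth :=
  Function.HasTemperateGrowth.comp (g := Complex.ofRealCLM) Complex.ofRealCLM.hasTemperateGrowth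
    hasTemperateGrowth_tCoord

@[simp] lemma mulT_apply (φ : 𝓢(E d, ℂ)) (x : E d) : mulT φ x = tCoord x * φ x := by
  rw [mulT, SchwartzMap.smulLeftCLM_apply_apply hasTemperateGrowth_tCoord_complex, smul_eq_mul]

lemma smulLeftCLM_inner_tDir (φ : 𝓢(E d, ℂ)) :
    SchwartzMap.smulLeftCLM ℂ (inner ℝ · (tDir d)) φ = mulT φ := by
  have h : (fun x : E d => inner ℝ x (tDir d)) = tCoord := funext inner_tDir
  ext x
  rw [h, SchwartzMap.smulLeftCLM_apply_apply hasTemperateGrowth_tCoord, mulT_apply,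
    Complex.real_smul]

lemma lineDeriv_fourier (φ : 𝓢(E d, ℂ)) :
    ∂_{tDir d} (𝓕 φ : 𝓢(E d, ℂ)) = 𝓕 (-(2 * Real.pi * Complex.I) • mulT φ) := by
  rw [SchwartzMap.lineDerivOp_fourier_eq, smulLeftCLM_inner_tDir]

lemma fourier_lineDeriv (φ : 𝓢(E d, ℂ)) :
    𝓕 (∂_{tDir d} φ : 𝓢(E d, ℂ)) = (2 * Real.pi * Complex.I) • mulT (𝓕 φ) := by
  rw [SchwartzMap.fourier_lineDerivOp_eq, smulLeftCLM_inner_tDir]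

lemma lineDeriv_fourierInv (φ : 𝓢(E d, ℂ)) :
    ∂_{tDir d} (𝓕⁻ φ : 𝓢(E d, ℂ)) = 𝓕⁻ ((2 * Real.pi * Complex.I) • mulT φ) := by
  rw [SchwartzMap.lineDerivOp_fourierInv_eq, smulLeftCLM_inner_tDir]

lemma fourierInv_lineDeriv (φ : 𝓢(E d, ℂ)) :
    𝓕⁻ (∂_{tDir d} φ : 𝓢(E d, ℂ)) = -(2 * Real.pi * Complex.I) • mulT (𝓕⁻ φ) := by
  rw [SchwartzMap.fourierInv_lineDerivOp_eq, smulLeftCLM_inner_tDir]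

lemma enorm_two_pi_I : ‖(2 * Real.pi * Complex.I : ℂ)‖ₑ = ENNReal.ofReal (2 * Real.pi) := by
  rw [← ofReal_norm]; simp [abs_of_pos Real.pi_pos]

lemma l2_smul (c : ℂ) (φ : 𝓢(E d, ℂ)) : l2 (c • φ : 𝓢(E d, ℂ)) = ‖c‖ₑ * l2 φ :=
  l2_const_mul c φ

lemma l2_mulT (φ : 𝓢(E d, ℂ)) : l2 (mulT φ) = l2 (wt 1 φ) := by
  rw [l2_wt_one]; congr 1; ext x; simp

lemma l2_wt_one_fourier_le (φ : 𝓢(E d, ℂ)) :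
    l2 (wt 1 (𝓕 φ : 𝓢(E d, ℂ))) ≤ l2 (∂_{tDir d} φ : 𝓢(E d, ℂ)) := by
  rw [← l2_fourier (∂_{tDir d} φ), fourier_lineDeriv, l2_smul, l2_mulT, enorm_two_pi_I]
  refine le_mul_of_one_le_left' ?_
  rw [ENNReal.one_le_ofReal]
  linarith [Real.pi_gt_three]

/-! #### Elementary bounds on weighted norms of Schwartz functions -/

lemma wt_norm_le {z : ℂ} (h0 : 0 ≤ z.re) (h1 : z.re ≤ 1) (f : E d → ℂ) {x : E d}
    (hx : tCoord x ≠ 0) : ‖wt z f x‖ ≤ ‖f x‖ + ‖wt 1 f x‖ := by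
  simp only [wt, norm_mul, norm_pw _ hx, Complex.one_re, Real.rpow_one]
  have h : |tCoord x| ^ z.re ≤ 1 + |tCoord x| := by
    rcases le_total |tCoord x| 1 with h | h
    · have := Real.rpow_le_one (abs_nonneg (tCoord x)) h h0
      have := abs_nonneg (tCoord x)
      linarith
    · have := Real.rpow_le_rpow_of_exponent_le h h1
      rw [Real.rpow_one] at this
      linarith
  nlinarith [norm_nonneg (f x)]

lemma l2_wt_le {z : ℂ} (h0 : 0 ≤ z.re) (h1 : z.re ≤ 1) {f : E d → ℂ}
    (hf : AEStronglyMeasurable f) : l2 (wt z f) ≤ l2 f + l2 (wt 1 f) := by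
  have h2 := eLpNorm_add_le (p := 2) (μ := volume) hf.norm
    (aestronglyMeasurable_wt 1 hf).norm (by norm_num)
  rw [eLpNorm_norm, eLpNorm_norm] at h2
  refine le_trans ?_ h2
  refine eLpNorm_mono_ae ?_
  filter_upwards [ae_tCoord_ne_zero] with x hx
  refine (wt_norm_le h0 h1 f hx).trans ?_
  exact le_abs_self _

lemma l2_wt_lt_top {z : ℂ} (h0 : 0 ≤ z.re) (h1 : z.re ≤ 1) (φ : 𝓢(E d, ℂ)) :
    l2 (wt z φ) < ⊤ := by
  refine (l2_wt_le h0 h1 (aestronglyMeasurable_schwartz φ)).trans_lt ?_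
  rw [← l2_mulT]
  exact ENNReal.add_lt_top.2 ⟨l2_schwartz_lt_top φ, l2_schwartz_lt_top _⟩

lemma memLp_wt_schwartz {z : ℂ} (h0 : 0 ≤ z.re) (h1 : z.re ≤ 1) (φ : 𝓢(E d, ℂ)) :
    MemLp (wt z φ) 2 :=
  ⟨aestronglyMeasurable_wt z (aestronglyMeasurable_schwartz φ), l2_wt_lt_top h0 h1 φ⟩

lemma mul_ae_eq_wt_mul_wt (z : ℂ) (f g : E d → ℂ) :
    (fun x => f x * g x) =ᵐ[volume] fun x => wt z f x * wt (-z) g x := by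
  filter_upwards [ae_tCoord_ne_zero] with x hx
  simp only [wt]
  linear_combination (-(f x * g x)) * pw_neg_mul_pw z hx

lemma integrable_mul_of_wt {z : ℂ} {f g : E d → ℂ} (hf : MemLp (wt z f) 2)
    (hg : MemLp (wt (-z) g) 2) : Integrable fun x => f x * g x :=
  (integrable_mul_of_memLp hf hg).congr (mul_ae_eq_wt_mul_wt z f g).symm

lemma enorm_integral_mul_le_wt (z : ℂ) {f g : E d → ℂ} (hf : AEStronglyMeasurable f)
    (hg : AEStronglyMeasurable g) : ‖∫ x, f x * g x‖ₑ ≤ l2 (wt z f) * l2 (wt (-z) g) := by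
  rw [integral_congr_ae (mul_ae_eq_wt_mul_wt z f g)]
  exact enorm_integral_mul_le (aestronglyMeasurable_wt z hf) (aestronglyMeasurable_wt _ hg)

lemma aestronglyMeasurable_of_wt {z : ℂ} {f : E d → ℂ} (hf : AEStronglyMeasurable (wt z f)) :
    AEStronglyMeasurable f :=
  (aestronglyMeasurable_wt (-z) hf).congr (wt_neg_wt z f)

lemma memLp_wt_neg_wt {z : ℂ} {k : E d → ℂ} (hk : MemLp k 2) : MemLp (wt (-z) (wt z k)) 2 :=
  (memLp_congr_ae (wt_neg_wt z k)).2 hk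

lemma tendsto_l2_wt_sub_annCut {z : ℂ} (h0 : 0 ≤ z.re) (h1 : z.re ≤ 1) (φ : 𝓢(E d, ℂ)) :
    Tendsto (fun n => l2 (wt z (φ - annCut n φ : 𝓢(E d, ℂ)))) atTop (𝓝 0) := by
  refine (tendsto_l2_one_sub_theta (memLp_wt_schwartz h0 h1 φ)).congr fun n => ?_
  congr 1; ext x
  simp [wt]; ring

/-! #### `L²` -/

/-- A distribution bounded by the `L²` norm of test functions is a function in `L²`. -/
theorem exists_lp_of_bound {u : 𝓢'(E d, ℂ)} {M : ℝ≥0} (h : ∀ φ, ‖u φ‖ₑ ≤ M * l2 φ) :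
    ∃ g : Lp ℂ 2 (volume : Measure (E d)), (g : 𝓢'(E d, ℂ)) = u ∧ ‖g‖ₑ ≤ M := by
  obtain ⟨k, hk, hkM, hkφ⟩ := exists_memLp_of_annular_bound
    ((u : 𝓢(E d, ℂ) →L[ℂ] ℂ) : 𝓢(E d, ℂ) →ₗ[ℂ] ℂ) 0 M (fun φ _ => by rw [wt_zero]; exact h φ)
  refine ⟨hk.toLp, ?_, ?_⟩
  · ext φ
    have hb : ∀ ψ : 𝓢(E d, ℂ), ‖(hk.toLp : 𝓢'(E d, ℂ)) ψ‖ₑ ≤ M * l2 ψ := by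
      intro ψ
      rw [lp_apply_eq_integral]
      refine (enorm_integral_mul_le (aestronglyMeasurable_schwartz ψ)
        (Lp.aestronglyMeasurable _)).trans ?_
      rw [mul_comm, l2, eLpNorm_congr_ae hk.coeFn_toLp]
      gcongr
    have h1 : ∀ n, ‖((hk.toLp : 𝓢'(E d, ℂ)) - u) φ‖ₑ
        ≤ 2 * M * l2 (φ - annCut n φ : 𝓢(E d, ℂ)) := by
      intro n
      have h2 : ((hk.toLp : 𝓢'(E d, ℂ)) - u) (annCut n φ) = 0 := by
        have := hkφ _ (annCut_mem_annular n φ)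
        rw [wt_zero] at this
        have h3 : u (annCut n φ) = ∫ x, annCut n φ x * k x := this
        change (hk.toLp : 𝓢'(E d, ℂ)) (annCut n φ) - u (annCut n φ) = 0
        rw [lp_apply_eq_integral, h3, sub_eq_zero]
        refine integral_congr_ae ?_
        filter_upwards [hk.coeFn_toLp] with x hx
        rw [hx]
      have h3 : ((hk.toLp : 𝓢'(E d, ℂ)) - u) φ
          = (hk.toLp : 𝓢'(E d, ℂ)) (φ - annCut n φ) - u (φ - annCut n φ) := by
        have : ((hk.toLp : 𝓢'(E d, ℂ)) - u) (φ - annCut n φ)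
          = ((hk.toLp : 𝓢'(E d, ℂ)) - u) φ := by rw [map_sub, h2, sub_zero]
        rw [← this]; rfl
      rw [h3]
      refine (enorm_sub_le).trans ((add_le_add (hb _) (h _)).trans ?_)
      exact le_of_eq (by ring)
    have h4 := tendsto_l2_wt_sub_annCut (z := 0) (by simp) (by simp) φ
    simp only [wt_zero] at h4
    have h5 := ENNReal.Tendsto.const_mul h4 (a := 2 * M) (Or.inr (by finiteness))
    rw [mul_zero] at h5
    have h6 := ge_of_tendsto' h5 h1
    rw [nonpos_iff_eq_zero, enorm_eq_zero] at h6
    exact sub_eq_zero.1 h6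
  · rw [Lp.enorm_toLp]; exact hkM

lemma normL2_le_of_bound {u : 𝓢'(E d, ℂ)} {M : ℝ≥0} (h : ∀ φ, ‖u φ‖ₑ ≤ M * l2 φ) :
    normL2 u ≤ M := by
  obtain ⟨g, hg, hM⟩ := exists_lp_of_bound h
  exact (iInf₂_le g hg).trans hM

lemma enorm_apply_le_normL2 {u : 𝓢'(E d, ℂ)} (hu : normL2 u ≠ ⊤) (φ : 𝓢(E d, ℂ)) :
    ‖u φ‖ₑ ≤ normL2 u * l2 φ := by
  refine le_mul_of_forall_gt hu (l2_schwartz_lt_top φ).ne fun M hM => ?_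
  simp only [normL2, iInf_lt_iff] at hM
  obtain ⟨g, hg, hM⟩ := hM
  rw [← hg, lp_apply_eq_integral]
  refine (enorm_integral_mul_le (aestronglyMeasurable_schwartz φ)
        (Lp.aestronglyMeasurable _)).trans ?_
  rw [mul_comm, l2, l2, ← Lp.enorm_def]
  gcongr

/-! #### The weighted part -/

lemma enorm_apply_le_of_weightedSq {s : ℝ} (hs0 : 0 ≤ s) (hs1 : s ≤ 1) {u : 𝓢'(E d, ℂ)}
    {M : ℝ≥0∞} (hM : M ≠ ⊤)
    (h : weightedSq s u ≤ M ^ 2) (φ : 𝓢(E d, ℂ)) : ‖u φ‖ₑ ≤ M * l2 (wt s φ) := by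
  refine le_mul_of_forall_gt hM (l2_wt_lt_top (by simpa) (by simpa) φ).ne fun M' hM' => ?_
  have h' : weightedSq s u < (M' : ℝ≥0∞) ^ 2 :=
    h.trans_lt (ENNReal.pow_lt_pow_left two_ne_zero hM')
  simp only [weightedSq_eq, iInf_lt_iff] at h'
  obtain ⟨f, hf, hM⟩ := h'
  rw [(hf.2 φ).2, mul_comm (M' : ℝ≥0∞)]
  refine (enorm_integral_mul_le_wt s (aestronglyMeasurable_schwartz φ) hf.1).trans ?_
  gcongr
  exact l2_le_of_sq_le hM.le

/-- A tempered distribution which is bounded by the norm of `L²(|t|^{2s})` on Schwartz functions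
is represented by a function in the dual space `L²(|t|^{-2s})`. -/
theorem exists_isRepresentedBy_of_bound {s : ℝ} (hs0 : 0 ≤ s) (hs1 : s ≤ 1) {u : 𝓢'(E d, ℂ)}
    {M : ℝ≥0} (h : ∀ φ, ‖u φ‖ₑ ≤ M * l2 (wt s φ)) :
    ∃ f, IsRepresentedBy u f ∧ MemLp (wt (-s) f) 2 ∧ l2 (wt (-s) f) ≤ M := by
  obtain ⟨k, hk, hkM, hkφ⟩ := exists_memLp_of_annular_bound
    ((u : 𝓢(E d, ℂ) →L[ℂ] ℂ) : 𝓢(E d, ℂ) →ₗ[ℂ] ℂ) s M (fun φ _ => h φ)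
  have hk' : MemLp (wt (-s) (wt s k)) 2 := memLp_wt_neg_wt hk
  have hl : l2 (wt (-s) (wt s k)) = l2 k := eLpNorm_congr_ae (wt_neg_wt _ k)
  refine ⟨wt s k, ⟨aestronglyMeasurable_wt _ hk.1, fun φ => ?_⟩, hk', by rwa [hl]⟩
  have hint : ∀ ψ : 𝓢(E d, ℂ), Integrable fun x => ψ x * wt s k x := fun ψ =>
    integrable_mul_of_wt (memLp_wt_schwartz (by simpa) (by simpa) ψ) hk'
  refine ⟨hint φ, ?_⟩
  have h1 : ∀ n, ‖u φ - ∫ x, φ x * wt s k x‖ₑ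
      ≤ 2 * M * l2 (wt s (φ - annCut n φ : 𝓢(E d, ℂ))) := by
    intro n
    have h2 : u (annCut n φ) = ∫ x, annCut n φ x * wt s k x := hkφ _ (annCut_mem_annular n φ)
    have h3 : u φ - ∫ x, φ x * wt s k x = u (φ - annCut n φ)
        - ∫ x, (φ - annCut n φ : 𝓢(E d, ℂ)) x * wt s k x := by
      simp only [sub_apply, sub_mul, map_sub]
      rw [integral_sub (hint φ) (hint _), h2]; ring
    rw [h3]
    have h4 : ‖∫ x, (φ - annCut n φ : 𝓢(E d, ℂ)) x * wt s k x‖ₑ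
        ≤ M * l2 (wt s (φ - annCut n φ : 𝓢(E d, ℂ))) := by
      refine (enorm_integral_mul_le_wt s (aestronglyMeasurable_schwartz _)
        (aestronglyMeasurable_wt _ hk.1)).trans ?_
      rw [hl, mul_comm]; gcongr
    refine enorm_sub_le.trans ((add_le_add (h _) h4).trans ?_)
    exact le_of_eq (by ring)
  have h4 := tendsto_l2_wt_sub_annCut (z := s) (by simpa) (by simpa) φ
  have h5 := ENNReal.Tendsto.const_mul h4 (a := 2 * M) (Or.inr (by finiteness))
  rw [mul_zero] at h5
  have h6 := ge_of_tendsto' h5 h1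
  rw [nonpos_iff_eq_zero, enorm_eq_zero] at h6
  exact sub_eq_zero.1 h6

lemma weightedSq_le_of_bound {s : ℝ} (hs0 : 0 ≤ s) (hs1 : s ≤ 1) {u : 𝓢'(E d, ℂ)}
    {M : ℝ≥0} (h : ∀ φ, ‖u φ‖ₑ ≤ M * l2 (wt s φ)) : weightedSq s u ≤ M ^ 2 := by
  obtain ⟨f, hf, -, hM⟩ := exists_isRepresentedBy_of_bound hs0 hs1 h
  rw [weightedSq_eq]
  exact (iInf₂_le f hf).trans (by gcongr)

lemma isRepresentedBy_ae_eq {u : 𝓢'(E d, ℂ)} {f g : E d → ℂ} (hf : IsRepresentedBy u f)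
    (hg : IsRepresentedBy u g) : f =ᵐ[volume] g :=
  ae_eq_of_annular (fun φ => (hf.2 φ).1) (fun φ => (hg.2 φ).1)
    fun φ _ => (hf.2 φ).2.symm.trans (hg.2 φ).2

/-- For a distribution that is a function, the weighted norm is detected by annular functions. -/
theorem l2_wt_le_of_annular_bound {s : ℝ} (hs0 : 0 ≤ s) (hs1 : s ≤ 1) {f : E d → ℂ}
    (hf : ∀ φ : 𝓢(E d, ℂ), Integrable fun x => φ x * f x)
    {M : ℝ≥0} (h : ∀ φ ∈ annular d, ‖∫ x, φ x * f x‖ₑ ≤ M * l2 (wt s φ)) :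
    MemLp (wt (-s) f) 2 ∧ l2 (wt (-s) f) ≤ M := by
  let L : 𝓢(E d, ℂ) →ₗ[ℂ] ℂ :=
    { toFun φ := ∫ x, φ x * f x
      map_add' φ ψ := by
        simp only [add_apply, add_mul]
        exact integral_add (hf φ) (hf ψ)
      map_smul' c φ := by
        simp only [smul_apply, smul_eq_mul, mul_assoc, RingHom.id_apply]
        exact integral_const_mul _ _ }
  obtain ⟨k, hk, hkM, hkφ⟩ := exists_memLp_of_annular_bound L s M h
  have hk' : MemLp (wt (-s) (wt s k)) 2 := memLp_wt_neg_wt hk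
  have h1 : f =ᵐ[volume] wt s k := ae_eq_of_annular hf
    (fun ψ => integrable_mul_of_wt (memLp_wt_schwartz (by simpa) (by simpa) ψ) hk') hkφ
  have h2 : wt (-s) f =ᵐ[volume] k := by
    refine EventuallyEq.trans ?_ (wt_neg_wt (s : ℂ) k)
    filter_upwards [h1] with x hx
    simp [wt, hx]
  exact ⟨(memLp_congr_ae h2).2 hk, by rwa [l2, eLpNorm_congr_ae h2]⟩

/-! #### The derivative -/

lemma isFracDeriv_one_iff {u : 𝓢'(E d, ℂ)} {g : Lp ℂ 2 (volume : Measure (E d))} :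
    IsFracDeriv 1 u g ↔ ∂_{tDir d} u = (g : 𝓢'(E d, ℂ)) := by simp [IsFracDeriv]

lemma enorm_apply_lineDeriv_le {u : 𝓢'(E d, ℂ)} {M : ℝ≥0∞} (hM : M ≠ ⊤)
    (h : fracDerivSq 1 u ≤ M ^ 2) (φ : 𝓢(E d, ℂ)) :
    ‖u (∂_{tDir d} φ)‖ₑ ≤ M * l2 φ := by
  refine le_mul_of_forall_gt hM (l2_schwartz_lt_top φ).ne fun M' hM' => ?_
  have h' : fracDerivSq 1 u < (M' : ℝ≥0∞) ^ 2 :=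
    h.trans_lt (ENNReal.pow_lt_pow_left two_ne_zero hM')
  simp only [fracDerivSq, iInf_lt_iff, isFracDeriv_one_iff] at h'
  obtain ⟨g, hg, hM⟩ := h'
  have h1 : u (∂_{tDir d} φ) = - (g : 𝓢'(E d, ℂ)) φ := by
    rw [← hg, TemperedDistribution.lineDerivOp_apply_apply, map_neg, neg_neg]
  rw [h1, enorm_neg, lp_apply_eq_integral]
  refine (enorm_integral_mul_le (aestronglyMeasurable_schwartz φ)
        (Lp.aestronglyMeasurable _)).trans ?_
  rw [mul_comm, l2, l2, ← Lp.enorm_def]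
  gcongr
  exact ((ENNReal.pow_lt_pow_left_iff two_ne_zero).1 hM).le

lemma fracDerivSq_one_le_of_bound {u : 𝓢'(E d, ℂ)} {M : ℝ≥0}
    (h : ∀ φ : 𝓢(E d, ℂ), ‖u (∂_{tDir d} φ)‖ₑ ≤ M * l2 φ) : fracDerivSq 1 u ≤ M ^ 2 := by
  obtain ⟨g, hg, hM⟩ := exists_lp_of_bound (u := ∂_{tDir d} u) (M := M) (fun φ => by
    rw [TemperedDistribution.lineDerivOp_apply_apply, map_neg, enorm_neg]; exact h φ)
  refine (iInf₂_le g (isFracDeriv_one_iff.2 hg.symm)).trans ?_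
  gcongr

/-- On annular functions the Fourier transform of `u` with `∂ₜ u ∈ L²` is bounded by the norm of
`L²(|t|^{-2})`. -/
lemma enorm_fourier_apply_le_of_fracDerivSq {u : 𝓢'(E d, ℂ)} {M : ℝ≥0∞} (hM : M ≠ ⊤)
    (h : fracDerivSq 1 u ≤ M ^ 2) {φ : 𝓢(E d, ℂ)} (hφ : φ ∈ annular d) :
    ‖(𝓕 u) φ‖ₑ ≤ M * l2 (wt (-1) φ) := by
  -- `𝓕 φ` is the derivative of the transform of `η = φ / (-2πi t)`
  obtain ⟨n, hn⟩ := exists_annMul_apply_of_annular hφ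
  have hg : ∀ t : ℝ, t ≠ 0 →
      ContDiffAt ℝ ∞ (fun t : ℝ => ((-(2 * Real.pi * Complex.I) * t)⁻¹ : ℂ)) t := by
    intro t ht
    refine ContDiffAt.inv (contDiffAt_const.mul Complex.ofRealCLM.contDiff.contDiffAt) ?_
    simp [ht, Real.pi_ne_zero]
  set η := annMul n (fun t : ℝ => ((-(2 * Real.pi * Complex.I) * t)⁻¹ : ℂ)) φ with hη
  have hη1 : ∀ x, η x = (-(2 * Real.pi * Complex.I) * tCoord x)⁻¹ * φ x := hn n le_rfl _ hg
  have h1 : 𝓕 φ = ∂_{tDir d} (𝓕 η) := by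
    rw [lineDeriv_fourier]
    congr 1; ext x
    simp only [smul_apply, mulT_apply, hη1, smul_eq_mul]
    by_cases hx : tCoord x = 0
    · rw [annular_apply_eq_zero hφ hx]; simp
    · have : (tCoord x : ℂ) ≠ 0 := by exact_mod_cast hx
      have : (Real.pi : ℂ) ≠ 0 := by exact_mod_cast Real.pi_ne_zero
      field_simp [Complex.I_ne_zero]
  rw [TemperedDistribution.fourier_apply, h1]
  refine (enorm_apply_lineDeriv_le hM h _).trans ?_
  rw [l2_fourier]
  gcongr
  refine eLpNorm_mono_ae ?_
  filter_upwards [ae_tCoord_ne_zero] with x hx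
  rw [hη1]
  simp only [wt, norm_mul, norm_inv, norm_neg, Complex.norm_I, norm_pw _ hx, Complex.neg_re,
    Complex.one_re, Real.rpow_neg_one, Complex.norm_real, Real.norm_eq_abs, mul_one,
    abs_of_pos Real.pi_pos, RCLike.norm_ofNat]
  gcongr
  nlinarith [Real.pi_gt_three, abs_pos.2 hx]

end HardySobolev

namespace ComplexInterpolation

section ThreeLines

variable {V : Type*} [AddCommGroup V] [Module ℂ V]

/-! ### The three lines theorem for admissible functions -/

lemma mem_strip_of_mem_openStrip {z : ℂ} (hz : z ∈ openStrip) : z ∈ strip :=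
  ⟨hz.1.le, hz.2.le⟩

lemma isOpen_openStrip : IsOpen openStrip :=
  (isOpen_lt continuous_const Complex.continuous_re).inter
    (isOpen_lt Complex.continuous_re continuous_const)

/-- If the functionals `L w` are bounded for the norm of `A₀ + A₁`, uniformly on the strip, and
depend holomorphically on `w`, then a bound for `L w (F w)` on the boundary lines holds inside. -/
theorem norm_le_of_isAdmissible {N₀ N₁ : V → ℝ≥0∞} {F : ℂ → V} (hF : IsAdmissible N₀ N₁ F)
    {L : ℂ → V →ₗ[ℂ] ℂ} {C : ℝ≥0} (hC : ∀ w ∈ strip, ∀ v, ‖L w v‖ₑ ≤ C * sumNorm N₀ N₁ v)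
    (hd : ∀ v, sumNorm N₀ N₁ v < ⊤ → Differentiable ℂ fun w => L w v) {M : ℝ}
    (h0 : ∀ y : ℝ, ‖L (y * Complex.I) (F (y * Complex.I))‖ ≤ M)
    (h1 : ∀ y : ℝ, ‖L (1 + y * Complex.I) (F (1 + y * Complex.I))‖ ≤ M)
    {θ : ℝ} (hθ0 : 0 ≤ θ) (hθ1 : θ ≤ 1) : ‖L θ (F θ)‖ ≤ M := by
  obtain ⟨B, hB⟩ := hF.bounded
  have hfin : ∀ z ∈ strip, sumNorm N₀ N₁ (F z) < ⊤ := fun z hz =>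
    (hB z hz).trans_lt ENNReal.coe_lt_top
  -- functionals applied to a family which is small for the sum norm
  have hsmall : ∀ {z : ℂ} {l : Filter ℂ} {G : ℂ → V}, (∀ᶠ w in l, w ∈ strip) →
      Tendsto (fun w => sumNorm N₀ N₁ (G w)) l (𝓝 0) → Tendsto (fun w => L w (G w)) l (𝓝 0) := by
    intro z l G hl hG
    rw [tendsto_zero_iff_enorm_tendsto_zero]
    have h2 := ENNReal.Tendsto.const_mul hG (a := (C : ℝ≥0∞)) (Or.inr ENNReal.coe_ne_top)
    rw [mul_zero] at h2
    refine tendsto_of_tendsto_of_tendsto_of_le_of_le' tendsto_const_nhds h2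
      (Eventually.of_forall fun _ => zero_le) ?_
    filter_upwards [hl] with w hw using hC w hw _
  have hcont : ContinuousOn (fun w => L w (F w)) strip := by
    intro z hz
    have h2 := hsmall (z := z) (l := 𝓝[strip] z) (eventually_mem_nhdsWithin) (hF.continuous z hz)
    have h3 : Tendsto (fun w => L w (F z)) (𝓝[strip] z) (𝓝 (L z (F z))) :=
      ((hd _ (hfin z hz)).continuous.tendsto z).mono_left nhdsWithin_le_nhds
    have h4 := h2.add h3
    rw [zero_add] at h4
    refine h4.congr fun w => ?_
    rw [map_sub]; ring
  have hdiff : DifferentiableOn ℂ (fun w => L w (F w)) openStrip := by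
    intro z hz
    obtain ⟨F', hF', hlim⟩ := hF.holomorphic z hz
    have hzs := mem_strip_of_mem_openStrip hz
    have hev : ∀ᶠ w in 𝓝[≠] z, w ∈ strip :=
      (eventually_nhdsWithin_of_eventually_nhds (isOpen_openStrip.eventually_mem hz)).mono
        fun w hw => mem_strip_of_mem_openStrip hw
    have h2 := hsmall (z := z) hev hlim
    have h3 : Tendsto (fun w => L w F') (𝓝[≠] z) (𝓝 (L z F')) :=
      ((hd _ hF').continuous.tendsto z).mono_left nhdsWithin_le_nhds
    have h4 : Tendsto (fun w => (w - z)⁻¹ • (L w (F z) - L z (F z))) (𝓝[≠] z)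
        (𝓝 (deriv (fun w => L w (F z)) z)) := by
      have := ((hd _ (hfin z hzs)) z).hasDerivAt
      rwa [hasDerivAt_iff_tendsto_slope] at this
    have h5 : HasDerivAt (fun w => L w (F w)) (0 + L z F' + deriv (fun w => L w (F z)) z) z := by
      rw [hasDerivAt_iff_tendsto_slope]
      refine ((h2.add h3).add h4).congr fun w => ?_
      simp only [slope_def_field, map_sub, map_smul, smul_eq_mul]
      ring
    exact h5.differentiableAt.differentiableWithinAt
  have hcl : closure (Complex.HadamardThreeLines.verticalStrip 0 1) ⊆ strip :=
    closure_minimal (fun z hz => ⟨hz.1.le, hz.2.le⟩)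
      ((isClosed_le continuous_const Complex.continuous_re).inter
        (isClosed_le Complex.continuous_re continuous_const))
  have hbd : BddAbove ((norm ∘ fun w => L w (F w)) ''
      Complex.HadamardThreeLines.verticalClosedStrip 0 1) := by
    refine ⟨C * B, ?_⟩
    rintro _ ⟨z, hz, rfl⟩
    have h2 : ‖L z (F z)‖ₑ ≤ C * B :=
      (hC z ⟨hz.1, hz.2⟩ _).trans (by gcongr; exact hB z ⟨hz.1, hz.2⟩)
    rw [← ENNReal.coe_mul, enorm_le_coe] at h2
    exact_mod_cast h2
  have hedge : ∀ z : ℂ, z = z.re + z.im * Complex.I := fun z => (Complex.re_add_im z).symm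
  have h := Complex.HadamardThreeLines.norm_le_interp_of_mem_verticalClosedStrip₀₁'
    (fun w => L w (F w)) (z := θ) (a := M) (b := M) ⟨by simpa using hθ0, by simpa using hθ1⟩
    ⟨hdiff, hcont.mono hcl⟩ hbd
    (by
      intro z hz
      have h2 : z = z.im * Complex.I := by
        rw [Set.mem_preimage, Set.mem_singleton_iff] at hz
        have := hedge z
        rw [hz] at this
        simpa using this
      rw [h2]; exact h0 z.im)
    (by
      intro z hz
      have h2 : z = 1 + z.im * Complex.I := by
        rw [Set.mem_preimage, Set.mem_singleton_iff] at hz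
        have := hedge z
        rw [hz] at this
        simpa using this
      rw [h2]; exact h1 z.im)
  have hM : 0 ≤ M := (norm_nonneg _).trans (h0 0)
  rcases hM.eq_or_lt with hM | hM
  · subst hM
    refine h.trans (le_of_eq ?_)
    simp only [Complex.ofReal_re]
    rcases hθ0.eq_or_lt with h | h
    · subst h; simp
    · rw [Real.zero_rpow h.ne', mul_zero]
  · rw [← Real.rpow_add hM] at h
    simpa using h

/-- A continuous curve vanishing at infinity is bounded, for a norm that satisfies the triangle
inequality up to a factor. -/
lemma IsBoundaryCurve.iSup_lt_top {W : Type*} [AddCommGroup W] {N : W → ℝ≥0∞} {K : ℝ≥0}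
    (hN : ∀ u v, N (u + v) ≤ K * (N u + N v)) {γ : ℝ → W} (h : IsBoundaryCurve N γ) :
    ⨆ y, N (γ y) < ⊤ := by
  have h1 : ∀ᶠ y in cocompact ℝ, N (γ y) < 1 := h.vanishing.eventually (gt_mem_nhds one_pos)
  obtain ⟨S, hS, hS'⟩ := mem_cocompact.1 h1
  have h2 : ∃ B : ℝ≥0, ∀ y ∈ S, N (γ y) ≤ B := by
    refine hS.induction_on (p := fun S => ∃ B : ℝ≥0, ∀ y ∈ S, N (γ y) ≤ B) ⟨0, by simp⟩ ?_ ?_ ?_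
    · rintro s t hst ⟨B, hB⟩
      exact ⟨B, fun y hy => hB y (hst hy)⟩
    · rintro s t ⟨B, hB⟩ ⟨B', hB'⟩
      refine ⟨max B B', fun y hy => ?_⟩
      rcases hy with hy | hy
      · exact (hB y hy).trans (by simp)
      · exact (hB' y hy).trans (by simp)
    · intro x _
      have h3 : ∀ᶠ y in 𝓝 x, N (γ y - γ x) < 1 := (h.continuous x).eventually (gt_mem_nhds one_pos)
      refine ⟨{y | N (γ y - γ x) < 1}, mem_nhdsWithin_of_mem_nhds h3,
        K * (1 + (N (γ x)).toNNReal), fun y hy => ?_⟩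
      have h4 := hN (γ y - γ x) (γ x)
      rw [sub_add_cancel] at h4
      refine h4.trans ?_
      push_cast
      rw [ENNReal.coe_toNNReal (h.finite x).ne]
      gcongr
      exact le_of_lt hy
  obtain ⟨B, hB⟩ := h2
  refine (iSup_le (a := ((max B 1 : ℝ≥0) : ℝ≥0∞)) fun y => ?_).trans_lt ENNReal.coe_lt_top
  by_cases hy : y ∈ S
  · exact (hB y hy).trans (by simp)
  · exact (le_of_lt (hS' hy)).trans (by simp)

end ThreeLines

/-! ### Sums of admissible functions -/

section Sum

variable {V : Type*} [AddCommGroup V] {N₀ N₁ : V → ℝ≥0∞}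

lemma sumNorm_add_le (h₀ : ∀ u v, N₀ (u + v) ≤ 2 * (N₀ u + N₀ v))
    (h₁ : ∀ u v, N₁ (u + v) ≤ 2 * (N₁ u + N₁ v)) (v w : V) :
    sumNorm N₀ N₁ (v + w) ≤ 2 * (sumNorm N₀ N₁ v + sumNorm N₀ N₁ w) := by
  simp only [sumNorm, ENNReal.iInf_add, ENNReal.add_iInf,
    ENNReal.mul_iInf_of_ne two_ne_zero ENNReal.ofNat_ne_top]
  refine le_iInf fun p => le_iInf fun hp => le_iInf fun q => le_iInf fun hq => ?_
  refine (iInf₂_le (p + q) ?_).trans ?_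
  · subst hp hq; simp only [Prod.fst_add, Prod.snd_add]; abel
  · calc N₀ (p.1 + q.1) + N₁ (p.2 + q.2)
        ≤ 2 * (N₀ p.1 + N₀ q.1) + 2 * (N₁ p.2 + N₁ q.2) := add_le_add (h₀ _ _) (h₁ _ _)
      _ = _ := by ring

lemma tendsto_quasiNorm_add {W ι : Type*} [AddCommGroup W] {N : W → ℝ≥0∞}
    (h : ∀ u v, N (u + v) ≤ 2 * (N u + N v)) {l : Filter ι} {f g e : ι → W}
    (hf : Tendsto (fun i => N (f i)) l (𝓝 0)) (hg : Tendsto (fun i => N (g i)) l (𝓝 0))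
    (he : ∀ i, e i = f i + g i) : Tendsto (fun i => N (e i)) l (𝓝 0) := by
  have h2 := ENNReal.Tendsto.const_mul (hf.add hg) (a := 2) (Or.inr ENNReal.ofNat_ne_top)
  rw [add_zero, mul_zero] at h2
  refine tendsto_of_tendsto_of_tendsto_of_le_of_le tendsto_const_nhds h2 (fun _ => zero_le)
    fun i => ?_
  dsimp only
  rw [he]; exact h _ _

lemma IsBoundaryCurve.add {N : V → ℝ≥0∞} (h : ∀ u v, N (u + v) ≤ 2 * (N u + N v)) {γ δ : ℝ → V}
    (hγ : IsBoundaryCurve N γ) (hδ : IsBoundaryCurve N δ) :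
    IsBoundaryCurve N (fun y => γ y + δ y) where
  finite y := (h _ _).trans_lt (ENNReal.mul_lt_top ENNReal.ofNat_lt_top
    (ENNReal.add_lt_top.2 ⟨hγ.finite y, hδ.finite y⟩))
  continuous y := tendsto_quasiNorm_add h (hγ.continuous y) (hδ.continuous y)
    fun _ => by abel
  vanishing := tendsto_quasiNorm_add h hγ.vanishing hδ.vanishing fun _ => rfl

lemma IsAdmissible.add [Module ℂ V] (h₀ : ∀ u v, N₀ (u + v) ≤ 2 * (N₀ u + N₀ v))
    (h₁ : ∀ u v, N₁ (u + v) ≤ 2 * (N₁ u + N₁ v)) {F G : ℂ → V} (hF : IsAdmissible N₀ N₁ F)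
    (hG : IsAdmissible N₀ N₁ G) : IsAdmissible N₀ N₁ (fun z => F z + G z) where
  bounded := by
    obtain ⟨C, hC⟩ := hF.bounded
    obtain ⟨D, hD⟩ := hG.bounded
    refine ⟨2 * (C + D), fun z hz => (sumNorm_add_le h₀ h₁ _ _).trans ?_⟩
    push_cast
    gcongr
    exacts [hC z hz, hD z hz]
  continuous z hz := tendsto_quasiNorm_add (sumNorm_add_le h₀ h₁) (hF.continuous z hz)
    (hG.continuous z hz) fun _ => by abel
  holomorphic z hz := by
    obtain ⟨F', hF', hF''⟩ := hF.holomorphic z hz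
    obtain ⟨G', hG', hG''⟩ := hG.holomorphic z hz
    refine ⟨F' + G', (sumNorm_add_le h₀ h₁ _ _).trans_lt (ENNReal.mul_lt_top
      ENNReal.ofNat_lt_top (ENNReal.add_lt_top.2 ⟨hF', hG'⟩)),
      tendsto_quasiNorm_add (sumNorm_add_le h₀ h₁) hF'' hG'' fun w => ?_⟩
    module
  left := hF.left.add h₀ hG.left
  right := hF.right.add h₁ hG.right

lemma stripNorm_add_le (h₀ : ∀ u v, N₀ (u + v) ≤ 2 * (N₀ u + N₀ v))
    (h₁ : ∀ u v, N₁ (u + v) ≤ 2 * (N₁ u + N₁ v)) (F G : ℂ → V) :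
    stripNorm N₀ N₁ (fun z => F z + G z) ≤ 2 * (stripNorm N₀ N₁ F + stripNorm N₀ N₁ G) := by
  refine max_le (iSup_le fun y => (h₀ _ _).trans ?_) (iSup_le fun y => (h₁ _ _).trans ?_)
  · gcongr
    · exact le_max_of_le_left (le_iSup (fun y : ℝ => N₀ (F (y * Complex.I))) y)
    · exact le_max_of_le_left (le_iSup (fun y : ℝ => N₀ (G (y * Complex.I))) y)
  · gcongr
    · exact le_max_of_le_right (le_iSup (fun y : ℝ => N₁ (F (1 + y * Complex.I))) y)
    · exact le_max_of_le_right (le_iSup (fun y : ℝ => N₁ (G (1 + y * Complex.I))) y)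

end Sum

end ComplexInterpolation

namespace HardySobolev

open scoped ContDiff
open ComplexInterpolation

variable {d : ℕ}

/-! ### The couple `(A₀, A₁)` -/

lemma normA_zero (u : 𝓢'(E d, ℂ)) : normA d 0 u = normL2 u := by simp [normA]

lemma normA_sq {s : ℝ} (hs : s ≠ 0) (u : 𝓢'(E d, ℂ)) :
    normA d s u ^ 2 = weightedSq s u + fracDerivSq s u := by
  rw [normA, if_neg hs, ← ENNReal.rpow_natCast, ← ENNReal.rpow_mul]
  norm_num

lemma normA_le_of_sq_le {s : ℝ} (hs : s ≠ 0) {u : 𝓢'(E d, ℂ)} {M : ℝ≥0∞}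
    (h1 : weightedSq s u ≤ M ^ 2) (h2 : fracDerivSq s u ≤ M ^ 2) : normA d s u ≤ 2 * M := by
  rw [← ENNReal.pow_le_pow_left_iff two_ne_zero, normA_sq hs, mul_pow]
  calc _ ≤ M ^ 2 + M ^ 2 := add_le_add h1 h2
    _ = 2 * M ^ 2 := (two_mul _).symm
    _ ≤ _ := by gcongr; norm_num

lemma weightedSq_le_normA_sq {s : ℝ} (hs : s ≠ 0) (u : 𝓢'(E d, ℂ)) :
    weightedSq s u ≤ normA d s u ^ 2 := by
  rw [normA_sq hs]; exact le_self_add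

lemma fracDerivSq_le_normA_sq {s : ℝ} (hs : s ≠ 0) (u : 𝓢'(E d, ℂ)) :
    fracDerivSq s u ≤ normA d s u ^ 2 := by
  rw [normA_sq hs]; exact le_add_self

lemma enorm_apply_le_normA_zero {u : 𝓢'(E d, ℂ)} (hu : normA d 0 u ≠ ⊤) (φ : 𝓢(E d, ℂ)) :
    ‖u φ‖ₑ ≤ normA d 0 u * l2 φ := by
  rw [normA_zero] at hu ⊢
  exact enorm_apply_le_normL2 hu φ

lemma enorm_apply_le_normA_one {u : 𝓢'(E d, ℂ)} (hu : normA d 1 u ≠ ⊤) (φ : 𝓢(E d, ℂ)) :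
    ‖u φ‖ₑ ≤ normA d 1 u * l2 (wt 1 φ) := by
  have := enorm_apply_le_of_weightedSq zero_le_one le_rfl hu
    (weightedSq_le_normA_sq one_ne_zero u) φ
  simpa using this

lemma enorm_apply_lineDeriv_le_normA_one {u : 𝓢'(E d, ℂ)} (hu : normA d 1 u ≠ ⊤)
    (φ : 𝓢(E d, ℂ)) : ‖u (∂_{tDir d} φ)‖ₑ ≤ normA d 1 u * l2 φ :=
  enorm_apply_lineDeriv_le hu (fracDerivSq_le_normA_sq one_ne_zero u) φ

lemma normA_zero_le_of_bound {u : 𝓢'(E d, ℂ)} {M : ℝ≥0∞} (hM : M ≠ ⊤)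
    (h : ∀ φ, ‖u φ‖ₑ ≤ M * l2 φ) : normA d 0 u ≤ M := by
  lift M to ℝ≥0 using hM
  rw [normA_zero]; exact normL2_le_of_bound h

lemma normA_one_le_of_bound {u : 𝓢'(E d, ℂ)} {M : ℝ≥0∞} (hM : M ≠ ⊤)
    (h1 : ∀ φ, ‖u φ‖ₑ ≤ M * l2 (wt 1 φ))
    (h2 : ∀ φ : 𝓢(E d, ℂ), ‖u (∂_{tDir d} φ)‖ₑ ≤ M * l2 φ) : normA d 1 u ≤ 2 * M := by
  lift M to ℝ≥0 using hM
  exact normA_le_of_sq_le one_ne_zero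
    (weightedSq_le_of_bound zero_le_one le_rfl (fun φ => by simpa using h1 φ))
    (fracDerivSq_one_le_of_bound h2)

lemma normA_zero_add_le (u v : 𝓢'(E d, ℂ)) :
    normA d 0 (u + v) ≤ (1 : ℝ≥0) * (normA d 0 u + normA d 0 v) := by
  rw [ENNReal.coe_one, one_mul]
  by_cases h : normA d 0 u + normA d 0 v = ⊤
  · rw [h]; exact le_top
  obtain ⟨hu, hv⟩ := ENNReal.add_ne_top.1 h
  refine normA_zero_le_of_bound h fun φ => ?_
  rw [add_mul]
  exact (enorm_add_le (u φ) (v φ)).trans (add_le_add (enorm_apply_le_normA_zero hu φ)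
    (enorm_apply_le_normA_zero hv φ))

lemma normA_one_add_le (u v : 𝓢'(E d, ℂ)) :
    normA d 1 (u + v) ≤ (2 : ℝ≥0) * (normA d 1 u + normA d 1 v) := by
  by_cases h : normA d 1 u + normA d 1 v = ⊤
  · rw [h]; simp
  obtain ⟨hu, hv⟩ := ENNReal.add_ne_top.1 h
  refine normA_one_le_of_bound h (fun φ => ?_) fun φ => ?_
  · rw [add_mul]
    exact (enorm_add_le (u φ) (v φ)).trans (add_le_add (enorm_apply_le_normA_one hu φ)
      (enorm_apply_le_normA_one hv φ))
  · rw [add_mul]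
    exact (enorm_add_le (u (∂_{tDir d} φ)) (v (∂_{tDir d} φ))).trans
      (add_le_add (enorm_apply_lineDeriv_le_normA_one hu φ)
        (enorm_apply_lineDeriv_le_normA_one hv φ))

lemma stripNorm_lt_top {F : ℂ → 𝓢'(E d, ℂ)} (hF : IsAdmissible (normA d 0) (normA d 1) F) :
    stripNorm (normA d 0) (normA d 1) F < ⊤ :=
  max_lt (hF.left.iSup_lt_top normA_zero_add_le) (hF.right.iSup_lt_top normA_one_add_le)

lemma exists_of_sumNorm_lt_top {v : 𝓢'(E d, ℂ)} (hv : sumNorm (normA d 0) (normA d 1) v < ⊤) :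
    ∃ v₀ v₁, v₀ + v₁ = v ∧ normA d 0 v₀ ≠ ⊤ ∧ normA d 1 v₁ ≠ ⊤ := by
  simp only [sumNorm, iInf_lt_iff] at hv
  obtain ⟨p, hp, h⟩ := hv
  obtain ⟨h0, h1⟩ := ENNReal.add_lt_top.1 h
  exact ⟨p.1, p.2, hp, h0.ne, h1.ne⟩

/-! #### Entire families of annular test functions -/

lemma norm_theta_pw_le (n : ℕ) (z : ℂ) (t : ℝ) :
    ‖(theta n t : ℂ) * pw z t‖ ≤ Real.exp (2 * (n + 1) * |z.re|) := by
  by_cases h : theta n t = 0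
  · rw [h]; simp [Real.exp_nonneg]
  obtain ⟨h0, h1⟩ := abs_log_lt_of_theta_ne_zero h
  rw [norm_mul, pw_eq_exp z h0, Complex.norm_exp, Complex.norm_real, Real.norm_eq_abs,
    abs_of_nonneg (theta_nonneg n t)]
  refine (mul_le_of_le_one_left (Real.exp_nonneg _) (theta_le_one n t)).trans ?_
  rw [Real.exp_le_exp]
  simp only [Complex.re_ofReal_mul]
  refine (le_abs_self _).trans ?_
  rw [abs_mul]
  gcongr

lemma differentiable_integral_theta_pw (n : ℕ) (a : ℝ) {G : E d → ℂ} (hG : Integrable G) :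
    Differentiable ℂ fun w : ℂ => ∫ x, (theta n (tCoord x) : ℂ) * pw (a * w) (tCoord x) * G x := by
  intro w₀
  have hmeas : ∀ w : ℂ, AEStronglyMeasurable
      (fun x : E d => (theta n (tCoord x) : ℂ) * pw (a * w) (tCoord x) * G x) := fun w =>
    (((Complex.measurable_ofReal.comp ((measurable_theta n).comp
      measurable_tCoord)).aestronglyMeasurable.mul (aestronglyMeasurable_pw _)).mul hG.1)
  have hre : ∀ w ∈ Metric.ball w₀ 1, |((a * w : ℂ)).re| ≤ |a| * (‖w₀‖ + 1) := by
    intro w hw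
    rw [Complex.re_ofReal_mul, abs_mul]
    gcongr
    refine (Complex.abs_re_le_norm w).trans ?_
    have := norm_sub_norm_le w w₀
    rw [mem_ball_iff_norm] at hw
    linarith
  have h := hasDerivAt_integral_of_dominated_loc_of_deriv_le (μ := (volume : Measure (E d)))
    (F := fun w x => (theta n (tCoord x) : ℂ) * pw (a * w) (tCoord x) * G x)
    (F' := fun w x => (Real.log (tCoord x) * a : ℂ) *
      ((theta n (tCoord x) : ℂ) * pw (a * w) (tCoord x) * G x)) (x₀ := w₀)
    (s := Metric.ball w₀ 1)
    (bound := fun x => (2 * (n + 1) * |a|) * (Real.exp (2 * (n + 1) * (|a| * (‖w₀‖ + 1))) * ‖G x‖))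
    (Metric.ball_mem_nhds w₀ one_pos) (Eventually.of_forall hmeas) ?_ ?_ ?_ ?_ ?_
  · exact h.2.differentiableAt
  · refine (hG.norm.const_mul (Real.exp (2 * (n + 1) * |((a * w₀ : ℂ)).re|))).mono' (hmeas w₀) ?_
    refine ae_of_all _ fun x => ?_
    rw [norm_mul]
    gcongr
    exact norm_theta_pw_le n _ _
  · refine AEStronglyMeasurable.mul ?_ (hmeas w₀)
    refine Measurable.aestronglyMeasurable ?_
    exact (Complex.measurable_ofReal.comp (Real.measurable_log.comp measurable_tCoord)).mul_const _
  · refine ae_of_all _ fun x w hw => ?_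
    by_cases hθ : theta n (tCoord x) = 0
    · simp only [hθ, Complex.ofReal_zero, zero_mul, mul_zero, norm_zero]
      positivity
    obtain ⟨h0, h1⟩ := abs_log_lt_of_theta_ne_zero hθ
    rw [norm_mul, norm_mul _ (G x), norm_mul (Real.log (tCoord x) : ℂ), Complex.norm_real,
      Complex.norm_real, Real.norm_eq_abs, Real.norm_eq_abs]
    have h2 : ‖(theta n (tCoord x) : ℂ) * pw (a * w) (tCoord x)‖
        ≤ Real.exp (2 * (n + 1) * (|a| * (‖w₀‖ + 1))) := by
      refine (norm_theta_pw_le n _ _).trans ?_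
      have := hre w hw
      gcongr
    gcongr
  · exact (hG.norm.const_mul _).const_mul _
  · refine ae_of_all _ fun x w hw => ?_
    by_cases hx : tCoord x = 0
    · simp only [hx, theta_zero, Complex.ofReal_zero, zero_mul, mul_zero]
      exact hasDerivAt_const _ _
    have h1 : HasDerivAt (fun w : ℂ => pw (a * w) (tCoord x))
        (pw (a * w) (tCoord x) * (Real.log (tCoord x) * a)) w := by
      simp only [pw_eq_exp _ hx]
      have := (((hasDerivAt_id w).const_mul (a : ℂ)).const_mul (Real.log (tCoord x) : ℂ)).cexp
      simpa using this
    have h2 := (h1.const_mul (theta n (tCoord x) : ℂ)).mul_const (G x)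
    convert! h2 using 1
    ring

/-- Interpolation of the estimates `|Λ v (φ)| ≤ ‖v‖₀ ‖φ‖₂` and `|Λ v (φ)| ≤ ‖v‖₁ ‖|t|^a φ‖₂` on
annular test functions: an admissible `F` with boundary values bounded by `M` satisfies
`|Λ F(s) (φ)| ≤ M ‖|t|^{as} φ‖₂`. The three lines theorem is applied to
`w ↦ Λ F(w) (|t|^{-aw} φ)`. -/
theorem enorm_apply_le_of_isAdmissible (Λ : 𝓢'(E d, ℂ) →ₗ[ℂ] (𝓢(E d, ℂ) →ₗ[ℂ] ℂ)) {a : ℝ}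
    (hΛ0 : ∀ v, normA d 0 v ≠ ⊤ → ∀ φ ∈ annular d, ‖Λ v φ‖ₑ ≤ normA d 0 v * l2 φ)
    (hΛ1 : ∀ v, normA d 1 v ≠ ⊤ → ∀ φ ∈ annular d, ‖Λ v φ‖ₑ ≤ normA d 1 v * l2 (wt a φ))
    {F : ℂ → 𝓢'(E d, ℂ)} (hF : IsAdmissible (normA d 0) (normA d 1) F) {M : ℝ≥0}
    (hM : stripNorm (normA d 0) (normA d 1) F ≤ M) {s : ℝ} (hs0 : 0 ≤ s) (hs1 : s ≤ 1)
    {φ : 𝓢(E d, ℂ)} (hφ : φ ∈ annular d) :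
    ‖Λ (F s) φ‖ₑ ≤ M * l2 (wt (a * s) φ) := by
  obtain ⟨n, hn⟩ := exists_annMul_apply_of_annular hφ
  -- the weight `|t|^{as}` is moved into the test function
  set ψ := annMul n (pw (a * s)) φ with hψ
  have hψφ : (ψ : E d → ℂ) = wt (a * s) φ := by
    ext x; exact hn n le_rfl _ (contDiffAt_pw _) x
  have hψann : ψ ∈ annular d := annMul_mem_annular n (contDiffAt_pw _) φ
  obtain ⟨m, hm⟩ := exists_annMul_apply_of_annular hψann
  set χ : ℂ → 𝓢(E d, ℂ) := fun w => annMul m (pw ((-a : ℝ) * w)) ψ with hχ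
  have hχann : ∀ w, χ w ∈ annular d := fun w => annMul_mem_annular m (contDiffAt_pw _) ψ
  have hχx : ∀ w x, χ w x = theta m (tCoord x) * pw ((-a : ℝ) * w) (tCoord x) * ψ x := fun w x =>
    annMul_apply m (contDiffAt_pw _) ψ x
  have hχwt : ∀ w, (χ w : E d → ℂ) = wt ((-a : ℝ) * w) ψ := fun w => by
    ext x; exact hm m le_rfl _ (contDiffAt_pw _) x
  have hχs : χ s = φ := by
    ext x
    rw [hχwt, hψφ]
    by_cases hx : tCoord x = 0
    · simp [wt, annular_apply_eq_zero hφ hx]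
    · have := pw_neg_mul_pw (a * s : ℂ) hx
      simp only [wt, Complex.ofReal_neg, neg_mul]
      linear_combination φ x * this
  have hl2φ : l2 (wt (a * s) φ) = l2 ψ := by rw [hψφ]
  let L : ℂ → 𝓢'(E d, ℂ) →ₗ[ℂ] ℂ := fun w => LinearMap.flip Λ (χ w)
  have hL : ∀ w v, L w v = Λ v (χ w) := fun w v => rfl
  have hfin0 : ∀ y : ℝ, normA d 0 (F (y * Complex.I)) ≤ M := fun y =>
    ((le_iSup (fun y : ℝ => normA d 0 (F (y * Complex.I))) y).trans (le_max_left _ _)).trans hM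
  have hfin1 : ∀ y : ℝ, normA d 1 (F (1 + y * Complex.I)) ≤ M := fun y =>
    ((le_iSup (fun y : ℝ => normA d 1 (F (1 + y * Complex.I))) y).trans (le_max_right _ _)).trans hM
  have hb0 : ∀ w ∈ strip, l2 (χ w) ≤ ENNReal.ofReal (Real.exp (2 * (m + 1) * |a|)) * l2 ψ := by
    intro w hw
    refine eLpNorm_le_mul_eLpNorm_of_ae_le_mul (ae_of_all _ fun x => ?_) 2
    rw [hχx, norm_mul]
    have hre : |((-a : ℝ) * w : ℂ).re| ≤ |a| := by
      rw [Complex.re_ofReal_mul, abs_mul, abs_neg, abs_of_nonneg hw.1]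
      exact mul_le_of_le_one_right (abs_nonneg a) hw.2
    gcongr
    refine (norm_theta_pw_le m _ _).trans ?_
    gcongr
  have hb1 : ∀ w ∈ strip, l2 (wt a (χ w))
      ≤ ENNReal.ofReal (Real.exp (2 * (m + 1) * |a|)) * l2 ψ := by
    intro w hw
    refine eLpNorm_le_mul_eLpNorm_of_ae_le_mul ?_ 2
    filter_upwards [ae_tCoord_ne_zero] with x hx
    have : wt a (χ w) x
        = (theta m (tCoord x) * pw (a + (-a : ℝ) * w) (tCoord x)) * ψ x := by
      rw [wt, hχx, pw_add _ _ hx]; ring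
    have hre : |(a + (-a : ℝ) * w : ℂ).re| ≤ |a| := by
      have : (a + (-a : ℝ) * w : ℂ).re = a * (1 - w.re) := by
        simp; ring
      rw [this, abs_mul, abs_of_nonneg (sub_nonneg.2 hw.2)]
      exact mul_le_of_le_one_right (abs_nonneg a) (by linarith [hw.1])
    rw [this, norm_mul]
    gcongr
    refine (norm_theta_pw_le m _ _).trans ?_
    gcongr
  have hψtop : l2 ψ ≠ ⊤ := (l2_schwartz_lt_top ψ).ne
  set K := ENNReal.ofReal (Real.exp (2 * (m + 1) * |a|)) * l2 ψ + 1 with hK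
  have hKtop : K ≠ ⊤ := by finiteness
  have key := norm_le_of_isAdmissible hF (L := L) (C := K.toNNReal) (M := (M * l2 ψ).toReal)
    (θ := s) ?_ ?_ ?_ ?_ hs0 hs1
  · rw [hL, hχs] at key
    rw [hl2φ, ← ofReal_norm]
    exact (ENNReal.ofReal_le_ofReal key).trans ENNReal.ofReal_toReal_le
  · intro w hw v
    rw [ENNReal.coe_toNNReal hKtop, hL]
    have hK0 : K ≠ 0 := by rw [hK]; simp
    by_cases hv : sumNorm (normA d 0) (normA d 1) v = ⊤
    · rw [hv, ENNReal.mul_top hK0]; exact le_top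
    have : ∀ p : 𝓢'(E d, ℂ) × 𝓢'(E d, ℂ), p.1 + p.2 = v →
        ‖Λ v (χ w)‖ₑ ≤ K * (normA d 0 p.1 + normA d 1 p.2) := by
      intro p hp
      by_cases h0 : normA d 0 p.1 = ⊤
      · rw [h0, top_add, ENNReal.mul_top hK0]; exact le_top
      by_cases h1 : normA d 1 p.2 = ⊤
      · rw [h1, add_top, ENNReal.mul_top hK0]; exact le_top
      rw [← hp, map_add, LinearMap.add_apply, mul_add]
      refine (enorm_add_le _ _).trans (add_le_add ?_ ?_)
      · refine (hΛ0 _ h0 _ (hχann w)).trans ?_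
        rw [mul_comm]
        gcongr
        exact (hb0 w hw).trans le_self_add
      · refine (hΛ1 _ h1 _ (hχann w)).trans ?_
        rw [mul_comm]
        gcongr
        exact (hb1 w hw).trans le_self_add
    have h2 : K⁻¹ * ‖Λ v (χ w)‖ₑ ≤ sumNorm (normA d 0) (normA d 1) v := by
      refine le_iInf₂ fun p hp => ?_
      rw [ENNReal.inv_mul_le_iff hK0 hKtop]
      exact this p hp
    rwa [ENNReal.inv_mul_le_iff hK0 hKtop] at h2
  · intro v hv
    obtain ⟨v₀, v₁, rfl, h0, h1⟩ := exists_of_sumNorm_lt_top hv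
    obtain ⟨k₀, hk₀, -, hk₀φ⟩ := exists_memLp_of_annular_bound (Λ v₀) 0 (normA d 0 v₀).toNNReal
      (fun φ hφ => by rw [wt_zero, ENNReal.coe_toNNReal h0]; exact hΛ0 v₀ h0 φ hφ)
    obtain ⟨k₁, hk₁, -, hk₁φ⟩ := exists_memLp_of_annular_bound (Λ v₁) a (normA d 1 v₁).toNNReal
      (fun φ hφ => by rw [ENNReal.coe_toNNReal h1]; exact hΛ1 v₁ h1 φ hφ)
    have hd : ∀ (z : ℂ) (k : E d → ℂ), MemLp k 2 → Differentiable ℂ fun w =>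
        ∫ x, χ w x * wt z k x := by
      intro z k hk
      have := differentiable_integral_theta_pw m (-a) (G := fun x => ψ x * wt z k x)
        (integrable_mul_of_wt (z := z) (memLp_wt_annular z hψann) (memLp_wt_neg_wt hk))
      convert! this using 4 with w x
      rw [hχx]; ring
    have : (fun w => L w (v₀ + v₁)) = fun w =>
        (∫ x, χ w x * wt 0 k₀ x) + ∫ x, χ w x * wt a k₁ x := by
      ext w
      rw [map_add, hL, hL, hk₀φ _ (hχann w), hk₁φ _ (hχann w)]
    rw [this]
    exact (hd 0 k₀ hk₀).add (hd a k₁ hk₁)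
  · intro y
    rw [hL, ← toReal_enorm]
    refine ENNReal.toReal_mono (by finiteness) ?_
    refine (hΛ0 _ ((hfin0 y).trans_lt ENNReal.coe_lt_top).ne _ (hχann _)).trans ?_
    refine mul_le_mul' (hfin0 y) ?_
    rw [hχwt, l2_wt_congr_re (w := 0) (by simp), wt_zero]
  · intro y
    rw [hL, ← toReal_enorm]
    refine ENNReal.toReal_mono (by finiteness) ?_
    refine (hΛ1 _ ((hfin1 y).trans_lt ENNReal.coe_lt_top).ne _ (hχann _)).trans ?_
    refine mul_le_mul' (hfin1 y) ?_
    rw [hχwt, l2, eLpNorm_congr_ae (wt_wt _ _ _), ← l2, l2_wt_congr_re (w := 0) (by simp), wt_zero]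

/-! ### Hardy's inequality -/

lemma lintegral_enorm_mul_le {f g : E d → ℂ} (hf : AEStronglyMeasurable f)
    (hg : AEStronglyMeasurable g) : ∫⁻ x, ‖f x‖ₑ * ‖g x‖ₑ ≤ l2 f * l2 g := by
  have h1 := eLpNorm_smul_le_mul_eLpNorm (p := 2) (q := 2) (r := 1) (μ := volume) hg hf
  rw [eLpNorm_one_eq_lintegral_enorm] at h1
  simpa [enorm_mul] using h1

lemma hasLineDerivAt_schwartz (φ : 𝓢(E d, ℂ)) (x v : E d) :
    HasLineDerivAt ℝ φ (∂_{v} φ x) x v := by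
  rw [SchwartzMap.lineDerivOp_apply_eq_fderiv]
  exact (SchwartzMap.hasFDerivAt φ x).hasLineDerivAt v

lemma lineDeriv_mulT (φ : 𝓢(E d, ℂ)) (x : E d) :
    ∂_{tDir d} (mulT φ) x = φ x + tCoord x * ∂_{tDir d} φ x := by
  have h1 : HasLineDerivAt ℝ (mulT φ) (φ x + tCoord x * ∂_{tDir d} φ x) x (tDir d) := by
    have h2 : HasDerivAt (fun r : ℝ => ((tCoord x + r : ℝ) : ℂ)) 1 0 := by
      simpa using ((hasDerivAt_id (0 : ℝ)).const_add (tCoord x)).ofReal_comp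
    have h3 := h2.mul (hasLineDerivAt_schwartz φ x (tDir d))
    unfold HasLineDerivAt
    convert! h3 using 1
    · ext r; simp
    · simp
  exact (hasLineDerivAt_schwartz _ x _).unique h1

/-- The derivative of `θₙ(t) σ(t) φ`, where `σ` is locally constant off `0`: the error term has
size `|φ| / (n |t|)`. -/
lemma exists_lineDeriv_annMul {σ : ℝ → ℂ} (hσ : ∀ t ≠ 0, ∀ᶠ r in 𝓝 t, σ r = σ t) :
    ∃ C : ℝ≥0, ∀ n : ℕ, ∀ φ : 𝓢(E d, ℂ), ∀ x : E d, tCoord x ≠ 0 → ∃ ε : ℝ,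
      |tCoord x * ε| ≤ C / (n + 1) ∧ ∂_{tDir d} (annMul n σ φ) x
        = theta n (tCoord x) * σ (tCoord x) * ∂_{tDir d} φ x + ε * σ (tCoord x) * φ x := by
  obtain ⟨C, hC⟩ := exists_deriv_theta_bound
  have hs : ∀ t ≠ 0, ContDiffAt ℝ ∞ σ t := fun t ht =>
    contDiffAt_const.congr_of_eventuallyEq (hσ t ht)
  refine ⟨C, fun n φ x hx => ?_⟩
  obtain ⟨ε, hε, hεC⟩ := hC n (tCoord x) hx
  refine ⟨ε, hεC, ?_⟩
  have h1 : HasLineDerivAt ℝ (annMul n σ φ) (theta n (tCoord x) * σ (tCoord x) * ∂_{tDir d} φ x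
      + ε * σ (tCoord x) * φ x) x (tDir d) := by
    have h0 : HasDerivAt (fun r : ℝ => tCoord x + r) 1 0 :=
      (hasDerivAt_id (0 : ℝ)).const_add (tCoord x)
    have hσ' : HasDerivAt σ 0 (tCoord x) :=
      (hasDerivAt_const (tCoord x) (σ (tCoord x))).congr_of_eventuallyEq (hσ _ hx)
    have h2 : HasDerivAt (fun r : ℝ => (theta n (tCoord x + r) : ℂ) * σ (tCoord x + r))
        (ε * σ (tCoord x)) 0 := by
      have h4 := (hε.ofReal_comp).mul hσ'
      have h3 := HasDerivAt.scomp (0 : ℝ) (h := fun r : ℝ => tCoord x + r)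
        (g₁ := fun t => (theta n t : ℂ) * σ t) (by simpa using! h4) h0
      simpa [Function.comp_def] using h3
    have h3 := h2.mul (hasLineDerivAt_schwartz φ x (tDir d))
    unfold HasLineDerivAt
    convert! h3 using 1
    · ext r; rw [annMul_apply n hs]; simp
    · simp; ring
  exact (hasLineDerivAt_schwartz _ x _).unique h1

/-- A Schwartz function vanishing on `t = 0` is `O(|t|)` near that hyperplane, with rapidly
decreasing constant; hence its quotient by `t` is in `L²`. -/
lemma memLp_wt_neg_one {χ : 𝓢(E d, ℂ)} (hχ : ∀ x, tCoord x = 0 → χ x = 0) :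
    MemLp (wt (-1) χ) 2 := by
  refine ⟨aestronglyMeasurable_wt _ (aestronglyMeasurable_schwartz χ), ?_⟩
  obtain ⟨k, hk⟩ := Measure.HasTemperateGrowth.exists_eLpNorm_lt_top (μ := (volume : Measure (E d)))
    2 inferInstance
  have hdec : ∀ φ : 𝓢(E d, ℂ), ∃ C : ℝ, ∀ x, (1 + ‖x‖) ^ k * ‖φ x‖ ≤ C := by
    intro φ
    refine ⟨2 ^ k * (Finset.Iic (k, 0)).sup (fun m => SchwartzMap.seminorm ℝ m.1 m.2) φ,
      fun x => ?_⟩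
    have := one_add_le_sup_seminorm_apply (𝕜 := ℝ) (m := (k, 0)) (le_refl k) (le_refl 0) φ x
    rwa [norm_iteratedFDeriv_zero] at this
  obtain ⟨C₀, hC₀⟩ := hdec χ
  obtain ⟨C₁, hC₁⟩ := hdec (∂_{tDir d} χ)
  have hC₁0 : 0 ≤ C₁ := le_trans (by positivity) (hC₁ 0)
  have hbound : ∀ x : E d, tCoord x ≠ 0 →
      ‖wt (-1) χ x‖ ≤ (C₀ + 2 ^ k * C₁) * ‖(1 + ‖x‖) ^ (-k : ℝ)‖ := by
    intro x hx
    have hpos : 0 < 1 + ‖x‖ := by positivity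
    have hwt : ‖wt (-1) χ x‖ = |tCoord x|⁻¹ * ‖χ x‖ := by
      simp [wt, norm_pw _ hx, Real.rpow_neg_one]
    rw [hwt, Real.norm_of_nonneg (by positivity), Real.rpow_neg hpos.le, Real.rpow_natCast,
      ← div_eq_mul_inv, le_div_iff₀ (by positivity)]
    have ht := abs_pos.2 hx
    rcases le_total 1 |tCoord x| with h | h
    · calc |tCoord x|⁻¹ * ‖χ x‖ * (1 + ‖x‖) ^ k ≤ 1 * ‖χ x‖ * (1 + ‖x‖) ^ k := by
            gcongr; exact inv_le_one_of_one_le₀ h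
        _ ≤ C₀ := by linarith [hC₀ x]
        _ ≤ _ := le_add_of_nonneg_right (by positivity)
    · -- mean value inequality on the segment from the projection of `x` to `t = 0`
      have hmv : ‖χ x‖ ≤ 2 ^ k * C₁ / (1 + ‖x‖) ^ k * |tCoord x| := by
        have h1 := Convex.norm_image_sub_le_of_norm_hasDerivWithin_le
          (f := fun r : ℝ => χ (x + r • tDir d)) (f' := fun r => ∂_{tDir d} χ (x + r • tDir d))
          (C := 2 ^ k * C₁ / (1 + ‖x‖) ^ k) (s := Set.uIcc 0 (-tCoord x)) (x := -tCoord x) (y := 0)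
          ?_ ?_ (convex_uIcc _ _) Set.right_mem_uIcc Set.left_mem_uIcc
        · have h2 : χ (x + (-tCoord x) • tDir d) = 0 :=
            hχ _ (by rw [tCoord_add, tCoord_smul, tCoord_tDir]; ring)
          rw [h2, zero_smul, add_zero, sub_zero, zero_sub, neg_neg] at h1
          exact h1
        · intro r hr
          have h3 := hasLineDerivAt_schwartz χ (x + r • tDir d) (tDir d)
          have h4 : HasDerivAt (fun r' : ℝ => χ (x + r' • tDir d))
              (∂_{tDir d} χ (x + r • tDir d)) r := by
            have h5 : HasDerivAt (fun r' : ℝ => r' - r) 1 r := (hasDerivAt_id r).sub_const r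
            have h6 := HasDerivAt.scomp r (h := fun r' : ℝ => r' - r)
              (g₁ := fun q : ℝ => χ (x + r • tDir d + q • tDir d))
              (by simpa [HasLineDerivAt] using h3) h5
            rw [one_smul] at h6
            convert! h6 using 1
            ext r'
            simp only [Function.comp, add_assoc, ← add_smul]
            congr 3; ring
          exact h4.hasDerivWithinAt
        · intro r hr
          have hr1 : |r| ≤ 1 := by
            have := Set.abs_sub_left_of_mem_uIcc hr
            simp at this
            exact this.trans h
          have h5 : 1 + ‖x‖ ≤ 2 * (1 + ‖x + r • tDir d‖) := by
            have h6 : ‖x‖ ≤ ‖x + r • tDir d‖ + ‖r • tDir d‖ := by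
              simpa using norm_sub_le (x + r • tDir d) (r • tDir d)
            rw [norm_smul, norm_tDir, Real.norm_eq_abs, mul_one] at h6
            linarith [norm_nonneg (x + r • tDir d)]
          rw [le_div_iff₀ (by positivity)]
          calc ‖∂_{tDir d} χ (x + r • tDir d)‖ * (1 + ‖x‖) ^ k
              ≤ ‖∂_{tDir d} χ (x + r • tDir d)‖ * (2 * (1 + ‖x + r • tDir d‖)) ^ k := by gcongr
            _ = 2 ^ k * ((1 + ‖x + r • tDir d‖) ^ k * ‖∂_{tDir d} χ (x + r • tDir d)‖) := by
              rw [mul_pow]; ring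
            _ ≤ _ := by gcongr; exact hC₁ _
      calc |tCoord x|⁻¹ * ‖χ x‖ * (1 + ‖x‖) ^ k
          ≤ |tCoord x|⁻¹ * (2 ^ k * C₁ / (1 + ‖x‖) ^ k * |tCoord x|) * (1 + ‖x‖) ^ k := by gcongr
        _ = 2 ^ k * C₁ := by field_simp
        _ ≤ _ := le_add_of_nonneg_left (le_trans (by positivity) (hC₀ 0))
  have hfin := eLpNorm_le_mul_eLpNorm_of_ae_le_mul (f := wt (-1) χ) (μ := volume)
    (g := fun x : E d => (1 + ‖x‖) ^ (-k : ℝ)) (c := C₀ + 2 ^ k * C₁)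
    (by filter_upwards [ae_tCoord_ne_zero] with x hx using hbound x hx) 2
  exact hfin.trans_lt (ENNReal.mul_lt_top ENNReal.ofReal_lt_top hk)

lemma contDiffAt_inv_ofReal (t : ℝ) (ht : t ≠ 0) :
    ContDiffAt ℝ ∞ (fun t : ℝ => ((t : ℂ))⁻¹) t :=
  Complex.ofRealCLM.contDiff.contDiffAt.inv (by simpa using ht)

/-- Hardy's inequality for annular functions, by integration by parts: with `η = χ / t`,
`2 Re ∫ ∂ₜχ η̄ = ∫ |η|²`. -/
lemma hardy_annular {χ : 𝓢(E d, ℂ)} (hχ : χ ∈ annular d) :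
    l2 (wt (-1) χ) ≤ 2 * l2 (∂_{tDir d} χ : 𝓢(E d, ℂ)) := by
  obtain ⟨n, hn⟩ := exists_annMul_apply_of_annular hχ
  set η := annMul n (fun t : ℝ => ((t : ℂ))⁻¹) χ with hη
  have hηx : ∀ x, η x = (tCoord x : ℂ)⁻¹ * χ x := hn n le_rfl _ contDiffAt_inv_ofReal
  have hχη : χ = mulT η := by
    ext x
    rw [mulT_apply, hηx]
    by_cases hx : tCoord x = 0
    · rw [annular_apply_eq_zero hχ hx]; simp
    · have : (tCoord x : ℂ) ≠ 0 := by exact_mod_cast hx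
      field_simp
  have hl : l2 (wt (-1) χ) = l2 η := by
    refine eLpNorm_congr_norm_ae ?_
    filter_upwards [ae_tCoord_ne_zero] with x hx
    rw [hηx]
    simp [wt, norm_pw _ hx, Real.rpow_neg_one]
  rw [hl]
  have hibp : ∫ x, inner ℝ (χ x) (∂_{tDir d} η x) = -∫ x, inner ℝ (∂_{tDir d} χ x) (η x) :=
    SchwartzMap.integral_bilinear_lineDerivOp_right_eq_neg_left (μ := volume) χ η
      (innerSL ℝ) (tDir d)
  have hsplit : ∀ x, inner ℝ (∂_{tDir d} χ x) (η x)
      = ‖η x‖ ^ 2 + inner ℝ (χ x) (∂_{tDir d} η x) := by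
    intro x
    rw [hχη, lineDeriv_mulT, mulT_apply, inner_add_left, real_inner_self_eq_norm_sq]
    congr 1
    rw [← Complex.real_smul, ← Complex.real_smul, inner_smul_left, inner_smul_left,
      real_inner_comm]
  have hint1 : Integrable fun x => inner ℝ (χ x) (∂_{tDir d} η x) :=
    (SchwartzMap.bilinLeftCLM (innerSL ℝ) (∂_{tDir d} η).hasTemperateGrowth χ).integrable
  have hint2 : Integrable fun x => ‖η x‖ ^ 2 := by
    have := (memLp_schwartz η).integrable_norm_pow two_ne_zero
    simpa using this
  have h2 : ∫ x, ‖η x‖ ^ 2 = 2 * ∫ x, inner ℝ (∂_{tDir d} χ x) (η x) := by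
    have h3 : ∫ x, inner ℝ (∂_{tDir d} χ x) (η x)
        = (∫ x, ‖η x‖ ^ 2) + ∫ x, inner ℝ (χ x) (∂_{tDir d} η x) := by
      rw [← integral_add hint2 hint1]
      exact integral_congr_ae (ae_of_all _ hsplit)
    linarith
  have h3 : l2 η ^ 2 ≤ (2 * l2 (∂_{tDir d} χ : 𝓢(E d, ℂ))) * l2 η := by
    have h4 : l2 η ^ 2 = ‖∫ x, ‖η x‖ ^ 2‖ₑ := by
      rw [eLpNorm_two_sq, Real.enorm_eq_ofReal (by positivity),
        ofReal_integral_eq_lintegral_ofReal hint2 (ae_of_all _ fun x => by positivity)]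
      congr 1; ext x
      rw [ENNReal.ofReal_pow (norm_nonneg _), ofReal_norm]
    rw [h4, h2, enorm_mul, mul_assoc]
    gcongr
    · rw [Real.enorm_eq_ofReal two_pos.le]; simp
    · refine (enorm_integral_le_lintegral_enorm _).trans ?_
      refine le_trans (lintegral_mono fun x => ?_) (lintegral_enorm_mul_le
        (aestronglyMeasurable_schwartz (∂_{tDir d} χ)) (aestronglyMeasurable_schwartz η))
      rw [← ofReal_norm, ← ofReal_norm, ← ofReal_norm, ← ENNReal.ofReal_mul (norm_nonneg _)]
      exact ENNReal.ofReal_le_ofReal (norm_inner_le_norm _ _)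
  by_cases h0 : l2 η = 0
  · rw [h0]; exact zero_le
  · rw [sq] at h3
    exact (ENNReal.mul_le_mul_iff_left h0 (l2_schwartz_lt_top η).ne).1 h3

lemma l2_add_le {f g : E d → ℂ} (hf : AEStronglyMeasurable f) (hg : AEStronglyMeasurable g) :
    l2 (fun x => f x + g x) ≤ l2 f + l2 g := eLpNorm_add_le hf hg (by norm_num)

lemma tendsto_const_div_succ (C : ℝ≥0) {A : ℝ≥0∞} (hA : A ≠ ⊤) :
    Tendsto (fun n : ℕ => ENNReal.ofReal (C / (n + 1)) * A) atTop (𝓝 0) := by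
  have h1 : Tendsto (fun n : ℕ => ENNReal.ofReal (C / ((n : ℝ) + 1))) atTop (𝓝 0) := by
    have := ENNReal.tendsto_ofReal (tendsto_const_div_atTop_nhds_zero_nat (C : ℝ) |>.comp
      (tendsto_add_atTop_nat 1))
    simpa [Function.comp_def] using this
  have := ENNReal.Tendsto.mul_const h1 (Or.inr hA)
  simpa using this

lemma schwartz_lineDeriv_sub (φ ψ : 𝓢(E d, ℂ)) (v : E d) :
    (∂_{v} (φ - ψ) : 𝓢(E d, ℂ)) = ∂_{v} φ - ∂_{v} ψ :=
  map_sub (lineDerivOpCLM ℂ 𝓢(E d, ℂ) v) φ ψ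

/-- Logarithmic cutoffs converge in the norm of the derivative: the error `θₙ' χ` is of size `|χ /
t| / n`, and `χ / t ∈ L²`. -/
lemma tendsto_l2_lineDeriv_sub_annCut {χ : 𝓢(E d, ℂ)} (hχ : ∀ x, tCoord x = 0 → χ x = 0) :
    Tendsto (fun n => l2 (∂_{tDir d} (χ - annCut n χ) : 𝓢(E d, ℂ))) atTop (𝓝 0) := by
  obtain ⟨C, hC⟩ := exists_lineDeriv_annMul (d := d) (σ := fun _ => 1) (fun t _ => by simp)
  have h1 := (tendsto_l2_one_sub_theta (memLp_schwartz (∂_{tDir d} χ))).add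
    (tendsto_const_div_succ C (memLp_wt_neg_one hχ).2.ne)
  rw [add_zero] at h1
  refine tendsto_of_tendsto_of_tendsto_of_le_of_le tendsto_const_nhds h1 (fun _ => zero_le)
    fun n => ?_
  have h2 : l2 (∂_{tDir d} (χ - annCut n χ) : 𝓢(E d, ℂ)) ≤
      l2 (fun x => (1 - theta n (tCoord x) : ℂ) * ∂_{tDir d} χ x
        + (∂_{tDir d} (χ - annCut n χ) x - (1 - theta n (tCoord x) : ℂ) * ∂_{tDir d} χ x)) := by
    refine l2_mono (ae_of_all _ fun x => ?_)
    rw [add_sub_cancel]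
  have hm : AEStronglyMeasurable (fun x : E d => (1 - theta n (tCoord x) : ℂ) * ∂_{tDir d} χ x) :=
    (measurable_const.sub (Complex.measurable_ofReal.comp
      ((measurable_theta n).comp measurable_tCoord))).aestronglyMeasurable.mul
      (aestronglyMeasurable_schwartz _)
  refine h2.trans ((l2_add_le hm ((aestronglyMeasurable_schwartz _).sub hm)).trans ?_)
  gcongr
  refine eLpNorm_le_mul_eLpNorm_of_ae_le_mul ?_ 2
  filter_upwards [ae_tCoord_ne_zero] with x hx
  obtain ⟨ε, hε, h3⟩ := hC n χ x hx
  have h4 : ∂_{tDir d} (χ - annCut n χ) x - (1 - theta n (tCoord x) : ℂ) * ∂_{tDir d} χ x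
      = - (ε * χ x) := by
    rw [schwartz_lineDeriv_sub, sub_apply, h3]; ring
  rw [Pi.sub_apply, h4, norm_neg, norm_mul, Complex.norm_real, Real.norm_eq_abs]
  simp only [wt, norm_mul, norm_pw _ hx, Complex.neg_re, Complex.one_re, Real.rpow_neg_one]
  rw [← mul_assoc]
  gcongr
  rw [abs_mul] at hε
  rwa [← div_eq_mul_inv, le_div_iff₀ (abs_pos.2 hx), mul_comm]

/-- Hardy's inequality for Schwartz functions vanishing on `t = 0`. -/
theorem hardy {χ : 𝓢(E d, ℂ)} (hχ : ∀ x, tCoord x = 0 → χ x = 0) :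
    l2 (wt (-1) χ) ≤ 2 * l2 (∂_{tDir d} χ : 𝓢(E d, ℂ)) := by
  have h1 := ((tendsto_l2_lineDeriv_sub_annCut hχ).const_add (l2 (∂_{tDir d} χ : 𝓢(E d, ℂ))))
  have h2 := ENNReal.Tendsto.const_mul h1 (a := 2) (Or.inr (by norm_num))
  have h3 := h2.add (tendsto_l2_one_sub_theta (memLp_wt_neg_one hχ))
  rw [add_zero, add_zero] at h3
  refine ge_of_tendsto' h3 fun n => ?_
  have h4 : l2 (wt (-1) χ) ≤ l2 (wt (-1) (annCut n χ))
      + l2 fun x => (1 - theta n (tCoord x) : ℂ) * wt (-1) χ x := by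
    refine le_trans (l2_mono (ae_of_all _ fun x => le_of_eq ?_)) (l2_add_le
      (aestronglyMeasurable_wt _ (aestronglyMeasurable_schwartz _)) ?_)
    · congr 1
      simp only [wt, annCut_apply]; ring
    · exact (measurable_const.sub (Complex.measurable_ofReal.comp
        ((measurable_theta n).comp measurable_tCoord))).aestronglyMeasurable.mul
        (memLp_wt_neg_one hχ).1
  refine h4.trans ?_
  gcongr
  refine (hardy_annular (annCut_mem_annular n χ)).trans ?_
  gcongr
  have h5 : (∂_{tDir d} (annCut n χ) : 𝓢(E d, ℂ))
      = ∂_{tDir d} χ - ∂_{tDir d} (χ - annCut n χ) := by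
    rw [schwartz_lineDeriv_sub]; abel
  rw [h5]
  exact eLpNorm_sub_le (aestronglyMeasurable_schwartz _) (aestronglyMeasurable_schwartz _)
    (by norm_num)

/-! ### The Fourier transform of a tame distribution -/

lemma l2_congr {f g : E d → ℂ} (h : f =ᵐ[volume] g) : l2 f = l2 g := eLpNorm_congr_ae h

lemma l2_lp (g : Lp ℂ 2 (volume : Measure (E d))) : l2 g = ‖g‖ₑ := (Lp.enorm_def g).symm

lemma enorm_fourier_lp (g : Lp ℂ 2 (volume : Measure (E d))) :
    ‖(𝓕 g : Lp ℂ 2 (volume : Measure (E d)))‖ₑ = ‖g‖ₑ := by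
  rw [← ofReal_norm, ← ofReal_norm, Lp.norm_fourier_eq]

/-- A distribution is tame if it is bounded for the norm `‖φ‖₂ + ‖t φ‖₂` of test functions. This
is a property of all elements of `A_0 + A_1`; it excludes Fourier transforms with a singular part
on `t = 0`. -/
def IsTame (u : 𝓢'(E d, ℂ)) : Prop :=
  ∃ C : ℝ≥0, ∀ φ : 𝓢(E d, ℂ), ‖u φ‖ₑ ≤ C * (l2 φ + l2 (wt 1 φ))

lemma isTame_of_isRepresentedBy {s : ℝ} (hs0 : 0 ≤ s) (hs1 : s ≤ 1) {u : 𝓢'(E d, ℂ)}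
    {f : E d → ℂ} (hf : IsRepresentedBy u f) (h : MemLp (wt (-s) f) 2) : IsTame u := by
  refine ⟨(l2 (wt (-s) f)).toNNReal, fun φ => ?_⟩
  rw [ENNReal.coe_toNNReal h.2.ne, (hf.2 φ).2, mul_comm (l2 _)]
  refine (enorm_integral_mul_le_wt s (aestronglyMeasurable_schwartz φ) hf.1).trans ?_
  gcongr
  exact l2_wt_le (by simpa using hs0) (by simpa using hs1) (aestronglyMeasurable_schwartz φ)

lemma exists_isRepresentedBy_of_weightedSq {s : ℝ} {u : 𝓢'(E d, ℂ)} (h : weightedSq s u ≠ ⊤) :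
    ∃ f, IsRepresentedBy u f ∧ MemLp (wt (-s) f) 2 := by
  simp only [weightedSq_eq, ← lt_top_iff_ne_top, iInf_lt_iff] at h
  obtain ⟨f, hf, hlt⟩ := h
  exact ⟨f, hf, aestronglyMeasurable_wt _ hf.1, by simpa using! hlt⟩

lemma weightedSq_eq_of_isRepresentedBy (s : ℝ) {u : 𝓢'(E d, ℂ)} {f : E d → ℂ}
    (hf : IsRepresentedBy u f) : weightedSq s u = l2 (wt (-s) f) ^ 2 := by
  rw [weightedSq_eq]
  refine le_antisymm (iInf₂_le f hf) (le_iInf₂ fun g hg => le_of_eq ?_)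
  congr 1
  refine eLpNorm_congr_ae ?_
  filter_upwards [isRepresentedBy_ae_eq hf hg] with x hx
  simp [wt, hx]

lemma IsRepresentedBy.add {u v : 𝓢'(E d, ℂ)} {f g : E d → ℂ} (hf : IsRepresentedBy u f)
    (hg : IsRepresentedBy v g) : IsRepresentedBy (u + v) (fun x => f x + g x) := by
  refine ⟨hf.1.add hg.1, fun φ => ?_⟩
  have h : (fun x => φ x * (f x + g x)) = fun x => φ x * f x + φ x * g x := by
    ext x; ring
  rw [h]
  refine ⟨(hf.2 φ).1.add (hg.2 φ).1, ?_⟩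
  rw [integral_add (hf.2 φ).1 (hg.2 φ).1, ← (hf.2 φ).2, ← (hg.2 φ).2]
  rfl

lemma IsTame.add {u v : 𝓢'(E d, ℂ)} (hu : IsTame u) (hv : IsTame v) : IsTame (u + v) := by
  obtain ⟨C, hC⟩ := hu
  obtain ⟨D, hD⟩ := hv
  refine ⟨C + D, fun φ => ?_⟩
  push_cast
  rw [add_mul]
  exact (enorm_add_le _ _).trans (add_le_add (hC φ) (hD φ))

lemma isRepresentedBy_lp (g : Lp ℂ 2 (volume : Measure (E d))) :
    IsRepresentedBy (g : 𝓢'(E d, ℂ)) g :=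
  ⟨Lp.aestronglyMeasurable g, fun φ =>
    ⟨integrable_mul_of_memLp (memLp_schwartz φ) (Lp.memLp g), lp_apply_eq_integral g φ⟩⟩

lemma isRepresentedBy_and_isTame_of_sumNorm {u : 𝓢'(E d, ℂ)}
    (hu : sumNorm (normA d 0) (normA d 1) u < ⊤) : (∃ f, IsRepresentedBy u f) ∧ IsTame u := by
  obtain ⟨v₀, v₁, rfl, h0, h1⟩ := exists_of_sumNorm_lt_top hu
  have hw : weightedSq 1 v₁ ≠ ⊤ := fun h => by
    have := weightedSq_le_normA_sq one_ne_zero v₁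
    rw [h, top_le_iff] at this
    exact h1 (by simpa using this)
  obtain ⟨f₁, hf₁, hm₁⟩ := exists_isRepresentedBy_of_weightedSq hw
  simp only [normA_zero, ← lt_top_iff_ne_top, normL2, iInf_lt_iff] at h0
  obtain ⟨g, rfl, -⟩ := h0
  have hg := isRepresentedBy_lp g
  refine ⟨⟨_, hg.add hf₁⟩, IsTame.add ?_ ?_⟩
  · refine isTame_of_isRepresentedBy le_rfl zero_le_one hg ?_
    have : wt (-((0 : ℝ) : ℂ)) g = g := by simpa using wt_zero (g : E d → ℂ)
    rw [this]; exact Lp.memLp g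
  · exact isTame_of_isRepresentedBy zero_le_one le_rfl hf₁ hm₁

/-- Tameness makes `𝓕 u` continuous for the norm `‖χ‖₂ + ‖∂ₜ χ‖₂`, in which annular cutoffs of a
function vanishing on `t = 0` converge. -/
lemma tendsto_fourier_annCut {u : 𝓢'(E d, ℂ)} (hu : IsTame u) {χ : 𝓢(E d, ℂ)}
    (hχ : ∀ x, tCoord x = 0 → χ x = 0) :
    Tendsto (fun n => (𝓕 u) (annCut n χ)) atTop (𝓝 ((𝓕 u) χ)) := by
  obtain ⟨C, hC⟩ := hu
  rw [tendsto_iff_edist_tendsto_0]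
  have h0 := tendsto_l2_wt_sub_annCut (z := 0) le_rfl zero_le_one χ
  have h := ENNReal.Tendsto.const_mul (h0.add (tendsto_l2_lineDeriv_sub_annCut hχ)) (a := C)
    (Or.inr ENNReal.coe_ne_top)
  rw [add_zero, mul_zero] at h
  refine tendsto_of_tendsto_of_tendsto_of_le_of_le tendsto_const_nhds h (fun _ => zero_le)
    fun n => ?_
  rw [edist_comm, edist_eq_enorm_sub, ← map_sub]
  refine (hC (𝓕 (χ - annCut n χ))).trans ?_
  gcongr
  · rw [l2_fourier, wt_zero]
  · exact l2_wt_one_fourier_le _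

lemma memLp_wt_neg_of_vanish {s : ℝ} (hs0 : 0 ≤ s) (hs1 : s ≤ 1) {χ : 𝓢(E d, ℂ)}
    (hχ : ∀ x, tCoord x = 0 → χ x = 0) : MemLp (wt (-s) χ) 2 := by
  have h1 := memLp_wt_neg_one hχ
  have h2 : wt (1 - s : ℂ) (wt (-1) χ) =ᵐ[volume] wt (-s) χ := by
    have := wt_wt (1 - s : ℂ) (-1) χ
    rwa [show (1 - s + -1 : ℂ) = -s by ring] at this
  refine ⟨aestronglyMeasurable_wt _ (aestronglyMeasurable_schwartz χ), ?_⟩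
  rw [← eLpNorm_congr_ae h2]
  refine (l2_wt_le (by simpa using hs1) (by simpa using hs0) h1.1).trans_lt
    (ENNReal.add_lt_top.2 ⟨h1.2, ?_⟩)
  rw [l2_congr (wt_wt_neg 1 χ)]
  exact l2_schwartz_lt_top χ

/-- If the Fourier transform of a tame distribution is `|t|^{-s} k` away from `t = 0`, with
`k ∈ L²`, then it is so on all test functions vanishing on `t = 0`. -/
theorem fourier_apply_of_vanish {s : ℝ} (hs0 : 0 ≤ s) (hs1 : s ≤ 1) {u : 𝓢'(E d, ℂ)}
    (hu : IsTame u) {k : E d → ℂ} (hk : MemLp k 2)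
    (h : ∀ φ ∈ annular d, (𝓕 u) φ = ∫ x, φ x * wt (-s) k x) {χ : 𝓢(E d, ℂ)}
    (hχ : ∀ x, tCoord x = 0 → χ x = 0) :
    (𝓕 u) χ = ∫ x, χ x * wt (-s) k x := by
  refine tendsto_nhds_unique (tendsto_fourier_annCut hu hχ) ?_
  have hm := memLp_wt_neg_of_vanish hs0 hs1 hχ
  have hk' : MemLp (wt (-(-s : ℂ)) (wt (-s) k)) 2 := memLp_wt_neg_wt hk
  rw [tendsto_iff_edist_tendsto_0]
  have h1 := ENNReal.Tendsto.mul_const (tendsto_l2_one_sub_theta hm) (b := l2 k) (Or.inr hk.2.ne)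
  rw [zero_mul] at h1
  refine tendsto_of_tendsto_of_tendsto_of_le_of_le tendsto_const_nhds h1 (fun _ => zero_le)
    fun n => ?_
  rw [edist_comm, edist_eq_enorm_sub, h _ (annCut_mem_annular n χ), ← integral_sub
    (integrable_mul_of_wt hm hk')
    (integrable_mul_of_wt (memLp_wt_annular _ (annCut_mem_annular n χ)) hk')]
  have h2 : ∀ x, χ x * wt (-s) k x - annCut n χ x * wt (-s) k x
      = (χ - annCut n χ : 𝓢(E d, ℂ)) x * wt (-s) k x := fun x => by
    rw [sub_apply]; ring
  simp only [h2]
  refine (enorm_integral_mul_le_wt (-s) (aestronglyMeasurable_schwartz _)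
    (aestronglyMeasurable_wt _ hk.1)).trans ?_
  rw [l2_congr (wt_neg_wt (-s : ℂ) k)]
  gcongr
  refine l2_mono (ae_of_all _ fun x => le_of_eq ?_)
  congr 1
  simp only [wt, sub_apply, annCut_apply]; ring

/-! ### The fractional derivative on the Fourier side -/

lemma two_pi_rpow_pos (s : ℝ) : 0 < (2 * Real.pi) ^ s := Real.rpow_pos_of_pos (by positivity) _

lemma isFracDeriv_iff {s : ℝ} (hs1 : s < 1) {u : 𝓢'(E d, ℂ)}
    {g : Lp ℂ 2 (volume : Measure (E d))} : IsFracDeriv s u g ↔ ∀ φ χ : 𝓢(E d, ℂ),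
      (∀ ξ, χ ξ = ((|2 * Real.pi * tCoord ξ| ^ s : ℝ) : ℂ) * φ ξ) →
        (𝓕 u) χ = (𝓕 (g : 𝓢'(E d, ℂ))) φ := by
  rw [IsFracDeriv, if_neg hs1.ne]

lemma abs_two_pi_mul_rpow (s t : ℝ) :
    ((|2 * Real.pi * t| ^ s : ℝ) : ℂ) = ((2 * Real.pi) ^ s : ℝ) * ((|t| ^ s : ℝ) : ℂ) := by
  rw [abs_mul, abs_of_pos (by positivity : 0 < 2 * Real.pi),
    Real.mul_rpow (by positivity) (abs_nonneg t)]
  push_cast; rfl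

/-- For a tame distribution, a bound of `𝓕 u` on annular functions gives `D^s u ∈ L²`. The
constant `7` is a bound for `(2π)^s`. -/
theorem fracDerivSq_le_of_annular_bound {s : ℝ} (hs0 : 0 < s) (hs1 : s < 1) {u : 𝓢'(E d, ℂ)}
    (hu : IsTame u) {M : ℝ≥0} (h : ∀ φ ∈ annular d, ‖(𝓕 u) φ‖ₑ ≤ M * l2 (wt (-s) φ)) :
    fracDerivSq s u ≤ (7 * M) ^ 2 := by
  obtain ⟨k, hk, hkM, hku⟩ := exists_memLp_of_annular_bound
    ((𝓕 u : 𝓢(E d, ℂ) →L[ℂ] ℂ) : 𝓢(E d, ℂ) →ₗ[ℂ] ℂ) (-s) M h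
  set c : ℝ := (2 * Real.pi) ^ s with hc
  set g : Lp ℂ 2 (volume : Measure (E d)) := 𝓕⁻ ((c : ℂ) • hk.toLp) with hg
  have hFg : (𝓕 g : Lp ℂ 2 (volume : Measure (E d))) = (c : ℂ) • hk.toLp := by
    rw [hg, FourierTransform.fourier_fourierInv_eq]
  have hgu : IsFracDeriv s u g := by
    rw [isFracDeriv_iff hs1]
    intro φ χ hχ
    have hχ0 : ∀ x, tCoord x = 0 → χ x = 0 := fun x hx => by
      rw [hχ, hx]; simp [Real.zero_rpow hs0.ne']
    rw [fourier_apply_of_vanish hs0.le hs1.le hu hk hku hχ0, fourier_lp_apply, hFg]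
    refine integral_congr_ae ?_
    filter_upwards [Lp.coeFn_smul (c : ℂ) hk.toLp, hk.coeFn_toLp, ae_tCoord_ne_zero]
      with x h1 h2 hx
    rw [h1, Pi.smul_apply, h2, hχ, abs_two_pi_mul_rpow, ← hc, ← pw_ofReal, wt, smul_eq_mul]
    linear_combination (c * φ x * k x) * pw_neg_mul_pw (s : ℂ) hx
  refine (iInf₂_le g hgu).trans ?_
  gcongr
  have h1 : ‖g‖ₑ = ‖(c : ℂ) • hk.toLp (μ := (volume : Measure (E d)))‖ₑ := by
    rw [← hFg, enorm_fourier_lp]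
  rw [h1, enorm_smul]
  gcongr
  · rw [← ofReal_norm, Complex.norm_real, Real.norm_of_nonneg (two_pi_rpow_pos s).le,
      show (7 : ℝ≥0∞) = ENNReal.ofReal 7 by simp]
    refine ENNReal.ofReal_le_ofReal ?_
    calc (2 * Real.pi) ^ s ≤ (2 * Real.pi) ^ (1 : ℝ) :=
          Real.rpow_le_rpow_of_exponent_le (by linarith [Real.pi_gt_three]) hs1.le
      _ ≤ 7 := by rw [Real.rpow_one]; linarith [Real.pi_lt_d2]
  · rwa [Lp.enorm_toLp]

/-- Conversely, if `D^s u = g ∈ L²` then `𝓕 u = |t|^{-s} k` off `t = 0`, with `k = (2π)^{-s} 𝓕 g`.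
-/
theorem exists_of_isFracDeriv {s : ℝ} (hs0 : 0 < s) (hs1 : s < 1) {u : 𝓢'(E d, ℂ)}
    {g : Lp ℂ 2 (volume : Measure (E d))} (h : IsFracDeriv s u g) :
    ∃ k : E d → ℂ, MemLp k 2 ∧ l2 k ≤ ‖g‖ₑ ∧
      ∀ φ ∈ annular d, (𝓕 u) φ = ∫ x, φ x * wt (-s) k x := by
  rw [isFracDeriv_iff hs1] at h
  set c : ℝ := (2 * Real.pi) ^ s with hc
  have hc0 : 0 < c := two_pi_rpow_pos s
  refine ⟨fun x => (c : ℂ)⁻¹ * (𝓕 g : Lp ℂ 2 (volume : Measure (E d))) x,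
    (Lp.memLp _).const_mul _, ?_, fun φ hφ => ?_⟩
  · rw [l2_const_mul, l2_lp, enorm_fourier_lp]
    refine mul_le_of_le_one_left zero_le ?_
    rw [← ofReal_norm, norm_inv, Complex.norm_real, Real.norm_of_nonneg hc0.le]
    refine ENNReal.ofReal_le_one.2 (inv_le_one_of_one_le₀ ?_)
    exact Real.one_le_rpow (by linarith [Real.pi_gt_three]) hs0.le
  · obtain ⟨ψ, -, hψ⟩ := exists_schwartz_wt (-s) hφ
    have h1 := h ((c : ℂ)⁻¹ • ψ) φ fun x => by
      rw [abs_two_pi_mul_rpow, ← hc, smul_apply, hψ, wt, smul_eq_mul, ← pw_ofReal]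
      by_cases hx : tCoord x = 0
      · rw [annular_apply_eq_zero hφ hx]; simp
      · have hcc : (c : ℂ) ≠ 0 := by exact_mod_cast hc0.ne'
        have := pw_neg_mul_pw (s : ℂ) hx
        field_simp
        linear_combination (-φ x) * this
    rw [h1, fourier_lp_apply]
    congr 1; ext x
    rw [smul_apply, hψ, smul_eq_mul]
    simp only [wt]; ring

/-! ### The interpolation space embeds into `A_s` -/

/-- The inclusion of the interpolation space in `A_s`: three lines for `F` and for its Fourier
transform, with weights of opposite sign. -/
theorem normA_le_of_isAdmissible {s : ℝ} (hs0 : 0 < s) (hs1 : s < 1) {F : ℂ → 𝓢'(E d, ℂ)}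
    (hF : IsAdmissible (normA d 0) (normA d 1) F) :
    normA d s (F s) ≤ 14 * stripNorm (normA d 0) (normA d 1) F := by
  have hfin := stripNorm_lt_top hF
  obtain ⟨M, hM⟩ := WithTop.ne_top_iff_exists.1 hfin.ne
  change (M : ℝ≥0∞) = _ at hM
  obtain ⟨B, hB⟩ := hF.bounded
  obtain ⟨⟨f, hf⟩, htame⟩ := isRepresentedBy_and_isTame_of_sumNorm
    ((hB s ⟨by simpa using hs0.le, by simpa using hs1.le⟩).trans_lt ENNReal.coe_lt_top)
  have hw : weightedSq s (F s) ≤ M ^ 2 := by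
    rw [weightedSq_eq_of_isRepresentedBy s hf]
    gcongr
    refine (l2_wt_le_of_annular_bound hs0.le hs1.le (fun φ => (hf.2 φ).1) fun φ hφ => ?_).2
    rw [← (hf.2 φ).2]
    have := enorm_apply_le_of_isAdmissible (a := 1)
      { toFun := fun u : 𝓢'(E d, ℂ) => ((u : 𝓢(E d, ℂ) →L[ℂ] ℂ) : 𝓢(E d, ℂ) →ₗ[ℂ] ℂ)
        map_add' := fun u v => rfl
        map_smul' := fun c u => rfl }
      (fun v hv φ _ => enorm_apply_le_normA_zero hv φ)
      (fun v hv φ _ => by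
        rw [Complex.ofReal_one]; exact enorm_apply_le_normA_one hv φ) hF hM.ge hs0.le hs1.le hφ
    simpa using! this
  have hD : fracDerivSq s (F s) ≤ (7 * M) ^ 2 := by
    refine fracDerivSq_le_of_annular_bound hs0 hs1 htame fun φ hφ => ?_
    have := enorm_apply_le_of_isAdmissible (a := -1)
      { toFun := fun u : 𝓢'(E d, ℂ) => ((𝓕 u : 𝓢(E d, ℂ) →L[ℂ] ℂ) : 𝓢(E d, ℂ) →ₗ[ℂ] ℂ)
        map_add' := fun u v => rfl
        map_smul' := fun c u => rfl }
      (fun v hv φ _ => by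
        have := enorm_apply_le_normA_zero hv (𝓕 φ)
        rwa [l2_fourier] at this)
      (fun v hv φ hφ => by
        rw [Complex.ofReal_neg, Complex.ofReal_one]
        exact enorm_fourier_apply_le_of_fracDerivSq hv (fracDerivSq_le_normA_sq one_ne_zero v) hφ)
      hF hM.ge hs0.le hs1.le hφ
    simpa using! this
  calc normA d s (F s) ≤ 2 * (7 * M) := by
        refine normA_le_of_sq_le hs0.ne' (hw.trans ?_) hD
        gcongr
        exact le_mul_of_one_le_left zero_le (by norm_num)
    _ = 14 * M := by rw [← mul_assoc]; norm_num
    _ = _ := by rw [hM]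

/-- A linear functional with a tame bound is continuous on the Schwartz space. -/
lemma exists_tempered_of_tame_bound (L : 𝓢(E d, ℂ) →ₗ[ℂ] ℂ) {C : ℝ≥0}
    (h : ∀ φ : 𝓢(E d, ℂ), ‖L φ‖ₑ ≤ C * (l2 φ + l2 (wt 1 φ))) :
    ∃ u : 𝓢'(E d, ℂ), ∀ φ, u φ = L φ := by
  have h2 : Continuous fun φ : 𝓢(E d, ℂ) => l2 φ := by
    simp only [← enorm_toLp]
    exact (SchwartzMap.toLpCLM ℂ ℂ 2 (volume : Measure (E d))).continuous.enorm
  have hcont : Continuous L := by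
    refine continuous_of_continuousAt_zero L ?_
    rw [ContinuousAt, map_zero, tendsto_iff_edist_tendsto_0]
    have h3 : Continuous fun φ : 𝓢(E d, ℂ) => (C : ℝ≥0∞) * (l2 φ + l2 (wt 1 φ)) := by
      simp only [← l2_mulT]
      exact ENNReal.continuous_const_mul ENNReal.coe_ne_top |>.comp
        (h2.add (h2.comp mulT.continuous))
    have h4 := h3.tendsto 0
    have h5 : (C : ℝ≥0∞) * (l2 (0 : 𝓢(E d, ℂ)) + l2 (wt 1 (0 : 𝓢(E d, ℂ)))) = 0 := by
      have h6 : ((0 : 𝓢(E d, ℂ)) : E d → ℂ) = 0 := rfl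
      rw [← l2_mulT, map_zero, h6, l2, eLpNorm_zero, add_zero, mul_zero]
    rw [h5] at h4
    refine tendsto_of_tendsto_of_tendsto_of_le_of_le tendsto_const_nhds h4 (fun _ => zero_le)
      fun φ => ?_
    rw [edist_eq_enorm_sub, sub_zero]
    exact h φ
  exact ⟨ContinuousLinearMap.toPointwiseConvergenceCLM _ _ _ _ ⟨L, hcont⟩, fun φ => rfl⟩

/-! ### Reflection in the last coordinate and odd parts -/

/-- The reflection `(z, t) ↦ (z, -t)`. -/
noncomputable def reflT (d : ℕ) : E d ≃ₗᵢ[ℝ] E d := (ℝ ∙ tDir d)ᗮ.reflection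

lemma reflT_reflT (x : E d) : reflT d (reflT d x) = x := Submodule.reflection_reflection _ x

lemma reflT_tDir : reflT d (tDir d) = -tDir d :=
  Submodule.reflection_orthogonalComplement_singleton_eq_neg (tDir d)

@[simp] lemma tCoord_reflT (x : E d) : tCoord (reflT d x) = -tCoord x := by
  rw [← inner_tDir, ← inner_tDir, ← (reflT d).inner_map_map, reflT_reflT, reflT_tDir,
    inner_neg_right]

lemma reflT_eq_self {x : E d} (hx : tCoord x = 0) : reflT d x = x := by
  refine Submodule.reflection_mem_subspace_eq_self ?_
  rw [Submodule.mem_orthogonal_singleton_iff_inner_left, inner_tDir, hx]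

lemma measurePreserving_reflT : MeasurePreserving (reflT d) volume volume :=
  (reflT d).measurePreserving

lemma l2_comp_reflT {f : E d → ℂ} (hf : AEStronglyMeasurable f) : l2 (f ∘ reflT d) = l2 f :=
  eLpNorm_comp_measurePreserving hf measurePreserving_reflT

lemma integral_comp_reflT (f : E d → ℂ) : ∫ x, f (reflT d x) = ∫ x, f x :=
  measurePreserving_reflT.integral_comp (reflT d).toHomeomorph.measurableEmbedding f

/-- Composition of Schwartz functions with the reflection in `t`. -/
noncomputable def compReflT : 𝓢(E d, ℂ) →L[ℂ] 𝓢(E d, ℂ) :=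
  SchwartzMap.compCLMOfContinuousLinearEquiv ℂ (reflT d).toContinuousLinearEquiv

@[simp] lemma compReflT_apply (φ : 𝓢(E d, ℂ)) (x : E d) : compReflT φ x = φ (reflT d x) := rfl

lemma coe_compReflT (φ : 𝓢(E d, ℂ)) : (compReflT φ : E d → ℂ) = φ ∘ reflT d := rfl

lemma fourier_compReflT (φ : 𝓢(E d, ℂ)) :
    (𝓕 (compReflT φ) : 𝓢(E d, ℂ)) = compReflT (𝓕 φ) := by
  ext x
  rw [compReflT_apply, fourier_coe, fourier_coe, coe_compReflT]
  exact Real.fourier_comp_linearIsometry (reflT d) φ x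

/-- The part of a Schwartz function that is odd in `t`. -/
noncomputable def oddPart : 𝓢(E d, ℂ) →L[ℂ] 𝓢(E d, ℂ) :=
  (2⁻¹ : ℂ) • (ContinuousLinearMap.id ℂ _ - compReflT)

lemma oddPart_apply (φ : 𝓢(E d, ℂ)) (x : E d) :
    oddPart φ x = 2⁻¹ * (φ x - φ (reflT d x)) := rfl

lemma oddPart_eq (φ : 𝓢(E d, ℂ)) : oddPart φ = (2⁻¹ : ℂ) • (φ - compReflT φ) := rfl

lemma oddPart_apply_of_tCoord_eq_zero (φ : 𝓢(E d, ℂ)) {x : E d} (hx : tCoord x = 0) :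
    oddPart φ x = 0 := by
  rw [oddPart_apply, reflT_eq_self hx, sub_self, mul_zero]

lemma fourier_oddPart (φ : 𝓢(E d, ℂ)) :
    (𝓕 (oddPart φ) : 𝓢(E d, ℂ)) = oddPart (𝓕 φ) := by
  simp only [oddPart_eq, ← fourierCLM_apply (R := ℂ), map_smul, map_sub]
  rw [fourierCLM_apply, fourierCLM_apply, fourier_compReflT]

lemma fourierInv_oddPart (φ : 𝓢(E d, ℂ)) :
    (𝓕⁻ (oddPart φ) : 𝓢(E d, ℂ)) = oddPart (𝓕⁻ φ) := by
  rw [← FourierTransform.fourierInv_fourier_eq (F := 𝓢(E d, ℂ)) (oddPart (𝓕⁻ φ)),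
    fourier_oddPart, FourierTransform.fourier_fourierInv_eq]

/-- Symmetrization with either sign does not increase the norm. -/
lemma l2_half_add_comp_le {f : E d → ℂ} (hf : AEStronglyMeasurable f) {ε : ℂ} (hε : ‖ε‖ₑ = 1) :
    l2 (fun x => 2⁻¹ * (f x + ε * f (reflT d x))) ≤ l2 f := by
  have hf' : AEStronglyMeasurable (f ∘ reflT d) :=
    hf.comp_quasiMeasurePreserving measurePreserving_reflT.quasiMeasurePreserving
  rw [l2_const_mul]
  calc ‖(2⁻¹ : ℂ)‖ₑ * l2 (fun x => f x + ε * f (reflT d x))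
      ≤ ‖(2⁻¹ : ℂ)‖ₑ * (l2 f + l2 fun x => ε * (f ∘ reflT d) x) := by
        gcongr
        exact l2_add_le hf (hf'.const_mul ε)
    _ = ‖(2⁻¹ : ℂ)‖ₑ * (2 * l2 f) := by
        rw [l2_const_mul, l2_comp_reflT hf, hε, one_mul, two_mul]
    _ = l2 f := by
        rw [← mul_assoc, enorm_inv two_ne_zero]
        have : ‖(2 : ℂ)‖ₑ = 2 := by rw [← ofReal_norm]; simp
        rw [this, ENNReal.inv_mul_cancel two_ne_zero ENNReal.ofNat_ne_top, one_mul]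

lemma l2_wt_oddPart_le (z : ℂ) (φ : 𝓢(E d, ℂ)) : l2 (wt z (oddPart φ)) ≤ l2 (wt z φ) := by
  have h := l2_half_add_comp_le (aestronglyMeasurable_wt z (aestronglyMeasurable_schwartz φ))
    (ε := -1) (by simp)
  refine le_trans (le_of_eq ?_) h
  congr 1; ext x
  simp only [wt, oddPart_apply, pw, tCoord_reflT, abs_neg]; ring

/-- The inverse Fourier transform of the odd part of a Schwartz function. It vanishes on `t = 0`. -/
noncomputable def oddFourierInv : 𝓢(E d, ℂ) →L[ℂ] 𝓢(E d, ℂ) :=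
  (fourierInvCLM ℂ 𝓢(E d, ℂ)).comp oddPart

lemma oddFourierInv_eq (ψ : 𝓢(E d, ℂ)) : oddFourierInv ψ = 𝓕⁻ (oddPart ψ) := rfl

lemma oddFourierInv_eq' (ψ : 𝓢(E d, ℂ)) : oddFourierInv ψ = oddPart (𝓕⁻ ψ) := by
  rw [oddFourierInv_eq, fourierInv_oddPart]

lemma oddFourierInv_vanish (ψ : 𝓢(E d, ℂ)) (x : E d) (hx : tCoord x = 0) :
    oddFourierInv ψ x = 0 := by
  rw [oddFourierInv_eq', oddPart_apply_of_tCoord_eq_zero _ hx]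

lemma l2_oddFourierInv_le (ψ : 𝓢(E d, ℂ)) : l2 (oddFourierInv ψ) ≤ l2 ψ := by
  rw [oddFourierInv_eq, l2_fourierInv]
  simpa [wt_zero] using l2_wt_oddPart_le 0 ψ

lemma enorm_two_pi_I_le : ‖(2 * Real.pi * Complex.I : ℂ)‖ₑ ≤ 7 := by
  rw [enorm_two_pi_I, show (7 : ℝ≥0∞) = ENNReal.ofReal 7 by simp]
  exact ENNReal.ofReal_le_ofReal (by linarith [Real.pi_lt_d2])

/-- By Hardy's inequality, since `𝓕⁻ (oddPart ψ)` vanishes on `t = 0`. -/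
lemma l2_wt_neg_one_oddFourierInv_le (ψ : 𝓢(E d, ℂ)) :
    l2 (wt (-1) (oddFourierInv ψ)) ≤ 14 * l2 (wt 1 ψ) := by
  refine (hardy (oddFourierInv_vanish ψ)).trans ?_
  rw [oddFourierInv_eq, lineDeriv_fourierInv, l2_fourierInv, l2_smul, l2_mulT, ← mul_assoc]
  calc 2 * ‖(2 * Real.pi * Complex.I : ℂ)‖ₑ * l2 (wt 1 (oddPart ψ))
      ≤ 2 * 7 * l2 (wt 1 ψ) := by
        gcongr
        · exact enorm_two_pi_I_le
        · exact l2_wt_oddPart_le 1 ψ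
    _ = _ := by norm_num

/-- Up to sign, `𝓕⁻ (oddPart (∂ₜ ψ))` is `2πi t` times the even part of `𝓕⁻ ψ`, so that division
by `|t|` leaves an `L²` function. -/
lemma l2_wt_neg_one_oddFourierInv_lineDeriv_le (ψ : 𝓢(E d, ℂ)) :
    l2 (wt (-1) (oddFourierInv (∂_{tDir d} ψ))) ≤ 7 * l2 ψ := by
  have h1 : l2 (wt (-1) (oddFourierInv (∂_{tDir d} ψ))) = ‖(2 * Real.pi * Complex.I : ℂ)‖ₑ *
      l2 (fun x => 2⁻¹ * ((𝓕⁻ ψ : 𝓢(E d, ℂ)) x + 1 * (𝓕⁻ ψ : 𝓢(E d, ℂ)) (reflT d x))) := by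
    rw [← l2_const_mul]
    refine eLpNorm_congr_norm_ae ?_
    filter_upwards [ae_tCoord_ne_zero] with x hx
    rw [oddFourierInv_eq', fourierInv_lineDeriv, wt, norm_mul, norm_pw _ hx, oddPart_apply]
    simp only [smul_apply, mulT_apply, tCoord_reflT, smul_eq_mul, Complex.ofReal_neg,
      Complex.neg_re, Complex.one_re, Real.rpow_neg_one, one_mul]
    rw [show (2⁻¹ * (-(2 * Real.pi * Complex.I) * (tCoord x * (𝓕⁻ ψ : 𝓢(E d, ℂ)) x)
        - -(2 * Real.pi * Complex.I) * (-tCoord x * (𝓕⁻ ψ : 𝓢(E d, ℂ)) (reflT d x))) : ℂ)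
        = -tCoord x * ((2 * Real.pi * Complex.I) *
          (2⁻¹ * ((𝓕⁻ ψ : 𝓢(E d, ℂ)) x + (𝓕⁻ ψ : 𝓢(E d, ℂ)) (reflT d x)))) by ring,
      norm_mul _ (_ * _), norm_neg, Complex.norm_real, Real.norm_eq_abs, ← mul_assoc,
      inv_mul_cancel₀ (abs_ne_zero.2 hx), one_mul]
  rw [h1]
  gcongr
  · exact enorm_two_pi_I_le
  · exact (l2_half_add_comp_le (aestronglyMeasurable_schwartz _) (by simp)).trans
      (l2_fourierInv ψ).le

/-! ### Odd distributions with a given Fourier transform -/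

/-- The function `min(1, |t|) b`. -/
noncomputable def lowMul (b : E d → ℂ) : E d → ℂ := fun x => ((min 1 |tCoord x| : ℝ) : ℂ) * b x

lemma aestronglyMeasurable_of_lowMul {b : E d → ℂ} (hb : MemLp (lowMul b) 2) :
    AEStronglyMeasurable b := by
  have h1 : AEStronglyMeasurable (fun x : E d => (((min 1 |tCoord x| : ℝ) : ℂ))⁻¹) :=
    (Complex.measurable_ofReal.comp (measurable_const.min
      (measurable_tCoord.norm))).inv.aestronglyMeasurable
  refine (h1.mul hb.1).congr ?_
  filter_upwards [ae_tCoord_ne_zero] with x hx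
  have : ((min 1 |tCoord x| : ℝ) : ℂ) ≠ 0 := by
    exact_mod_cast (lt_min one_pos (abs_pos.2 hx)).ne'
  simp only [Pi.mul_apply, lowMul]
  rw [← mul_assoc, inv_mul_cancel₀ this, one_mul]

lemma l2_div_lowMul_le {f : E d → ℂ} (hf : AEStronglyMeasurable f) :
    l2 (fun x => (((min 1 |tCoord x| : ℝ) : ℂ))⁻¹ * f x) ≤ l2 f + l2 (wt (-1) f) := by
  have h : l2 (fun x => (((min 1 |tCoord x| : ℝ) : ℂ))⁻¹ * f x)
      ≤ eLpNorm (fun x => ‖f x‖ + ‖wt (-1) f x‖) 2 volume := by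
    refine eLpNorm_mono_ae ?_
    filter_upwards [ae_tCoord_ne_zero] with x hx
    have hp := abs_pos.2 hx
    have hm : 0 < min 1 |tCoord x| := lt_min one_pos hp
    rw [norm_mul, norm_inv, Complex.norm_real, Real.norm_of_nonneg hm.le, wt, norm_mul,
      norm_pw _ hx, Real.norm_of_nonneg (by positivity)]
    simp only [Complex.neg_re, Complex.one_re, Real.rpow_neg_one]
    rw [← one_add_mul]
    gcongr
    rcases min_cases 1 |tCoord x| with h | h <;> rw [h.1]
    · simp only [inv_one]; linarith [inv_pos.2 hp]
    · linarith
  refine h.trans ((eLpNorm_add_le hf.norm (aestronglyMeasurable_wt _ hf).norm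
    (by norm_num)).trans ?_)
  rw [eLpNorm_norm, eLpNorm_norm]

lemma mul_ae_eq_low {b : E d → ℂ} (f : E d → ℂ) : (fun x => f x * b x) =ᵐ[volume]
    fun x => (((min 1 |tCoord x| : ℝ) : ℂ))⁻¹ * f x * lowMul b x := by
  filter_upwards [ae_tCoord_ne_zero] with x hx
  have : ((min 1 |tCoord x| : ℝ) : ℂ) ≠ 0 := by
    exact_mod_cast (lt_min one_pos (abs_pos.2 hx)).ne'
  rw [lowMul]; field_simp

lemma memLp_div_low {f : E d → ℂ} (hf : MemLp f 2) (hf' : MemLp (wt (-1) f) 2) :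
    MemLp (fun x => (((min 1 |tCoord x| : ℝ) : ℂ))⁻¹ * f x) 2 :=
  ⟨((Complex.measurable_ofReal.comp (measurable_const.min
      (measurable_tCoord.norm))).inv.aestronglyMeasurable.mul hf.1),
    (l2_div_lowMul_le hf.1).trans_lt (ENNReal.add_lt_top.2 ⟨hf.2, hf'.2⟩)⟩

lemma memLp_wt_neg_one_oddFourierInv (ψ : 𝓢(E d, ℂ)) : MemLp (wt (-1) (oddFourierInv ψ)) 2 :=
  memLp_wt_neg_one (oddFourierInv_vanish ψ)

lemma integrable_oddFourierInv_mul {b : E d → ℂ} (hb : MemLp (lowMul b) 2) (ψ : 𝓢(E d, ℂ)) :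
    Integrable fun x => oddFourierInv ψ x * b x :=
  (integrable_mul_of_memLp (memLp_div_low (memLp_schwartz _) (memLp_wt_neg_one_oddFourierInv ψ))
    hb).congr (mul_ae_eq_low _).symm

lemma exists_oddDistr {b : E d → ℂ} (hb : MemLp (lowMul b) 2) :
    ∃ u : 𝓢'(E d, ℂ), ∀ ψ, u ψ = ∫ x, oddFourierInv ψ x * b x := by
  refine exists_tempered_of_tame_bound (C := 14 * (l2 (lowMul b)).toNNReal)
    { toFun ψ := ∫ x, oddFourierInv ψ x * b x
      map_add' φ ψ := ?_
      map_smul' c ψ := ?_ } fun ψ => ?_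
  · rw [← integral_add (integrable_oddFourierInv_mul hb φ) (integrable_oddFourierInv_mul hb ψ)]
    congr 1; ext x
    rw [map_add, add_apply]; ring
  · rw [RingHom.id_apply, smul_eq_mul, ← integral_const_mul]
    congr 1; ext x
    rw [map_smul, smul_apply, smul_eq_mul]; ring
  · change ‖∫ x, oddFourierInv ψ x * b x‖ₑ ≤ _
    have hm := memLp_div_low (memLp_schwartz _) (memLp_wt_neg_one_oddFourierInv ψ)
    rw [integral_congr_ae (mul_ae_eq_low _)]
    refine (enorm_integral_mul_le hm.1 hb.1).trans ?_
    push_cast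
    rw [ENNReal.coe_toNNReal hb.2.ne, mul_comm, mul_comm (14 : ℝ≥0∞), mul_assoc]
    gcongr
    refine (l2_div_lowMul_le (aestronglyMeasurable_schwartz _)).trans ?_
    rw [mul_add]
    refine add_le_add ((l2_oddFourierInv_le ψ).trans ?_) (l2_wt_neg_one_oddFourierInv_le ψ)
    exact le_mul_of_one_le_left zero_le (by norm_num)

open Classical in
/-- The distribution odd in `t` whose Fourier transform is the odd part of `b`; here `b` may be
singular at `t = 0`, as long as `min(1, |t|) b ∈ L²` (and `0` is a junk value otherwise). -/
noncomputable def oddDistr (b : E d → ℂ) : 𝓢'(E d, ℂ) :=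
  if hb : MemLp (lowMul b) 2 then (exists_oddDistr hb).choose else 0

lemma oddDistr_apply {b : E d → ℂ} (hb : MemLp (lowMul b) 2) (ψ : 𝓢(E d, ℂ)) :
    oddDistr b ψ = ∫ x, oddFourierInv ψ x * b x := by
  rw [oddDistr, dif_pos hb]
  exact (exists_oddDistr hb).choose_spec ψ

lemma normA_zero_oddDistr_le {b : E d → ℂ} (hb : MemLp (lowMul b) 2) :
    normA d 0 (oddDistr b) ≤ l2 b := by
  by_cases h : l2 b = ⊤
  · rw [h]; exact le_top
  refine normA_zero_le_of_bound h fun ψ => ?_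
  rw [oddDistr_apply hb, mul_comm (l2 b)]
  refine (enorm_integral_mul_le (aestronglyMeasurable_schwartz _)
    (aestronglyMeasurable_of_lowMul hb)).trans ?_
  gcongr
  exact l2_oddFourierInv_le ψ

/-- Odd synthesis maps `L²(t² dz dt)` to `A_1`: after transposition, the two parts of the norm are
the two bounds for `|t|^{-1} 𝓕⁻ (oddPart ψ)`. -/
lemma normA_one_oddDistr_le {b : E d → ℂ} (hb : MemLp (lowMul b) 2) :
    normA d 1 (oddDistr b) ≤ 28 * l2 (wt 1 b) := by
  by_cases h : l2 (wt 1 b) = ⊤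
  · rw [h]; simp
  rw [show (28 : ℝ≥0∞) = 2 * 14 by norm_num, mul_assoc]
  have hbm := aestronglyMeasurable_of_lowMul hb
  have key : ∀ ψ, ‖oddDistr b ψ‖ₑ ≤ l2 (wt (-1) (oddFourierInv ψ)) * l2 (wt 1 b) := fun ψ => by
    rw [oddDistr_apply hb]
    simpa using enorm_integral_mul_le_wt (-1) (aestronglyMeasurable_schwartz _) hbm
  refine normA_one_le_of_bound (ENNReal.mul_ne_top (by norm_num) h) (fun ψ => ?_) fun ψ => ?_
  · refine (key ψ).trans ?_
    rw [mul_right_comm]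
    gcongr
    exact l2_wt_neg_one_oddFourierInv_le ψ
  · refine (key _).trans ?_
    rw [mul_right_comm]
    gcongr
    refine (l2_wt_neg_one_oddFourierInv_lineDeriv_le ψ).trans ?_
    gcongr
    norm_num

lemma lowMul_add (b c : E d → ℂ) : lowMul (b + c) = lowMul b + lowMul c := by
  ext x; simp [lowMul, mul_add]

lemma lowMul_smul (r : ℂ) (b : E d → ℂ) : lowMul (r • b) = r • lowMul b := by
  ext x; simp only [lowMul, Pi.smul_apply, smul_eq_mul]; ring

lemma oddDistr_add {b c : E d → ℂ} (hb : MemLp (lowMul b) 2) (hc : MemLp (lowMul c) 2) :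
    oddDistr (b + c) = oddDistr b + oddDistr c := by
  ext ψ
  change _ = oddDistr b ψ + oddDistr c ψ
  rw [oddDistr_apply hb, oddDistr_apply hc, oddDistr_apply (by rw [lowMul_add]; exact hb.add hc),
    ← integral_add (integrable_oddFourierInv_mul hb ψ) (integrable_oddFourierInv_mul hc ψ)]
  simp [mul_add]

lemma oddDistr_smul {b : E d → ℂ} (r : ℂ) (hb : MemLp (lowMul b) 2) :
    oddDistr (r • b) = r • oddDistr b := by
  ext ψ
  change _ = r * oddDistr b ψ
  rw [oddDistr_apply hb, oddDistr_apply (by rw [lowMul_smul]; exact hb.const_smul r),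
    ← integral_const_mul]
  congr 1; ext x
  simp only [Pi.smul_apply, smul_eq_mul]; ring

/-! ### Multiplication by the sign of the last coordinate -/

open Classical in
/-- The sign of `t`, with the value `-1` at `t = 0`. -/
noncomputable def sgn (t : ℝ) : ℂ := if 0 < t then 1 else -1

lemma sgn_mul_self (t : ℝ) : sgn t * sgn t = 1 := by unfold sgn; split_ifs <;> norm_num

@[simp] lemma norm_sgn (t : ℝ) : ‖sgn t‖ = 1 := by unfold sgn; split_ifs <;> simp

lemma measurable_sgn : Measurable sgn :=
  Measurable.ite measurableSet_Ioi measurable_const measurable_const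

lemma sgn_eventuallyEq {t : ℝ} (ht : t ≠ 0) : ∀ᶠ r in 𝓝 t, sgn r = sgn t := by
  rcases ht.lt_or_gt with h | h
  · filter_upwards [gt_mem_nhds h] with r hr
    simp [sgn, hr.not_gt, h.not_gt]
  · filter_upwards [lt_mem_nhds h] with r hr
    simp [sgn, hr, h]

lemma contDiffAt_sgn (t : ℝ) (ht : t ≠ 0) : ContDiffAt ℝ ∞ sgn t :=
  contDiffAt_const.congr_of_eventuallyEq (sgn_eventuallyEq ht)

lemma sgn_neg {t : ℝ} (ht : t ≠ 0) : sgn (-t) = -sgn t := by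
  rcases ht.lt_or_gt with h | h <;> simp [sgn, h, h.not_gt]

/-- Multiplication of functions by the sign of `t`. -/
noncomputable def sgnMul (f : E d → ℂ) : E d → ℂ := fun x => sgn (tCoord x) * f x

lemma wt_sgnMul (z : ℂ) (f : E d → ℂ) : wt z (sgnMul f) = sgnMul (wt z f) := by
  ext x; simp only [sgnMul, wt]; ring

lemma l2_sgnMul (f : E d → ℂ) : l2 (sgnMul f) = l2 f :=
  eLpNorm_congr_norm_ae (ae_of_all _ fun x => by simp [sgnMul])

lemma aestronglyMeasurable_sgnMul {f : E d → ℂ} (hf : AEStronglyMeasurable f) :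
    AEStronglyMeasurable (sgnMul f) :=
  (measurable_sgn.comp measurable_tCoord).aestronglyMeasurable.mul hf

lemma memLp_sgnMul {f : E d → ℂ} (hf : MemLp f 2) : MemLp (sgnMul f) 2 :=
  ⟨aestronglyMeasurable_sgnMul hf.1, by rw [← l2, l2_sgnMul]; exact hf.2⟩

lemma exists_isRepresentedBy_of_memLp_wt {s : ℝ} (hs0 : 0 ≤ s) (hs1 : s ≤ 1) {f : E d → ℂ}
    (hf : MemLp (wt (-s) f) 2) : ∃ w : 𝓢'(E d, ℂ), IsRepresentedBy w f := by
  have hint : ∀ φ : 𝓢(E d, ℂ), Integrable fun x => φ x * f x := fun φ =>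
    integrable_mul_of_wt (z := s) (memLp_wt_schwartz (by simpa) (by simpa) φ) hf
  have hfm := aestronglyMeasurable_of_wt hf.1
  obtain ⟨w, hw⟩ := exists_tempered_of_tame_bound (C := (l2 (wt (-s) f)).toNNReal)
    { toFun φ := ∫ x, φ x * f x
      map_add' φ ψ := by
        rw [← integral_add (hint φ) (hint ψ)]
        congr 1; ext x
        rw [add_apply]; ring
      map_smul' c φ := by
        rw [RingHom.id_apply, smul_eq_mul, ← integral_const_mul]
        congr 1; ext x
        rw [smul_apply, smul_eq_mul]; ring } fun φ => by
      change ‖∫ x, φ x * f x‖ₑ ≤ _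
      rw [ENNReal.coe_toNNReal hf.2.ne, mul_comm (l2 _)]
      refine (enorm_integral_mul_le_wt s (aestronglyMeasurable_schwartz φ) hfm).trans ?_
      gcongr
      exact l2_wt_le (by simpa) (by simpa) (aestronglyMeasurable_schwartz φ)
  exact ⟨w, hfm, fun φ => ⟨hint φ, hw φ⟩⟩

lemma normA_zero_eq_of_isRepresentedBy {u : 𝓢'(E d, ℂ)} {f : E d → ℂ}
    (hf : IsRepresentedBy u f) : normA d 0 u = l2 f := by
  rw [normA_zero, normL2]
  refine le_antisymm ?_ (le_iInf₂ fun g hg => le_of_eq ?_)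
  · by_cases h : l2 f = ⊤
    · rw [h]; exact le_top
    have hm : MemLp f 2 := ⟨hf.1, lt_top_iff_ne_top.2 h⟩
    refine (iInf₂_le hm.toLp ?_).trans (by rw [Lp.enorm_toLp])
    ext φ
    rw [lp_apply_eq_integral, (hf.2 φ).2]
    refine integral_congr_ae ?_
    filter_upwards [hm.coeFn_toLp] with x hx
    rw [hx]
  · rw [← l2_lp]
    refine l2_congr (isRepresentedBy_ae_eq hf ?_)
    rw [← hg]; exact isRepresentedBy_lp g

/-- `w` is the product of the function `u` and the sign of `t`. -/
def IsSgnMul (u w : 𝓢'(E d, ℂ)) : Prop :=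
  ∃ f, IsRepresentedBy u f ∧ IsRepresentedBy w (sgnMul f)

lemma isRepresentedBy_unique {u v : 𝓢'(E d, ℂ)} {f g : E d → ℂ} (hf : IsRepresentedBy u f)
    (hg : IsRepresentedBy v g) (h : f =ᵐ[volume] g) : u = v := by
  ext φ
  rw [(hf.2 φ).2, (hg.2 φ).2]
  refine integral_congr_ae ?_
  filter_upwards [h] with x hx
  rw [hx]

lemma IsSgnMul.unique {u w w' : 𝓢'(E d, ℂ)} (h : IsSgnMul u w) (h' : IsSgnMul u w') : w = w' := by
  obtain ⟨f, hf, hw⟩ := h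
  obtain ⟨g, hg, hw'⟩ := h'
  refine isRepresentedBy_unique hw hw' ?_
  filter_upwards [isRepresentedBy_ae_eq hf hg] with x hx
  simp only [sgnMul, hx]

lemma IsRepresentedBy.const_smul {u : 𝓢'(E d, ℂ)} {f : E d → ℂ} (hf : IsRepresentedBy u f)
    (c : ℂ) : IsRepresentedBy (c • u) (fun x => c * f x) := by
  refine ⟨hf.1.const_mul c, fun φ => ?_⟩
  have h : (fun x => φ x * (c * f x)) = fun x => c * (φ x * f x) := by
    ext x; ring
  rw [h, integral_const_mul]
  refine ⟨(hf.2 φ).1.const_mul c, ?_⟩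
  rw [← (hf.2 φ).2]
  rfl

lemma IsSgnMul.add {u w u' w' : 𝓢'(E d, ℂ)} (h : IsSgnMul u w) (h' : IsSgnMul u' w') :
    IsSgnMul (u + u') (w + w') := by
  obtain ⟨f, hf, hw⟩ := h
  obtain ⟨g, hg, hw'⟩ := h'
  refine ⟨_, hf.add hg, ?_⟩
  convert! hw.add hw' using 1
  ext x; simp only [sgnMul]; ring

lemma IsSgnMul.const_smul {u w : 𝓢'(E d, ℂ)} (h : IsSgnMul u w) (c : ℂ) :
    IsSgnMul (c • u) (c • w) := by
  obtain ⟨f, hf, hw⟩ := h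
  refine ⟨_, hf.const_smul c, ?_⟩
  convert! hw.const_smul c using 1
  ext x; simp only [sgnMul]; ring

lemma IsSgnMul.normA_zero_eq {u w : 𝓢'(E d, ℂ)} (h : IsSgnMul u w) :
    normA d 0 w = normA d 0 u := by
  obtain ⟨f, hf, hw⟩ := h
  rw [normA_zero_eq_of_isRepresentedBy hf, normA_zero_eq_of_isRepresentedBy hw, l2_sgnMul]

/-- Multiplication by the sign of `t` is bounded on `A_1`, because the elements of `A_1` vanish
on `t = 0`: a cutoff near `t = 0` at logarithmic scale `n` costs `O(‖u / t‖ / n)`. -/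
lemma IsSgnMul.normA_one_le {u w : 𝓢'(E d, ℂ)} (h : IsSgnMul u w) :
    normA d 1 w ≤ 2 * normA d 1 u := by
  obtain ⟨f, hf, hw⟩ := h
  by_cases hM : normA d 1 u = ⊤
  · rw [hM]; simp
  set M := normA d 1 u with hMdef
  have hws := weightedSq_le_normA_sq one_ne_zero u
  have hww : weightedSq 1 w ≤ M ^ 2 := by
    rwa [weightedSq_eq_of_isRepresentedBy 1 hw, wt_sgnMul, l2_sgnMul,
      ← weightedSq_eq_of_isRepresentedBy 1 hf]
  have hw1 : ∀ φ, ‖w φ‖ₑ ≤ M * l2 (wt 1 φ) := fun φ => by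
    simpa using enorm_apply_le_of_weightedSq zero_le_one le_rfl hM hww φ
  have hfM : l2 (wt (-1) f) ≤ M := by
    rw [weightedSq_eq_of_isRepresentedBy 1 hf] at hws
    simpa using l2_le_of_sq_le hws
  refine normA_one_le_of_bound hM hw1 fun φ => ?_
  obtain ⟨C, hC⟩ := exists_lineDeriv_annMul (d := d) (fun t ht => sgn_eventuallyEq ht)
  have hbound : ∀ n : ℕ, ‖w (∂_{tDir d} φ)‖ₑ ≤ M * l2 φ +
      (M * l2 (wt 1 (∂_{tDir d} φ - annCut n (∂_{tDir d} φ) : 𝓢(E d, ℂ)))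
        + ENNReal.ofReal (C / (n + 1)) * (l2 φ * M)) := by
    intro n
    set η := annMul n sgn φ with hη
    have hηx : ∀ x, η x = theta n (tCoord x) * sgn (tCoord x) * φ x :=
      annMul_apply n contDiffAt_sgn φ
    set e : E d → ℂ := fun x => ∂_{tDir d} η x
      - theta n (tCoord x) * sgn (tCoord x) * ∂_{tDir d} φ x with he
    have hsplit : ∀ x, annCut n (∂_{tDir d} φ) x * sgnMul f x
        = ∂_{tDir d} η x * f x - e x * f x := fun x => by
      simp only [he, sgnMul, annCut_apply]; ring
    have hi1 := (hf.2 (∂_{tDir d} η)).1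
    have hi2 : Integrable fun x => e x * f x := by
      refine (hi1.sub (hw.2 (annCut n (∂_{tDir d} φ))).1).congr (ae_of_all _ fun x => ?_)
      simp only [Pi.sub_apply, hsplit]; ring
    have h1 : w (annCut n (∂_{tDir d} φ)) = u (∂_{tDir d} η) - ∫ x, e x * f x := by
      rw [(hw.2 _).2, (hf.2 _).2, ← integral_sub hi1 hi2]
      exact integral_congr_ae (ae_of_all _ hsplit)
    have h2 : w (∂_{tDir d} φ) = u (∂_{tDir d} η)
        + (w (∂_{tDir d} φ - annCut n (∂_{tDir d} φ)) + -∫ x, e x * f x) := by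
      rw [map_sub, h1]; ring
    have h3 : ‖∫ x, e x * f x‖ₑ ≤ ENNReal.ofReal (C / (n + 1)) * (l2 φ * M) := by
      calc ‖∫ x, e x * f x‖ₑ ≤ ∫⁻ x, ‖e x * f x‖ₑ := enorm_integral_le_lintegral_enorm _
        _ ≤ ∫⁻ x, ENNReal.ofReal (C / (n + 1)) * (‖φ x‖ₑ * ‖wt (-1) f x‖ₑ) := by
            refine lintegral_mono_ae ?_
            filter_upwards [ae_tCoord_ne_zero] with x hx
            obtain ⟨ε, hε, h4⟩ := hC n φ x hx
            have h5 : e x = ε * sgn (tCoord x) * φ x := by rw [he]; dsimp only; rw [h4]; ring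
            rw [h5, ← ofReal_norm, ← ofReal_norm, ← ofReal_norm,
              ← ENNReal.ofReal_mul (norm_nonneg _), ← ENNReal.ofReal_mul (by positivity)]
            refine ENNReal.ofReal_le_ofReal ?_
            simp only [norm_mul, norm_sgn, Complex.norm_real, Real.norm_eq_abs, wt, norm_pw _ hx,
              Complex.neg_re, Complex.one_re, Real.rpow_neg_one, mul_one]
            have h6 : |ε| ≤ C / (n + 1) * |tCoord x|⁻¹ := by
              rw [abs_mul] at hε
              rwa [← div_eq_mul_inv, le_div_iff₀ (abs_pos.2 hx), mul_comm]
            calc |ε| * ‖φ x‖ * ‖f x‖ ≤ C / (n + 1) * |tCoord x|⁻¹ * ‖φ x‖ * ‖f x‖ := by gcongr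
              _ = _ := by ring
        _ = ENNReal.ofReal (C / (n + 1)) * ∫⁻ x, ‖φ x‖ₑ * ‖wt (-1) f x‖ₑ :=
            lintegral_const_mul' _ _ ENNReal.ofReal_ne_top
        _ ≤ _ := by
            gcongr
            refine (lintegral_enorm_mul_le (aestronglyMeasurable_schwartz φ)
              (aestronglyMeasurable_wt _ hf.1)).trans ?_
            gcongr
    rw [h2]
    refine (enorm_add_le _ _).trans (add_le_add ?_ ((enorm_add_le _ _).trans (add_le_add
      (hw1 _) (by rwa [enorm_neg]))))
    refine (enorm_apply_lineDeriv_le_normA_one hM η).trans ?_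
    gcongr
    refine l2_mono (ae_of_all _ fun x => ?_)
    rw [hηx, norm_mul, norm_mul, norm_sgn, mul_one, Complex.norm_real,
      Real.norm_of_nonneg (theta_nonneg _ _)]
    exact mul_le_of_le_one_left (norm_nonneg _) (theta_le_one _ _)
  have hlim := (ENNReal.Tendsto.const_mul (tendsto_l2_wt_sub_annCut (z := 1) (by simp) (by simp)
    (∂_{tDir d} φ)) (a := M) (Or.inr hM)).add (tendsto_const_div_succ C
      (ENNReal.mul_ne_top (l2_schwartz_lt_top φ).ne hM))
  rw [mul_zero, add_zero] at hlim
  have := ge_of_tendsto' (hlim.const_add (M * l2 φ)) hbound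
  rwa [add_zero] at this

open Classical in
/-- The product of a function in `𝓢'` and the sign of `t`, if it is again in `𝓢'`, and `0`
otherwise. -/
noncomputable def sgnDistr (u : 𝓢'(E d, ℂ)) : 𝓢'(E d, ℂ) :=
  if h : ∃ w, IsSgnMul u w then h.choose else 0

lemma IsSgnMul.sgnDistr_eq {u w : 𝓢'(E d, ℂ)} (h : IsSgnMul u w) : sgnDistr u = w := by
  have h' : ∃ w, IsSgnMul u w := ⟨w, h⟩
  rw [sgnDistr, dif_pos h']
  exact h'.choose_spec.unique h

/-- On `A_0 + A_1` multiplication by the sign of `t` is always defined. -/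
lemma isSgnMul_sgnDistr_of_sumNorm {u : 𝓢'(E d, ℂ)}
    (hu : sumNorm (normA d 0) (normA d 1) u < ⊤) : IsSgnMul u (sgnDistr u) := by
  suffices h : ∃ w, IsSgnMul u w by
    obtain ⟨w, hw⟩ := h
    rwa [hw.sgnDistr_eq]
  obtain ⟨v₀, v₁, rfl, h0, h1⟩ := exists_of_sumNorm_lt_top hu
  have hw : weightedSq 1 v₁ ≠ ⊤ := fun h => by
    have := weightedSq_le_normA_sq one_ne_zero v₁
    rw [h, top_le_iff] at this
    exact h1 (by simpa using this)
  obtain ⟨f₁, hf₁, hm₁⟩ := exists_isRepresentedBy_of_weightedSq hw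
  simp only [normA_zero, ← lt_top_iff_ne_top, normL2, iInf_lt_iff] at h0
  obtain ⟨g, rfl, -⟩ := h0
  obtain ⟨w₁, hw₁⟩ := exists_isRepresentedBy_of_memLp_wt zero_le_one le_rfl
    (f := sgnMul f₁) (by rw [wt_sgnMul]; exact memLp_sgnMul hm₁)
  obtain ⟨w₀, hw₀⟩ := exists_isRepresentedBy_of_memLp_wt le_rfl zero_le_one
    (f := sgnMul g) (by
      rw [Complex.ofReal_zero, neg_zero, wt_zero]; exact memLp_sgnMul (Lp.memLp g))
  exact ⟨w₀ + w₁, IsSgnMul.add ⟨g, isRepresentedBy_lp g, hw₀⟩ ⟨f₁, hf₁, hw₁⟩⟩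

/-! ### Operators into `A_0 + A_1` -/

/-- An operator `T`, linear on the functions `b` with `min(1, |t|) b ∈ L²`, which maps `L²` to `A_0`
and `L²(t² dz dt)` to `A_1`. -/
structure IsSynthesis (T : (E d → ℂ) → 𝓢'(E d, ℂ)) (C : ℝ≥0) : Prop where
  map_add : ∀ {b c : E d → ℂ}, MemLp (lowMul b) 2 → MemLp (lowMul c) 2 → T (b + c) = T b + T c
  map_smul : ∀ (r : ℂ) {b : E d → ℂ}, MemLp (lowMul b) 2 → T (r • b) = r • T b
  normA_zero_le : ∀ {b : E d → ℂ}, MemLp (lowMul b) 2 → normA d 0 (T b) ≤ C * l2 b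
  normA_one_le : ∀ {b : E d → ℂ}, MemLp (lowMul b) 2 → normA d 1 (T b) ≤ C * l2 (wt 1 b)

lemma IsSynthesis.map_sub {T : (E d → ℂ) → 𝓢'(E d, ℂ)} {C : ℝ≥0} (hT : IsSynthesis T C)
    {b c : E d → ℂ} (hb : MemLp (lowMul b) 2) (hc : MemLp (lowMul c) 2) :
    T (b - c) = T b - T c := by
  have hc' : MemLp (lowMul ((-1 : ℂ) • c)) 2 := by rw [lowMul_smul]; exact hc.const_smul _
  rw [sub_eq_add_neg, ← neg_one_smul ℂ c, hT.map_add hb hc', hT.map_smul _ hc]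
  module

/-- The part of `b` with `|t| > 1` is in `L²`, and the part with `|t| ≤ 1` is in `L²(t² dz dt)`.
-/
lemma IsSynthesis.sumNorm_le {T : (E d → ℂ) → 𝓢'(E d, ℂ)} {C : ℝ≥0} (hT : IsSynthesis T C)
    {b : E d → ℂ} (hb : MemLp (lowMul b) 2) :
    sumNorm (normA d 0) (normA d 1) (T b) ≤ 2 * C * l2 (lowMul b) := by
  set S : Set (E d) := {x | 1 < |tCoord x|} with hS
  have hSm : MeasurableSet S := measurableSet_lt measurable_const measurable_tCoord.norm
  have hlow : ∀ R : Set (E d), lowMul (R.indicator b) = R.indicator (lowMul b) := fun R => by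
    ext x
    by_cases hx : x ∈ R <;> simp [lowMul, hx]
  have h1 : MemLp (lowMul (S.indicator b)) 2 := by rw [hlow]; exact hb.indicator hSm
  have h2 : MemLp (lowMul (Sᶜ.indicator b)) 2 := by rw [hlow]; exact hb.indicator hSm.compl
  have hle1 : l2 (S.indicator b) ≤ l2 (lowMul b) := by
    refine l2_mono (ae_of_all _ fun x => ?_)
    by_cases hx : x ∈ S
    · have : min 1 |tCoord x| = 1 := min_eq_left (le_of_lt hx)
      simp [hx, lowMul, this]
    · simp [hx]
  have hle2 : l2 (wt 1 (Sᶜ.indicator b)) ≤ l2 (lowMul b) := by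
    refine l2_mono ?_
    filter_upwards [ae_tCoord_ne_zero] with x hx'
    by_cases hx : x ∈ S
    · simp [hx, wt]
    · have : min 1 |tCoord x| = |tCoord x| := min_eq_right (not_lt.1 hx)
      simp [hx, lowMul, this, wt, pw_one]
  refine (iInf₂_le (T (S.indicator b), T (Sᶜ.indicator b)) ?_).trans ?_
  · change T _ + T _ = _
    rw [← hT.map_add h1 h2, Set.indicator_self_add_compl]
  · calc normA d 0 (T (S.indicator b)) + normA d 1 (T (Sᶜ.indicator b))
        ≤ C * l2 (lowMul b) + C * l2 (lowMul b) := by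
          gcongr
          · exact (hT.normA_zero_le h1).trans (by gcongr)
          · exact (hT.normA_one_le h2).trans (by gcongr)
      _ = _ := by ring

/-- Odd synthesis yields functions odd in `t`. -/
lemma isSynthesis_oddDistr : IsSynthesis (oddDistr (d := d)) 28 where
  map_add := oddDistr_add
  map_smul r _ hb := oddDistr_smul r hb
  normA_zero_le hb := (normA_zero_oddDistr_le hb).trans
    (le_mul_of_one_le_left zero_le (by norm_num))
  normA_one_le hb := normA_one_oddDistr_le hb

lemma isSgnMul_oddDistr {b : E d → ℂ} (hb : MemLp (lowMul b) 2) :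
    IsSgnMul (oddDistr b) (sgnDistr (oddDistr b)) :=
  isSgnMul_sgnDistr_of_sumNorm ((isSynthesis_oddDistr.sumNorm_le hb).trans_lt
    (ENNReal.mul_lt_top (by finiteness) hb.2))

/-- Odd synthesis followed by multiplication by the sign yields functions even in `t`. -/
lemma isSynthesis_sgnDistr_oddDistr :
    IsSynthesis (fun b : E d → ℂ => sgnDistr (oddDistr b)) 56 where
  map_add hb hc := by
    rw [oddDistr_add hb hc]
    exact ((isSgnMul_oddDistr hb).add (isSgnMul_oddDistr hc)).sgnDistr_eq
  map_smul r _ hb := by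
    rw [oddDistr_smul r hb]
    exact ((isSgnMul_oddDistr hb).const_smul r).sgnDistr_eq
  normA_zero_le hb := by
    rw [(isSgnMul_oddDistr hb).normA_zero_eq]
    exact (normA_zero_oddDistr_le hb).trans (le_mul_of_one_le_left zero_le (by norm_num))
  normA_one_le {b} hb := by
    refine (isSgnMul_oddDistr hb).normA_one_le.trans ?_
    calc 2 * normA d 1 (oddDistr b) ≤ 2 * (28 * l2 (wt 1 b)) := by
          gcongr; exact normA_one_oddDistr_le hb
      _ = _ := by rw [← mul_assoc]; norm_num

/-! ### Admissible families -/

lemma tendsto_l2_of_dominated {ι : Type*} {l : Filter ι} [l.IsCountablyGenerated]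
    {q : ι → E d → ℂ} {k : E d → ℂ} (hk : MemLp k 2) {B : ℝ}
    (hm : ∀ᶠ w in l, AEStronglyMeasurable (q w)) (hb : ∀ᶠ w in l, ∀ᵐ x, ‖q w x‖ ≤ B * ‖k x‖)
    (hlim : ∀ᵐ x, Tendsto (fun w => q w x) l (𝓝 0)) :
    Tendsto (fun w => l2 (q w)) l (𝓝 0) := by
  have h : Tendsto (fun w => ∫⁻ x : E d, ‖q w x‖ₑ ^ 2) l (𝓝 (∫⁻ _ : E d, 0)) := by
    refine tendsto_lintegral_filter_of_dominated_convergence'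
      (fun x => (ENNReal.ofReal B * ‖k x‖ₑ) ^ 2) ?_ ?_ ?_ ?_
    · filter_upwards [hm] with w hw using hw.aemeasurable.enorm.pow_const 2
    · filter_upwards [hb] with w hw
      filter_upwards [hw] with x hx
      refine pow_le_pow_left' ?_ 2
      rw [← ofReal_norm, ← ofReal_norm, ← ENNReal.ofReal_mul' (norm_nonneg _)]
      exact ENNReal.ofReal_le_ofReal hx
    · simp_rw [mul_pow]
      rw [lintegral_const_mul' _ _ (by finiteness), ← eLpNorm_two_sq]
      exact ENNReal.mul_ne_top (by finiteness) (ENNReal.pow_ne_top hk.2.ne)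
    · filter_upwards [hlim] with x hx
      have := (ENNReal.continuous_pow 2).tendsto 0 |>.comp
        (continuous_enorm.tendsto (0 : ℂ) |>.comp hx |>.trans (by rw [enorm_zero]))
      simpa [Function.comp_def] using this
  have h2 : Tendsto (fun w => l2 (q w) ^ 2) l (𝓝 0) := by
    simp_rw [eLpNorm_two_sq]; simpa using h
  have h3 := (ENNReal.continuous_rpow_const (y := (1 / 2 : ℝ))).tendsto 0 |>.comp h2
  simp only [ENNReal.zero_rpow_of_pos (show (0 : ℝ) < 1 / 2 by norm_num)] at h3
  refine h3.congr fun n => ?_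
  simp only [Function.comp, ← ENNReal.rpow_natCast, ← ENNReal.rpow_mul]
  norm_num

/-- The analytic family of multipliers `e^{(z-s)²} |t|^{-z}`. The first factor, equal to `1` at
`z = s`, gives the decay on vertical lines. -/
noncomputable def multiplier (s : ℝ) (z : ℂ) (t : ℝ) : ℂ := Complex.exp ((z - s) ^ 2) * pw (-z) t

lemma multiplier_self (s t : ℝ) : multiplier s s t = pw (-s) t := by simp [multiplier]

lemma hasDerivAt_multiplier (s : ℝ) (z : ℂ) {t : ℝ} (ht : t ≠ 0) :
    HasDerivAt (fun w => multiplier s w t)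
      ((2 * (z - s) - Real.log t) * multiplier s z t) z := by
  have h : (fun w => multiplier s w t)
      = fun w : ℂ => Complex.exp ((w - s) ^ 2) * Complex.exp (Real.log t * (-w)) := by
    ext w; rw [multiplier, pw_eq_exp _ ht]
  have h1 : HasDerivAt (fun w : ℂ => (w - s) ^ 2) (2 * (z - s)) z := by
    simpa using! ((hasDerivAt_id z).sub_const (s : ℂ)).pow 2
  have h2 : HasDerivAt (fun w : ℂ => (Real.log t : ℂ) * (-w)) (-Real.log t) z := by
    simpa using (hasDerivAt_id z).neg.const_mul (Real.log t : ℂ)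
  rw [h]
  refine (h1.cexp.mul h2.cexp).congr_deriv ?_
  rw [multiplier, pw_eq_exp _ ht]; ring

lemma norm_multiplier (s : ℝ) (z : ℂ) {t : ℝ} (ht : t ≠ 0) :
    ‖multiplier s z t‖ = Real.exp ((z.re - s) ^ 2 - z.im ^ 2) * |t| ^ (-z.re) := by
  rw [multiplier, norm_mul, norm_pw _ ht, Complex.norm_exp, Complex.neg_re]
  congr 2
  simp [sq]

lemma exp_strip_le {s : ℝ} (hs0 : 0 ≤ s) (hs1 : s ≤ 1) {a y : ℝ} (ha0 : 0 ≤ a) (ha1 : a ≤ 1) :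
    Real.exp ((a - s) ^ 2 - y ^ 2) ≤ 3 := by
  calc Real.exp ((a - s) ^ 2 - y ^ 2) ≤ Real.exp 1 := by
        refine Real.exp_le_exp.2 ?_
        have : (a - s) ^ 2 ≤ 1 := by
          rw [sq_le_one_iff_abs_le_one, abs_le]; constructor <;> linarith
        linarith [sq_nonneg y]
    _ ≤ 3 := by linarith [Real.exp_one_lt_d9]

lemma norm_min_mul_multiplier_le {s : ℝ} (hs0 : 0 ≤ s) (hs1 : s ≤ 1) {z : ℂ} (hz : z ∈ strip)
    {t : ℝ} (ht : t ≠ 0) : ‖((min 1 |t| : ℝ) : ℂ) * multiplier s z t‖ ≤ 3 := by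
  have hp := abs_pos.2 ht
  rw [norm_mul, norm_multiplier s z ht, Complex.norm_real,
    Real.norm_of_nonneg (le_min zero_le_one hp.le)]
  have h1 : min 1 |t| * |t| ^ (-z.re) ≤ 1 := by
    rcases le_total 1 |t| with h | h
    · rw [min_eq_left h, one_mul]
      exact Real.rpow_le_one_of_one_le_of_nonpos h (by linarith [hz.1])
    · rw [min_eq_right h]
      calc |t| * |t| ^ (-z.re) = |t| ^ (1 - z.re) := by
            rw [sub_eq_add_neg, Real.rpow_add hp, Real.rpow_one]
        _ ≤ 1 := Real.rpow_le_one hp.le h (by linarith [hz.2])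
  calc min 1 |t| * (Real.exp ((z.re - s) ^ 2 - z.im ^ 2) * |t| ^ (-z.re))
      = Real.exp ((z.re - s) ^ 2 - z.im ^ 2) * (min 1 |t| * |t| ^ (-z.re)) := by ring
    _ ≤ 3 * 1 := by
        gcongr
        exact exp_strip_le hs0 hs1 hz.1 hz.2
    _ = 3 := mul_one _

/-- `e^{(z-s)²} |t|^{-z} k`. -/
noncomputable def synthFamily (s : ℝ) (k : E d → ℂ) (z : ℂ) : E d → ℂ :=
  fun x => multiplier s z (tCoord x) * k x

lemma measurable_multiplier (s : ℝ) (z : ℂ) : Measurable (multiplier s z) :=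
  (measurable_pw (-z)).const_mul _

lemma aestronglyMeasurable_synthFamily (s : ℝ) {k : E d → ℂ} (hk : AEStronglyMeasurable k)
    (z : ℂ) : AEStronglyMeasurable (synthFamily s k z) :=
  ((measurable_multiplier s z).comp measurable_tCoord).aestronglyMeasurable.mul hk

lemma aestronglyMeasurable_lowMul {b : E d → ℂ} (hb : AEStronglyMeasurable b) :
    AEStronglyMeasurable (lowMul b) :=
  (Complex.measurable_ofReal.comp (measurable_const.min
      (measurable_tCoord.norm))).aestronglyMeasurable.mul hb

lemma memLp_lowMul_synthFamily {s : ℝ} (hs0 : 0 ≤ s) (hs1 : s ≤ 1) {k : E d → ℂ} (hk : MemLp k 2)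
    {z : ℂ} (hz : z ∈ strip) : MemLp (lowMul (synthFamily s k z)) 2 := by
  refine hk.of_le_mul (c := 3)
    (aestronglyMeasurable_lowMul (aestronglyMeasurable_synthFamily s hk.1 z)) ?_
  filter_upwards [ae_tCoord_ne_zero] with x hx
  rw [lowMul, synthFamily, ← mul_assoc, norm_mul]
  gcongr
  exact norm_min_mul_multiplier_le hs0 hs1 hz hx

lemma lowMul_sub (b c : E d → ℂ) : lowMul (b - c) = lowMul b - lowMul c := by
  ext x; simp [lowMul, mul_sub]

/-- Boundary values on `Re z = a` are measured with the weight `|t|^a`. -/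
lemma l2_wt_synthFamily_le (s a y : ℝ) (k : E d → ℂ) :
    l2 (wt a (synthFamily s k (a + y * Complex.I)))
      ≤ ENNReal.ofReal (Real.exp ((a - s) ^ 2 - y ^ 2)) * l2 k := by
  refine eLpNorm_le_mul_eLpNorm_of_ae_le_mul ?_ 2
  filter_upwards [ae_tCoord_ne_zero] with x hx
  have hp := abs_pos.2 hx
  rw [wt, synthFamily, norm_mul, norm_mul, norm_pw _ hx, norm_multiplier _ _ hx]
  have h1 : (a + y * Complex.I : ℂ).re = a := by simp
  have h2 : (a + y * Complex.I : ℂ).im = y := by simp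
  rw [h1, h2, Complex.ofReal_re]
  refine le_of_eq ?_
  have : |tCoord x| ^ a * |tCoord x| ^ (-a) = 1 := by
    rw [← Real.rpow_add hp, add_neg_cancel, Real.rpow_zero]
  linear_combination (Real.exp ((a - s) ^ 2 - y ^ 2) * ‖k x‖) * this

lemma tendsto_exp_cocompact (c : ℝ) :
    Tendsto (fun y : ℝ => Real.exp (c - y ^ 2)) (cocompact ℝ) (𝓝 0) := by
  refine Real.tendsto_exp_atBot.comp ?_
  have h1 : Tendsto (fun y : ℝ => ‖y‖ ^ 2) (cocompact ℝ) atTop :=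
    (tendsto_pow_atTop two_ne_zero).comp tendsto_norm_cocompact_atTop
  have h2 := tendsto_const_nhds (x := c) |>.add_atBot (tendsto_neg_atTop_atBot.comp h1)
  refine h2.congr fun y => ?_
  simp [sub_eq_add_neg]

/-- A boundary line `Re z = a` of the family, with a norm `N` controlled by the weight `|t|^a`. -/
lemma isBoundaryCurve_synthFamily {T : (E d → ℂ) → 𝓢'(E d, ℂ)} {C : ℝ≥0} (hT : IsSynthesis T C)
    {N : 𝓢'(E d, ℂ) → ℝ≥0∞} {a : ℝ} (ha0 : 0 ≤ a) (ha1 : a ≤ 1)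
    (hN : ∀ {b : E d → ℂ}, MemLp (lowMul b) 2 → N (T b) ≤ C * l2 (wt a b))
    {s : ℝ} (hs0 : 0 ≤ s) (hs1 : s ≤ 1) {k : E d → ℂ} (hk : MemLp k 2) :
    IsBoundaryCurve N (fun y : ℝ => T (synthFamily s k (a + y * Complex.I))) := by
  have hmem : ∀ y : ℝ, (a + y * Complex.I : ℂ) ∈ strip := fun y => by
    simp [strip, ha0, ha1]
  have hlow : ∀ y : ℝ, MemLp (lowMul (synthFamily s k (a + y * Complex.I))) 2 := fun y =>
    memLp_lowMul_synthFamily hs0 hs1 hk (hmem y)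
  have hbd : ∀ y : ℝ, N (T (synthFamily s k (a + y * Complex.I)))
      ≤ ENNReal.ofReal (Real.exp ((a - s) ^ 2 - y ^ 2)) * (C * l2 k) := fun y => by
    refine (hN (hlow y)).trans ?_
    rw [mul_left_comm]
    gcongr
    exact l2_wt_synthFamily_le s a y k
  have hfin : (C : ℝ≥0∞) * l2 k ≠ ⊤ := ENNReal.mul_ne_top ENNReal.coe_ne_top hk.2.ne
  refine ⟨fun y => (hbd y).trans_lt (ENNReal.mul_lt_top ENNReal.ofReal_lt_top
    (lt_top_iff_ne_top.2 hfin)), fun y => ?_, ?_⟩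
  · have h1 : Tendsto (fun y' : ℝ => l2 (wt a (synthFamily s k (a + y' * Complex.I)
        - synthFamily s k (a + y * Complex.I)))) (𝓝 y) (𝓝 0) := by
      refine tendsto_l2_of_dominated hk (B := 6) (Eventually.of_forall fun y' =>
        aestronglyMeasurable_wt _ ((aestronglyMeasurable_synthFamily s hk.1 _).sub
          (aestronglyMeasurable_synthFamily s hk.1 _))) (Eventually.of_forall fun y' => ?_) ?_
      · filter_upwards [ae_tCoord_ne_zero] with x hx
        have hp := abs_pos.2 hx
        have h2 : ∀ y : ℝ, ‖pw a (tCoord x) * multiplier s (a + y * Complex.I) (tCoord x)‖ ≤ 3 := by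
          intro y
          rw [norm_mul, norm_pw _ hx, norm_multiplier _ _ hx]
          have h1 : (a + y * Complex.I : ℂ).re = a := by simp
          have h2 : (a + y * Complex.I : ℂ).im = y := by simp
          rw [h1, h2, Complex.ofReal_re, mul_left_comm, ← Real.rpow_add hp, add_neg_cancel,
            Real.rpow_zero, mul_one]
          exact exp_strip_le hs0 hs1 ha0 ha1
        rw [wt, Pi.sub_apply, synthFamily, synthFamily, ← sub_mul, ← mul_assoc, mul_sub, norm_mul]
        gcongr
        exact (norm_sub_le _ _).trans (by linarith [h2 y, h2 y'])
      · filter_upwards [ae_tCoord_ne_zero] with x hx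
        have h2 : Continuous fun y' : ℝ => multiplier s (a + y' * Complex.I) (tCoord x) :=
          (continuous_iff_continuousAt.2 fun z =>
            (hasDerivAt_multiplier s z hx).continuousAt).comp (by fun_prop)
        have h3 : Continuous fun y' : ℝ => wt a (synthFamily s k (a + y' * Complex.I)
            - synthFamily s k (a + y * Complex.I)) x := by
          simp only [wt, Pi.sub_apply, synthFamily]
          fun_prop
        have := h3.tendsto y
        simpa [wt] using this
    have h2 := ENNReal.Tendsto.const_mul h1 (a := C) (Or.inr ENNReal.coe_ne_top)
    rw [mul_zero] at h2
    refine tendsto_of_tendsto_of_tendsto_of_le_of_le tendsto_const_nhds h2 (fun _ => zero_le)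
      fun y' => ?_
    dsimp only
    rw [← hT.map_sub (hlow y') (hlow y)]
    exact hN (by rw [lowMul_sub]; exact (hlow y').sub (hlow y))
  · have h1 := ENNReal.Tendsto.mul_const (ENNReal.tendsto_ofReal
      (tendsto_exp_cocompact ((a - s) ^ 2))) (b := C * l2 k) (Or.inr hfin)
    rw [ENNReal.ofReal_zero, zero_mul] at h1
    exact tendsto_of_tendsto_of_tendsto_of_le_of_le tendsto_const_nhds h1 (fun _ => zero_le) hbd

lemma ball_subset_strip {z : ℂ} (hz : z ∈ openStrip) :
    ∃ R > 0, Metric.ball z R ⊆ strip := by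
  obtain ⟨R, hR, h⟩ := Metric.isOpen_iff.1 isOpen_openStrip z hz
  exact ⟨R, hR, h.trans fun w hw => mem_strip_of_mem_openStrip hw⟩

/-- The derivative in `z` of `e^{(z-s)²} |t|^{-z} k`. -/
noncomputable def synthDeriv (s : ℝ) (k : E d → ℂ) (z : ℂ) : E d → ℂ :=
  fun x => (2 * (z - s) - Real.log (tCoord x)) * multiplier s z (tCoord x) * k x

lemma aestronglyMeasurable_synthDeriv (s : ℝ) {k : E d → ℂ} (hk : AEStronglyMeasurable k)
    (z : ℂ) : AEStronglyMeasurable (synthDeriv s k z) := by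
  refine AEStronglyMeasurable.mul (Measurable.aestronglyMeasurable ?_) hk
  exact (measurable_const.sub (Complex.measurable_ofReal.comp
    (Real.measurable_log.comp measurable_tCoord))).mul
    ((measurable_multiplier s z).comp measurable_tCoord)

/-- Difference quotients and derivatives of the family are bounded by the Schwarz lemma. -/
lemma norm_slope_multiplier_le {s : ℝ} (hs0 : 0 ≤ s) (hs1 : s ≤ 1) {z : ℂ} {R : ℝ} (hR : 0 < R)
    (hball : Metric.ball z R ⊆ strip) {t : ℝ} (ht : t ≠ 0) {w : ℂ} (hw : w ∈ Metric.ball z R)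
    (hwz : w ≠ z) :
    ‖((min 1 |t| : ℝ) : ℂ) * ((w - z)⁻¹ * (multiplier s w t - multiplier s z t))‖ ≤ 7 / R := by
  set f : ℂ → ℂ := fun w => ((min 1 |t| : ℝ) : ℂ) * multiplier s w t with hf
  have hz3 := norm_min_mul_multiplier_le hs0 hs1 (hball (Metric.mem_ball_self hR)) ht
  have hd : DifferentiableOn ℂ f (Metric.ball z R) := fun v _ =>
    ((hasDerivAt_multiplier s v ht).const_mul _).differentiableAt.differentiableWithinAt
  have hmaps : Set.MapsTo f (Metric.ball z R) (Metric.ball (f z) 7) := fun v hv => by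
    rw [Metric.mem_ball, dist_eq_norm]
    have := norm_min_mul_multiplier_le hs0 hs1 (hball hv) ht
    exact (norm_sub_le _ _).trans_lt (by simp only [hf]; linarith)
  have h := Complex.dist_le_div_mul_dist_of_mapsTo_ball hd
    (hmaps.mono_right Metric.ball_subset_closedBall) hw
  rw [dist_eq_norm, dist_eq_norm] at h
  have h0 : 0 < ‖w - z‖ := norm_pos_iff.2 (sub_ne_zero.2 hwz)
  have h1 : ((min 1 |t| : ℝ) : ℂ) * ((w - z)⁻¹ * (multiplier s w t - multiplier s z t))
      = (w - z)⁻¹ * (f w - f z) := by simp only [hf]; ring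
  rw [h1, norm_mul, norm_inv, inv_mul_le_iff₀ h0, mul_comm]
  exact h

lemma tendsto_slope_multiplier (s : ℝ) (z : ℂ) {t : ℝ} (ht : t ≠ 0) :
    Tendsto (fun w => (w - z)⁻¹ * (multiplier s w t - multiplier s z t)) (𝓝[≠] z)
      (𝓝 ((2 * (z - s) - Real.log t) * multiplier s z t)) := by
  have := hasDerivAt_iff_tendsto_slope.1 (hasDerivAt_multiplier s z ht)
  simpa [slope_fun_def, slope_def_field, div_eq_inv_mul] using this

lemma norm_deriv_multiplier_le {s : ℝ} (hs0 : 0 ≤ s) (hs1 : s ≤ 1) {z : ℂ} {R : ℝ} (hR : 0 < R)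
    (hball : Metric.ball z R ⊆ strip) {t : ℝ} (ht : t ≠ 0) :
    ‖((min 1 |t| : ℝ) : ℂ) * ((2 * (z - s) - Real.log t) * multiplier s z t)‖ ≤ 7 / R := by
  refine le_of_tendsto ((tendsto_slope_multiplier s z ht).const_mul _).norm ?_
  filter_upwards [self_mem_nhdsWithin, mem_nhdsWithin_of_mem_nhds (Metric.ball_mem_nhds z hR)]
    with w hw1 hw2
  exact norm_slope_multiplier_le hs0 hs1 hR hball ht hw2 hw1

/-- An operator into `A_0 + A_1` turns the analytic family `e^{(z-s)²} |t|^{-z} k` into an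
admissible function: all limits are taken under the norm of `min(1, |t|) b`, by dominated
convergence. -/
theorem isAdmissible_synthFamily {T : (E d → ℂ) → 𝓢'(E d, ℂ)} {C : ℝ≥0} (hT : IsSynthesis T C)
    {s : ℝ} (hs0 : 0 ≤ s) (hs1 : s ≤ 1) {k : E d → ℂ} (hk : MemLp k 2) :
    IsAdmissible (normA d 0) (normA d 1) (fun z => T (synthFamily s k z)) := by
  have hlow : ∀ z ∈ strip, MemLp (lowMul (synthFamily s k z)) 2 := fun z hz =>
    memLp_lowMul_synthFamily hs0 hs1 hk hz
  have hfin : 2 * (C : ℝ≥0∞) ≠ ⊤ := by finiteness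
  refine ⟨⟨(2 * C * (3 * l2 k)).toNNReal, fun z hz => ?_⟩, fun z hz => ?_, fun z hz => ?_, ?_, ?_⟩
  · rw [ENNReal.coe_toNNReal (ENNReal.mul_ne_top hfin (ENNReal.mul_ne_top (by norm_num) hk.2.ne))]
    refine (hT.sumNorm_le (hlow z hz)).trans ?_
    gcongr
    have h := eLpNorm_le_mul_eLpNorm_of_ae_le_mul (f := lowMul (synthFamily s k z)) (g := k)
      (c := 3) (μ := volume) ?_ 2
    · simpa using h
    · filter_upwards [ae_tCoord_ne_zero] with x hx
      rw [lowMul, synthFamily, ← mul_assoc, norm_mul]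
      gcongr
      exact norm_min_mul_multiplier_le hs0 hs1 hz hx
  · have h1 : Tendsto (fun w => l2 (lowMul (synthFamily s k w - synthFamily s k z)))
        (𝓝[strip] z) (𝓝 0) := by
      refine tendsto_l2_of_dominated hk (B := 6) (Eventually.of_forall fun w =>
        aestronglyMeasurable_lowMul ((aestronglyMeasurable_synthFamily s hk.1 _).sub
          (aestronglyMeasurable_synthFamily s hk.1 _))) ?_ ?_
      · filter_upwards [self_mem_nhdsWithin] with w hw
        filter_upwards [ae_tCoord_ne_zero] with x hx
        rw [lowMul, Pi.sub_apply, synthFamily, synthFamily, ← sub_mul, ← mul_assoc, mul_sub,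
          norm_mul]
        gcongr
        exact (norm_sub_le _ _).trans (by
          linarith [norm_min_mul_multiplier_le hs0 hs1 hw hx,
            norm_min_mul_multiplier_le hs0 hs1 hz hx])
      · filter_upwards [ae_tCoord_ne_zero] with x hx
        have h2 : Continuous fun w : ℂ => multiplier s w (tCoord x) :=
          continuous_iff_continuousAt.2 fun z => (hasDerivAt_multiplier s z hx).continuousAt
        have h3 : Continuous fun w : ℂ => lowMul (synthFamily s k w - synthFamily s k z) x := by
          simp only [lowMul, Pi.sub_apply, synthFamily]
          fun_prop
        have := (h3.tendsto z).mono_left (nhdsWithin_le_nhds (s := strip))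
        simpa [lowMul] using this
    have h2 := ENNReal.Tendsto.const_mul h1 (a := 2 * C) (Or.inr hfin)
    rw [mul_zero] at h2
    refine tendsto_of_tendsto_of_tendsto_of_le_of_le' tendsto_const_nhds h2
      (Eventually.of_forall fun _ => zero_le) ?_
    filter_upwards [self_mem_nhdsWithin] with w hw
    rw [← hT.map_sub (hlow w hw) (hlow z hz)]
    exact hT.sumNorm_le (by rw [lowMul_sub]; exact (hlow w hw).sub (hlow z hz))
  · obtain ⟨R, hR, hball⟩ := ball_subset_strip hz
    have hzs := mem_strip_of_mem_openStrip hz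
    have hD : MemLp (lowMul (synthDeriv s k z)) 2 := by
      refine hk.of_le_mul (c := 7 / R)
        (aestronglyMeasurable_lowMul (aestronglyMeasurable_synthDeriv s hk.1 z)) ?_
      filter_upwards [ae_tCoord_ne_zero] with x hx
      rw [lowMul, synthDeriv, ← mul_assoc, norm_mul]
      gcongr
      exact norm_deriv_multiplier_le hs0 hs1 hR hball hx
    refine ⟨T (synthDeriv s k z), (hT.sumNorm_le hD).trans_lt
      (ENNReal.mul_lt_top (lt_top_iff_ne_top.2 hfin) hD.2), ?_⟩
    set q : ℂ → E d → ℂ := fun w =>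
      (w - z)⁻¹ • (synthFamily s k w - synthFamily s k z) - synthDeriv s k z with hq
    have hnear : ∀ᶠ w in 𝓝[≠] z, w ∈ Metric.ball z R ∧ w ≠ z := by
      filter_upwards [self_mem_nhdsWithin, mem_nhdsWithin_of_mem_nhds (Metric.ball_mem_nhds z hR)]
        with w hw1 hw2 using ⟨hw2, hw1⟩
    have hqx : ∀ w x, q w x = ((w - z)⁻¹ * (multiplier s w (tCoord x) - multiplier s z (tCoord x))
        - (2 * (z - s) - Real.log (tCoord x)) * multiplier s z (tCoord x)) * k x := fun w x => by
      simp only [hq, Pi.sub_apply, Pi.smul_apply, smul_eq_mul, synthFamily, synthDeriv]; ring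
    have h1 : Tendsto (fun w => l2 (lowMul (q w))) (𝓝[≠] z) (𝓝 0) := by
      refine tendsto_l2_of_dominated hk (B := 7 / R + 7 / R) (Eventually.of_forall fun w =>
        aestronglyMeasurable_lowMul ((((aestronglyMeasurable_synthFamily s hk.1 _).sub
          (aestronglyMeasurable_synthFamily s hk.1 _)).const_smul _).sub
          (aestronglyMeasurable_synthDeriv s hk.1 z))) ?_ ?_
      · filter_upwards [hnear] with w hw
        filter_upwards [ae_tCoord_ne_zero] with x hx
        rw [lowMul, hqx, ← mul_assoc, mul_sub, norm_mul]
        gcongr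
        exact (norm_sub_le _ _).trans (add_le_add
          (norm_slope_multiplier_le hs0 hs1 hR hball hx hw.1 hw.2)
          (norm_deriv_multiplier_le hs0 hs1 hR hball hx))
      · filter_upwards [ae_tCoord_ne_zero] with x hx
        have h2 := (((tendsto_slope_multiplier s z hx).sub_const
          ((2 * (z - s) - Real.log (tCoord x)) * multiplier s z (tCoord x))).mul_const
            (k x)).const_mul ((min 1 |tCoord x| : ℝ) : ℂ)
        rw [sub_self, zero_mul, mul_zero] at h2
        refine h2.congr fun w => ?_
        rw [lowMul, hqx]
    have h2 := ENNReal.Tendsto.const_mul h1 (a := 2 * C) (Or.inr hfin)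
    rw [mul_zero] at h2
    refine tendsto_of_tendsto_of_tendsto_of_le_of_le' tendsto_const_nhds h2
      (Eventually.of_forall fun _ => zero_le) ?_
    filter_upwards [hnear] with w hw
    have hw' := hlow w (hball hw.1)
    have hd : MemLp (lowMul (synthFamily s k w - synthFamily s k z)) 2 := by
      rw [lowMul_sub]; exact hw'.sub (hlow z hzs)
    have hd' : MemLp (lowMul ((w - z)⁻¹ • (synthFamily s k w - synthFamily s k z))) 2 := by
      rw [lowMul_smul]; exact hd.const_smul _
    rw [← hT.map_sub hw' (hlow z hzs), ← hT.map_smul _ hd, ← hT.map_sub hd' hD]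
    exact hT.sumNorm_le (by rw [lowMul_sub]; exact hd'.sub hD)
  · have h := isBoundaryCurve_synthFamily hT (N := normA d 0) (a := 0) le_rfl zero_le_one
      (fun hb => by rw [Complex.ofReal_zero, wt_zero]; exact hT.normA_zero_le hb) hs0 hs1 hk
    simpa using h
  · have h := isBoundaryCurve_synthFamily hT (N := normA d 1) (a := 1) zero_le_one le_rfl
      (fun hb => by rw [Complex.ofReal_one]; exact hT.normA_one_le hb) hs0 hs1 hk
    simpa using h

lemma stripNorm_synthFamily_le {T : (E d → ℂ) → 𝓢'(E d, ℂ)} {C : ℝ≥0} (hT : IsSynthesis T C)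
    {s : ℝ} (hs0 : 0 ≤ s) (hs1 : s ≤ 1) {k : E d → ℂ} (hk : MemLp k 2) :
    stripNorm (normA d 0) (normA d 1) (fun z => T (synthFamily s k z)) ≤ 3 * C * l2 k := by
  have key : ∀ a : ℝ, 0 ≤ a → a ≤ 1 → ∀ y : ℝ,
      C * l2 (wt a (synthFamily s k (a + y * Complex.I))) ≤ 3 * C * l2 k := by
    intro a ha0 ha1 y
    rw [mul_comm (3 : ℝ≥0∞), mul_assoc]
    gcongr
    refine (l2_wt_synthFamily_le s a y k).trans ?_
    gcongr
    refine (ENNReal.ofReal_le_ofReal (exp_strip_le hs0 hs1 ha0 ha1)).trans ?_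
    simp
  refine max_le (iSup_le fun y => ?_) (iSup_le fun y => ?_)
  · have h := key 0 le_rfl zero_le_one y
    rw [Complex.ofReal_zero, zero_add, wt_zero] at h
    exact (hT.normA_zero_le (memLp_lowMul_synthFamily hs0 hs1 hk (by simp [strip]))).trans h
  · have h := key 1 zero_le_one le_rfl y
    rw [Complex.ofReal_one] at h
    exact (hT.normA_one_le (memLp_lowMul_synthFamily hs0 hs1 hk (by simp [strip]))).trans h

/-! ### Splitting `sgn(t) f` at a given scale -/

/-- The smooth approximation `t / √(1 + t²)` of the sign function, written as a product of functions
of temperate growth. -/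
noncomputable def smoothSgn (t : ℝ) : ℝ := t * (1 + ‖t‖ ^ 2) ^ (-(1 / 2) : ℝ)

lemma one_add_norm_sq_rpow (t : ℝ) :
    (1 + ‖t‖ ^ 2) ^ (-(1 / 2) : ℝ) = (√(1 + t ^ 2))⁻¹ := by
  rw [Real.rpow_neg (by positivity), ← Real.sqrt_eq_rpow, Real.norm_eq_abs, sq_abs]

lemma smoothSgn_eq (t : ℝ) : smoothSgn t = t / √(1 + t ^ 2) := by
  rw [smoothSgn, one_add_norm_sq_rpow, div_eq_mul_inv]

lemma sqrt_one_add_sq_pos (t : ℝ) : 0 < √(1 + t ^ 2) := Real.sqrt_pos.2 (by positivity)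

lemma one_le_sqrt_one_add_sq (t : ℝ) : 1 ≤ √(1 + t ^ 2) :=
  Real.one_le_sqrt.2 (by linarith [sq_nonneg t])

lemma abs_le_sqrt_one_add_sq (t : ℝ) : |t| ≤ √(1 + t ^ 2) :=
  Real.abs_le_sqrt (by linarith)

lemma inv_sqrt_le_min {t : ℝ} (ht : t ≠ 0) : (√(1 + t ^ 2))⁻¹ ≤ min 1 |t|⁻¹ :=
  le_min (inv_le_one_of_one_le₀ (one_le_sqrt_one_add_sq t))
    (inv_anti₀ (abs_pos.2 ht) (abs_le_sqrt_one_add_sq t))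

lemma abs_smoothSgn_le (t : ℝ) : |smoothSgn t| ≤ 1 := by
  rw [smoothSgn_eq, abs_div, abs_of_pos (sqrt_one_add_sq_pos t),
    div_le_one (sqrt_one_add_sq_pos t)]
  exact abs_le_sqrt_one_add_sq t

lemma norm_sgn_sub_smoothSgn_le {t : ℝ} (ht : t ≠ 0) :
    ‖sgn t - smoothSgn t‖ ≤ min 1 |t|⁻¹ := by
  refine le_trans ?_ (inv_sqrt_le_min ht)
  have hs := sqrt_one_add_sq_pos t
  have h : ‖sgn t - smoothSgn t‖ = 1 - |t| / √(1 + t ^ 2) := by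
    rw [smoothSgn_eq]
    rcases ht.lt_or_gt with h | h
    · rw [sgn, if_neg h.not_gt, abs_of_neg h, ← Complex.ofReal_one, ← Complex.ofReal_neg,
        ← Complex.ofReal_sub, Complex.norm_real, Real.norm_eq_abs, abs_of_nonpos]
      · ring
      · have := (abs_le.1 (abs_smoothSgn_le t)).1
        rw [smoothSgn_eq] at this; linarith
    · rw [sgn, if_pos h, abs_of_pos h, ← Complex.ofReal_one,
        ← Complex.ofReal_sub, Complex.norm_real, Real.norm_eq_abs, abs_of_nonneg]
      have := (abs_le.1 (abs_smoothSgn_le t)).2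
      rw [smoothSgn_eq] at this; linarith
  rw [h, sub_le_iff_le_add, ← one_div, ← add_div, le_div_iff₀ hs, one_mul, Real.sqrt_le_iff]
  refine ⟨by positivity, ?_⟩
  nlinarith [sq_abs t, abs_nonneg t]

lemma hasDerivAt_smoothSgn (t : ℝ) : HasDerivAt smoothSgn ((√(1 + t ^ 2))⁻¹ ^ 3) t := by
  have h0 : smoothSgn = fun t => t / √(1 + t ^ 2) := funext smoothSgn_eq
  have hs := sqrt_one_add_sq_pos t
  have h1 : HasDerivAt (fun t : ℝ => 1 + t ^ 2) (2 * t) t := by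
    simpa using! ((hasDerivAt_id t).pow 2).const_add 1
  have h2 := h1.sqrt (by positivity : (1 + t ^ 2) ≠ 0)
  rw [h0]
  refine ((hasDerivAt_id t).div h2 hs.ne').congr_deriv ?_
  have h3 : √(1 + t ^ 2) ^ 2 = 1 + t ^ 2 := Real.sq_sqrt (by positivity)
  simp only [id]
  field_simp
  linarith

lemma hasTemperateGrowth_smoothSgn (r : ℝ) :
    (fun x : E d => (smoothSgn (tCoord x / r) : ℂ)).HasTemperateGrowth := by
  have h1 : smoothSgn.HasTemperateGrowth :=
    Function.HasTemperateGrowth.id'.mul (Function.hasTemperateGrowth_one_add_norm_sq_rpow ℝ _)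
  have h2 : (fun x : E d => tCoord x / r).HasTemperateGrowth := by
    simp only [div_eq_mul_inv]
    exact hasTemperateGrowth_tCoord.mul (Function.HasTemperateGrowth.const _)
  exact Function.HasTemperateGrowth.comp (g := Complex.ofRealCLM)
    Complex.ofRealCLM.hasTemperateGrowth (h1.comp h2)

/-- Multiplication of Schwartz functions by `smoothSgn (t / r)`. -/
noncomputable def mulSmoothSgn (r : ℝ) : 𝓢(E d, ℂ) →L[ℂ] 𝓢(E d, ℂ) :=
  SchwartzMap.smulLeftCLM ℂ (fun x : E d => (smoothSgn (tCoord x / r) : ℂ))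

lemma mulSmoothSgn_apply (r : ℝ) (φ : 𝓢(E d, ℂ)) (x : E d) :
    mulSmoothSgn r φ x = smoothSgn (tCoord x / r) * φ x := by
  rw [mulSmoothSgn, SchwartzMap.smulLeftCLM_apply_apply (hasTemperateGrowth_smoothSgn r),
    smul_eq_mul]

/-- The derivative of `smoothSgn (t / r)`. -/
noncomputable def smoothSgnDeriv (r t : ℝ) : ℝ := (√(1 + (t / r) ^ 2))⁻¹ ^ 3 / r

lemma lineDeriv_mulSmoothSgn (r : ℝ) (φ : 𝓢(E d, ℂ)) (x : E d) :
    ∂_{tDir d} (mulSmoothSgn r φ) x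
      = smoothSgn (tCoord x / r) * ∂_{tDir d} φ x + smoothSgnDeriv r (tCoord x) * φ x := by
  have h1 : HasLineDerivAt ℝ (mulSmoothSgn r φ) (smoothSgn (tCoord x / r) * ∂_{tDir d} φ x
      + smoothSgnDeriv r (tCoord x) * φ x) x (tDir d) := by
    have h0 : HasDerivAt (fun q : ℝ => (tCoord x + q) / r) (1 / r) 0 :=
      ((hasDerivAt_id (0 : ℝ)).const_add (tCoord x)).div_const r
    have h2 : HasDerivAt (fun q : ℝ => smoothSgn ((tCoord x + q) / r))
        (smoothSgnDeriv r (tCoord x)) 0 := by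
      have := HasDerivAt.comp (0 : ℝ) (h := fun q : ℝ => (tCoord x + q) / r)
        (h₂ := smoothSgn) (hasDerivAt_smoothSgn _) h0
      simpa [Function.comp_def, smoothSgnDeriv, div_eq_mul_inv] using this
    have h3 := h2.ofReal_comp.mul (hasLineDerivAt_schwartz φ x (tDir d))
    unfold HasLineDerivAt
    convert! h3 using 1
    · ext q; rw [mulSmoothSgn_apply]; simp
    · simp; ring
  exact (hasLineDerivAt_schwartz _ x _).unique h1

lemma abs_smoothSgnDeriv_le {r t : ℝ} (hr : 0 < r) : |smoothSgnDeriv r t| ≤ r⁻¹ := by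
  have h1 : 0 < (√(1 + (t / r) ^ 2))⁻¹ := inv_pos.2 (sqrt_one_add_sq_pos _)
  rw [smoothSgnDeriv, abs_of_nonneg (by positivity), div_eq_mul_inv]
  exact mul_le_of_le_one_left (by positivity)
    (pow_le_one₀ h1.le (inv_le_one_of_one_le₀ (one_le_sqrt_one_add_sq _)))

lemma abs_smoothSgnDeriv_le_min {r t : ℝ} (hr : 0 < r) (ht : t ≠ 0) :
    |smoothSgnDeriv r t| ≤ r⁻¹ * min 1 (r / |t|) := by
  have h1 : 0 < (√(1 + (t / r) ^ 2))⁻¹ := inv_pos.2 (sqrt_one_add_sq_pos _)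
  rw [smoothSgnDeriv, abs_of_nonneg (by positivity), div_eq_mul_inv, mul_comm]
  gcongr
  have h2 : min 1 (r / |t|) = min 1 |t / r|⁻¹ := by
    rw [abs_div, abs_of_pos hr, inv_div]
  rw [h2]
  refine le_trans ?_ (inv_sqrt_le_min (div_ne_zero ht hr.ne'))
  exact pow_le_of_le_one h1.le (inv_le_one_of_one_le₀ (one_le_sqrt_one_add_sq _)) (by norm_num)

/-! #### The weights `min(1, r|t|)` and `min(1, r/|t|)` -/

/-- `min(1, r|t|) f`, essentially the part of `f` with `|t| ≥ 1/r`. -/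
noncomputable def highPart (r : ℝ) (f : E d → ℂ) : E d → ℂ :=
  fun x => ((min 1 (r * |tCoord x|) : ℝ) : ℂ) * f x

/-- `min(1, r/|t|) f`, essentially the part of `f` with `|t| ≤ r`. -/
noncomputable def lowPart (r : ℝ) (f : E d → ℂ) : E d → ℂ :=
  fun x => ((min 1 (r / |tCoord x|) : ℝ) : ℂ) * f x

lemma norm_highPart {r : ℝ} (hr : 0 < r) (f : E d → ℂ) (x : E d) :
    ‖highPart r f x‖ = min 1 (r * |tCoord x|) * ‖f x‖ := by
  rw [highPart, norm_mul, Complex.norm_real, Real.norm_of_nonneg]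
  exact le_min zero_le_one (by positivity)

lemma norm_lowPart {r : ℝ} (hr : 0 < r) (f : E d → ℂ) (x : E d) :
    ‖lowPart r f x‖ = min 1 (r / |tCoord x|) * ‖f x‖ := by
  rw [lowPart, norm_mul, Complex.norm_real, Real.norm_of_nonneg]
  exact le_min zero_le_one (by positivity)

lemma min_le_rpow {s : ℝ} (hs0 : 0 ≤ s) (hs1 : s ≤ 1) {y : ℝ} (hy : 0 < y) :
    min 1 y ≤ y ^ s := by
  rcases le_total 1 y with h | h
  · rw [min_eq_left h]; exact Real.one_le_rpow h hs0
  · rw [min_eq_right h]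
    calc y = y ^ (1 : ℝ) := (Real.rpow_one y).symm
      _ ≤ y ^ s := Real.rpow_le_rpow_of_exponent_ge hy h hs1

lemma aestronglyMeasurable_highPart (r : ℝ) {f : E d → ℂ} (hf : AEStronglyMeasurable f) :
    AEStronglyMeasurable (highPart r f) :=
  (Complex.measurable_ofReal.comp (measurable_const.min
    (measurable_tCoord.norm.const_mul r))).aestronglyMeasurable.mul hf

lemma aestronglyMeasurable_lowPart (r : ℝ) {f : E d → ℂ} (hf : AEStronglyMeasurable f) :
    AEStronglyMeasurable (lowPart r f) :=
  (Complex.measurable_ofReal.comp (measurable_const.min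
    (measurable_const.div measurable_tCoord.norm))).aestronglyMeasurable.mul hf

lemma memLp_highPart {s : ℝ} (hs0 : 0 ≤ s) (hs1 : s ≤ 1) {r : ℝ} (hr : 0 < r) {k : E d → ℂ}
    (hk : MemLp k 2) : MemLp (highPart r (wt (-s) k)) 2 := by
  refine hk.of_le_mul (c := r ^ s)
    (aestronglyMeasurable_highPart r (aestronglyMeasurable_wt _ hk.1)) ?_
  filter_upwards [ae_tCoord_ne_zero] with x hx
  have hp := abs_pos.2 hx
  rw [norm_highPart hr, wt, norm_mul, norm_pw _ hx, ← mul_assoc]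
  gcongr
  calc min 1 (r * |tCoord x|) * |tCoord x| ^ (-s : ℂ).re
      ≤ (r * |tCoord x|) ^ s * |tCoord x| ^ (-s) := by
        rw [Complex.neg_re, Complex.ofReal_re]
        gcongr
        exact min_le_rpow hs0 hs1 (by positivity)
    _ = r ^ s := by
        rw [Real.mul_rpow hr.le hp.le, mul_assoc, ← Real.rpow_add hp, add_neg_cancel,
          Real.rpow_zero, mul_one]

lemma memLp_lowPart {s : ℝ} (hs0 : 0 ≤ s) (hs1 : s ≤ 1) {r : ℝ} (hr : 0 < r) {f : E d → ℂ}
    (hf : MemLp (wt (-s) f) 2) : MemLp (lowPart r f) 2 := by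
  refine hf.of_le_mul (c := r ^ s)
    (aestronglyMeasurable_lowPart r (aestronglyMeasurable_of_wt hf.1)) ?_
  filter_upwards [ae_tCoord_ne_zero] with x hx
  have hp := abs_pos.2 hx
  rw [norm_lowPart hr, wt, norm_mul, norm_pw _ hx, ← mul_assoc]
  gcongr
  rw [Complex.neg_re, Complex.ofReal_re, Real.rpow_neg hp.le, ← div_eq_mul_inv,
    ← Real.div_rpow hr.le hp.le]
  exact min_le_rpow hs0 hs1 (by positivity)

lemma integral_fourier_mul (ψ : 𝓢(E d, ℂ)) (p : Lp ℂ 2 (volume : Measure (E d))) :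
    ∫ x, (𝓕 ψ : 𝓢(E d, ℂ)) x * p x
      = ∫ x, ψ x * (𝓕 p : Lp ℂ 2 (volume : Measure (E d))) x := by
  rw [← fourier_lp_apply, ← lp_apply_eq_integral]; rfl

/-- Splitting of `u` into the parts of frequencies above and below `1 / r`: the high part is `h`,
and the low part has the derivative `G = ∂ₜ (u - h)`. -/
lemma exists_frequency_split {s : ℝ} (hs0 : 0 ≤ s) (hs1 : s ≤ 1) {u : 𝓢'(E d, ℂ)} (hu : IsTame u)
    {k : E d → ℂ} (hk : MemLp k 2) (hku : ∀ φ ∈ annular d, (𝓕 u) φ = ∫ x, φ x * wt (-s) k x)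
    {r : ℝ} (hr : 0 < r) : ∃ h G : Lp ℂ 2 (volume : Measure (E d)),
      l2 h ≤ l2 (highPart r (wt (-s) k)) ∧
      ENNReal.ofReal r * l2 G ≤ 7 * l2 (highPart r (wt (-s) k)) ∧
      ∀ φ : 𝓢(E d, ℂ), u (∂_{tDir d} φ) - ∫ x, ∂_{tDir d} φ x * h x = -∫ x, φ x * G x := by
  set a := wt (-s : ℂ) k with ha
  have ham : AEStronglyMeasurable a := aestronglyMeasurable_wt _ hk.1
  have hhigh : MemLp (highPart r a) 2 := memLp_highPart hs0 hs1 hr hk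
  set H : Set (E d) := {x | 1 ≤ r * |tCoord x|} with hH
  have hHm : MeasurableSet H :=
    measurableSet_le measurable_const (measurable_tCoord.norm.const_mul r)
  set b : E d → ℂ := H.indicator a with hb
  set c : E d → ℂ := Hᶜ.indicator (fun x => 2 * Real.pi * Complex.I * tCoord x * a x) with hc
  have hble : ∀ x, ‖b x‖ ≤ ‖highPart r a x‖ := fun x => by
    rw [norm_highPart hr]
    by_cases hx : x ∈ H
    · rw [hb, Set.indicator_of_mem hx, min_eq_left hx, one_mul]
    · rw [hb, Set.indicator_of_notMem hx, norm_zero]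
      have : 0 ≤ min 1 (r * |tCoord x|) := le_min zero_le_one (by positivity)
      positivity
  have hcle : ∀ x, ‖c x‖ ≤ (7 / r) * ‖highPart r a x‖ := fun x => by
    rw [norm_highPart hr]
    by_cases hx : x ∈ H
    · have : 0 ≤ min 1 (r * |tCoord x|) := le_min zero_le_one (by positivity)
      rw [hc, Set.indicator_of_notMem (by simpa using hx), norm_zero]
      positivity
    · rw [hc, Set.indicator_of_mem (by simpa using hx), min_eq_right (le_of_lt (not_le.1 hx))]
      simp only [norm_mul, Complex.norm_real, Complex.norm_I, Complex.norm_ofNat,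
        Real.norm_of_nonneg Real.pi_pos.le, Real.norm_eq_abs, mul_one]
      have h7 : 2 * Real.pi ≤ 7 := by linarith [Real.pi_lt_d2]
      calc 2 * Real.pi * |tCoord x| * ‖a x‖ ≤ 7 * |tCoord x| * ‖a x‖ := by gcongr
        _ = _ := by field_simp
  have hbL : MemLp b 2 := hhigh.of_le (ham.indicator hHm) (ae_of_all _ hble)
  have hcL : MemLp c 2 := hhigh.of_le_mul (AEStronglyMeasurable.indicator
    (((Complex.measurable_ofReal.comp measurable_tCoord).const_mul
      (2 * Real.pi * Complex.I : ℂ)).aestronglyMeasurable.mul ham) hHm.compl) (ae_of_all _ hcle)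
  refine ⟨𝓕⁻ hbL.toLp, 𝓕⁻ hcL.toLp, ?_, ?_, fun φ => ?_⟩
  · rw [l2_lp, ← enorm_fourier_lp, FourierTransform.fourier_fourierInv_eq, Lp.enorm_toLp]
    exact l2_mono (ae_of_all _ hble)
  · rw [l2_lp, ← enorm_fourier_lp, FourierTransform.fourier_fourierInv_eq, Lp.enorm_toLp]
    calc ENNReal.ofReal r * l2 c
        ≤ ENNReal.ofReal r * (ENNReal.ofReal (7 / r) * l2 (highPart r a)) := by
          gcongr
          exact eLpNorm_le_mul_eLpNorm_of_ae_le_mul (ae_of_all _ hcle) 2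
      _ = _ := by
          rw [← mul_assoc, ← ENNReal.ofReal_mul hr.le, mul_div_cancel₀ _ hr.ne']
          simp
  · obtain ⟨ψ, rfl⟩ : ∃ ψ : 𝓢(E d, ℂ), 𝓕 ψ = φ :=
      ⟨𝓕⁻ φ, FourierTransform.fourier_fourierInv_eq φ⟩
    set χ : 𝓢(E d, ℂ) := -(2 * Real.pi * Complex.I) • mulT ψ with hχ
    have hχx : ∀ x, χ x = -(2 * Real.pi * Complex.I) * (tCoord x * ψ x) := fun x => by
      rw [hχ, smul_apply, mulT_apply, smul_eq_mul]
    have hχ0 : ∀ x, tCoord x = 0 → χ x = 0 := fun x hx => by rw [hχx, hx]; simp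
    have h1 : u (𝓕 χ : 𝓢(E d, ℂ)) = ∫ x, χ x * a x :=
      fourier_apply_of_vanish hs0 hs1 hu hk hku hχ0
    rw [lineDeriv_fourier, h1, integral_fourier_mul, integral_fourier_mul,
      FourierTransform.fourier_fourierInv_eq, FourierTransform.fourier_fourierInv_eq]
    have hi1 : Integrable fun x => χ x * a x := integrable_mul_of_wt (z := -s)
      (memLp_wt_neg_of_vanish hs0 hs1 hχ0) (memLp_wt_neg_wt hk)
    have hi2 : Integrable fun x => χ x * hbL.toLp b x :=
      integrable_mul_of_memLp (memLp_schwartz χ) (Lp.memLp _)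
    rw [← integral_sub hi1 hi2, ← integral_neg]
    refine integral_congr_ae ?_
    filter_upwards [hbL.coeFn_toLp, hcL.coeFn_toLp] with x hx1 hx2
    rw [hx1, hx2, hχx]
    by_cases hx : x ∈ H
    · rw [hb, hc, Set.indicator_of_mem hx, Set.indicator_of_notMem (by simpa using hx)]; ring
    · rw [hb, hc, Set.indicator_of_notMem hx, Set.indicator_of_mem (by simpa using hx)]; ring

lemma sgn_div {r : ℝ} (hr : 0 < r) (t : ℝ) : sgn (t / r) = sgn t := by
  simp only [sgn, div_pos_iff_of_pos_right hr]

set_option maxHeartbeats 800000 in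
/-- The product of a function in `A_s` and the sign of `t` is, for each scale `r`, the sum of a
function in `L²` and a function with derivative in `L²`, with norms controlled by the frequencies of
`u` above `1/r` and by `u` at `|t| ≤ r`. In terms of Fourier transforms: `t ŵ = t p + (2πi)⁻¹ q`. -/
lemma exists_scale_split {s : ℝ} (hs0 : 0 ≤ s) (hs1 : s ≤ 1) {u w : 𝓢'(E d, ℂ)} {f : E d → ℂ}
    (hf : IsRepresentedBy u f) (hfs : MemLp (wt (-s) f) 2) (hw : IsRepresentedBy w (sgnMul f))
    {k : E d → ℂ} (hk : MemLp k 2) (hku : ∀ φ ∈ annular d, (𝓕 u) φ = ∫ x, φ x * wt (-s) k x)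
    {r : ℝ} (hr : 0 < r) : ∃ p q : Lp ℂ 2 (volume : Measure (E d)),
      l2 p ≤ 8 * (l2 (highPart r (wt (-s) k)) + l2 (lowPart r f)) ∧
      ENNReal.ofReal r * l2 q ≤ 8 * (l2 (highPart r (wt (-s) k)) + l2 (lowPart r f)) ∧
      ∀ χ : 𝓢(E d, ℂ), (𝓕 w) (mulT χ)
        = ∫ x, χ x * (tCoord x * p x + (2 * Real.pi * Complex.I)⁻¹ * q x) := by
  have hu := isTame_of_isRepresentedBy hs0 hs1 hf hfs
  obtain ⟨h, G, hh, hG, hdu⟩ := exists_frequency_split hs0 hs1 hu hk hku hr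
  set K₁ := l2 (highPart r (wt (-s) k)) with hK₁
  set K₂ := l2 (lowPart r f) with hK₂
  have hlow : MemLp (lowPart r f) 2 := memLp_lowPart hs0 hs1 hr hfs
  set β : E d → ℂ := fun x => smoothSgn (tCoord x / r) with hβ
  set β' : E d → ℂ := fun x => smoothSgnDeriv r (tCoord x) with hβ'
  have hβm : AEStronglyMeasurable β :=
    (hasTemperateGrowth_smoothSgn r).1.continuous.aestronglyMeasurable
  have hβm' : AEStronglyMeasurable β' := by
    have : Continuous fun t : ℝ => smoothSgnDeriv r t := by
      unfold smoothSgnDeriv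
      refine Continuous.div_const (Continuous.pow (Continuous.inv₀ (by fun_prop) fun t =>
        (sqrt_one_add_sq_pos _).ne') 3) r
    exact (Complex.continuous_ofReal.comp (this.comp continuous_tCoord)).aestronglyMeasurable
  have hβ1 : ∀ x, ‖β x‖ ≤ 1 := fun x => by
    rw [hβ, Complex.norm_real]; exact abs_smoothSgn_le _
  -- the two functions of the splitting `sgn f = v₀ + β (f - h)`, `∂ₜ (β (f - h)) = q₀`
  set v₁ : E d → ℂ := fun x => (sgn (tCoord x) - β x) * f x with hv₁
  have hv₁le : ∀ᵐ x, ‖v₁ x‖ ≤ ‖lowPart r f x‖ := by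
    filter_upwards [ae_tCoord_ne_zero] with x hx
    rw [norm_lowPart hr, hv₁, norm_mul]
    gcongr
    have := norm_sgn_sub_smoothSgn_le (div_ne_zero hx hr.ne')
    rwa [sgn_div hr, abs_div, abs_of_pos hr, inv_div] at this
  have hv₁L : MemLp v₁ 2 := hlow.of_le
    ((((measurable_sgn.comp measurable_tCoord).aestronglyMeasurable).sub hβm).mul hf.1) hv₁le
  have hβh : MemLp (fun x => β x * h x) 2 := (Lp.memLp h).of_le (hβm.mul (Lp.memLp h).1)
    (ae_of_all _ fun x => by
      rw [norm_mul]; exact mul_le_of_le_one_left (norm_nonneg _) (hβ1 x))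
  have hβG : MemLp (fun x => β x * G x) 2 := (Lp.memLp G).of_le (hβm.mul (Lp.memLp G).1)
    (ae_of_all _ fun x => by
      rw [norm_mul]; exact mul_le_of_le_one_left (norm_nonneg _) (hβ1 x))
  have hβ'f_le : ∀ᵐ x, ‖β' x * f x‖ ≤ r⁻¹ * ‖lowPart r f x‖ := by
    filter_upwards [ae_tCoord_ne_zero] with x hx
    rw [norm_lowPart hr, hβ', norm_mul, Complex.norm_real, ← mul_assoc]
    gcongr
    exact abs_smoothSgnDeriv_le_min hr hx
  have hβ'h_le : ∀ᵐ x, ‖β' x * h x‖ ≤ r⁻¹ * ‖h x‖ := ae_of_all _ fun x => by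
    rw [hβ', norm_mul, Complex.norm_real]
    gcongr
    exact abs_smoothSgnDeriv_le hr
  have hβ'f : MemLp (fun x => β' x * f x) 2 := hlow.of_le_mul (hβm'.mul hf.1) hβ'f_le
  have hβ'h : MemLp (fun x => β' x * h x) 2 :=
    (Lp.memLp h).of_le_mul (hβm'.mul (Lp.memLp h).1) hβ'h_le
  have hv₀ : MemLp (fun x => v₁ x + β x * h x) 2 := hv₁L.add hβh
  have hq₀' : MemLp (fun x => β' x * f x - β' x * h x) 2 := hβ'f.sub hβ'h
  have hq₀ : MemLp (fun x => β x * G x + (β' x * f x - β' x * h x)) 2 := hβG.add hq₀'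
  have hl2βh : l2 (fun x => β x * h x) ≤ l2 h := l2_mono (ae_of_all _ fun x => by
    rw [norm_mul]; exact mul_le_of_le_one_left (norm_nonneg _) (hβ1 x))
  have hl2βG : l2 (fun x => β x * G x) ≤ l2 G := l2_mono (ae_of_all _ fun x => by
    rw [norm_mul]; exact mul_le_of_le_one_left (norm_nonneg _) (hβ1 x))
  have hrr : ENNReal.ofReal r * ENNReal.ofReal r⁻¹ = 1 := by
    rw [← ENNReal.ofReal_mul hr.le, mul_inv_cancel₀ hr.ne', ENNReal.ofReal_one]
  refine ⟨𝓕 hv₀.toLp, 𝓕 hq₀.toLp, ?_, ?_, fun χ => ?_⟩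
  · rw [l2_lp, enorm_fourier_lp, Lp.enorm_toLp]
    calc l2 (fun x => v₁ x + β x * h x) ≤ l2 v₁ + l2 (fun x => β x * h x) :=
          l2_add_le hv₁L.1 hβh.1
      _ ≤ K₂ + K₁ := add_le_add (l2_mono hv₁le) (hl2βh.trans hh)
      _ ≤ 8 * (K₁ + K₂) := by
          rw [add_comm]; exact le_mul_of_one_le_left zero_le (by norm_num)
  · rw [l2_lp, enorm_fourier_lp, Lp.enorm_toLp]
    have h1 : l2 (fun x => β' x * f x) ≤ ENNReal.ofReal r⁻¹ * K₂ :=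
      eLpNorm_le_mul_eLpNorm_of_ae_le_mul hβ'f_le 2
    have h2 : l2 (fun x => β' x * h x) ≤ ENNReal.ofReal r⁻¹ * K₁ :=
      (eLpNorm_le_mul_eLpNorm_of_ae_le_mul hβ'h_le 2).trans (by gcongr)
    have h3 : l2 (fun x => β' x * f x - β' x * h x) ≤ ENNReal.ofReal r⁻¹ * (K₁ + K₂) := by
      rw [mul_add, add_comm (ENNReal.ofReal r⁻¹ * K₁)]
      exact (eLpNorm_sub_le hβ'f.1 hβ'h.1 (by norm_num)).trans (add_le_add h1 h2)
    calc ENNReal.ofReal r * l2 (fun x => β x * G x + (β' x * f x - β' x * h x))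
        ≤ ENNReal.ofReal r * (l2 G + ENNReal.ofReal r⁻¹ * (K₁ + K₂)) := by
          gcongr
          exact (l2_add_le hβG.1 hq₀'.1).trans (add_le_add hl2βG h3)
      _ ≤ 7 * K₁ + (K₁ + K₂) := by
          rw [mul_add, ← mul_assoc, hrr, one_mul]
          gcongr
      _ ≤ 7 * (K₁ + K₂) + (K₁ + K₂) := by
          gcongr
          exact le_self_add
      _ = 8 * (K₁ + K₂) := by ring
  · set η : 𝓢(E d, ℂ) := 𝓕 χ with hη
    set ζ : 𝓢(E d, ℂ) := 𝓕 (mulT χ) with hζ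
    have hcI : (2 * Real.pi * Complex.I : ℂ) ≠ 0 := by simp [Real.pi_ne_zero]
    have hζη : ∀ x, ζ x = -(2 * Real.pi * Complex.I)⁻¹ * ∂_{tDir d} η x := fun x => by
      have h1 := lineDeriv_fourier χ
      rw [← fourierCLM_apply (R := ℂ) (-(2 * Real.pi * Complex.I : ℂ) • mulT χ), map_smul,
        fourierCLM_apply] at h1
      rw [hη, h1, smul_apply, smul_eq_mul]
      field_simp
      rfl
    -- the part `β (f - h)`, by partial integration
    have hpart : ∫ x, ∂_{tDir d} η x * (β x * f x - β x * h x)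
        = -∫ x, η x * (β x * G x + (β' x * f x - β' x * h x)) := by
      have h1 := hdu (mulSmoothSgn r η)
      rw [(hf.2 _).2] at h1
      have hi1 := (hf.2 (∂_{tDir d} (mulSmoothSgn r η))).1
      have hi2 := integrable_mul_of_memLp (memLp_schwartz (∂_{tDir d} (mulSmoothSgn r η)))
        (Lp.memLp h)
      have hi3 := integrable_mul_of_memLp (memLp_schwartz η) hq₀'
      have hi4 := integrable_mul_of_memLp (memLp_schwartz η) hβG
      have hi5 : Integrable fun x => ∂_{tDir d} (mulSmoothSgn r η) x * f x
          - ∂_{tDir d} (mulSmoothSgn r η) x * h x := hi1.sub hi2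
      rw [← integral_sub hi1 hi2] at h1
      have h2 : ∀ x, ∂_{tDir d} η x * (β x * f x - β x * h x)
          = (∂_{tDir d} (mulSmoothSgn r η) x * f x - ∂_{tDir d} (mulSmoothSgn r η) x * h x)
            - η x * (β' x * f x - β' x * h x) := fun x => by
        rw [lineDeriv_mulSmoothSgn]; simp only [hβ, hβ']; ring
      rw [integral_congr_ae (ae_of_all _ h2), integral_sub hi5 hi3, h1]
      have h3 : ∀ x, η x * (β x * G x + (β' x * f x - β' x * h x))
          = η x * (β x * G x) + η x * (β' x * f x - β' x * h x) := fun x => by ring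
      rw [integral_congr_ae (ae_of_all _ h3), integral_add hi4 hi3, neg_add, ← sub_eq_add_neg]
      congr 2
      refine integral_congr_ae (ae_of_all _ fun x => ?_)
      dsimp only
      rw [mulSmoothSgn_apply]; ring
    have hj1 := integrable_mul_of_memLp (memLp_schwartz ζ) hv₀
    have hj2 : Integrable fun x => ζ x * (β x * f x - β x * h x) := by
      refine ((hw.2 ζ).1.sub hj1).congr (ae_of_all _ fun x => ?_)
      simp only [Pi.sub_apply, sgnMul, hv₁]; ring
    have hsum : (𝓕 w) (mulT χ) = (∫ x, ζ x * (v₁ x + β x * h x))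
        + ∫ x, ζ x * (β x * f x - β x * h x) := by
      rw [← integral_add hj1 hj2]
      refine ((hw.2 ζ).2).trans (integral_congr_ae (ae_of_all _ fun x => ?_))
      simp only [sgnMul, hv₁]; ring
    have e1 : ∫ x, ζ x * (v₁ x + β x * h x)
        = ∫ x, χ x * (tCoord x * (𝓕 hv₀.toLp : Lp ℂ 2 (volume : Measure (E d))) x) := by
      have := integral_fourier_mul (mulT χ) hv₀.toLp
      rw [← hζ] at this
      rw [integral_congr_ae (g := fun x => ζ x * hv₀.toLp _ x) (by
        filter_upwards [hv₀.coeFn_toLp] with x hx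
        rw [hx]), this]
      refine integral_congr_ae (ae_of_all _ fun x => ?_)
      dsimp only
      rw [mulT_apply]; ring
    have e2 : ∫ x, ζ x * (β x * f x - β x * h x)
        = ∫ x, χ x * ((2 * Real.pi * Complex.I)⁻¹ *
            (𝓕 hq₀.toLp : Lp ℂ 2 (volume : Measure (E d))) x) := by
      have h1 : ∀ x, ζ x * (β x * f x - β x * h x) = -(2 * Real.pi * Complex.I)⁻¹ *
          (∂_{tDir d} η x * (β x * f x - β x * h x)) := fun x => by rw [hζη]; ring
      rw [integral_congr_ae (ae_of_all _ h1), integral_const_mul, hpart]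
      have := integral_fourier_mul χ hq₀.toLp
      rw [← hη] at this
      rw [integral_congr_ae (g := fun x => η x * hq₀.toLp _ x) (by
        filter_upwards [hq₀.coeFn_toLp] with x hx
        rw [hx]), this, neg_mul_neg, ← integral_const_mul]
      refine integral_congr_ae (ae_of_all _ fun x => ?_)
      dsimp only
      ring
    set P : Lp ℂ 2 (volume : Measure (E d)) := 𝓕 hv₀.toLp
    set Q : Lp ℂ 2 (volume : Measure (E d)) := 𝓕 hq₀.toLp
    have hl1 : Integrable fun x => χ x * (tCoord x * P x) := by
      refine (integrable_mul_of_memLp (memLp_schwartz (mulT χ)) (Lp.memLp P)).congr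
        (ae_of_all _ fun x => ?_)
      dsimp only
      rw [mulT_apply]; ring
    have hl2 : Integrable fun x => χ x * ((2 * Real.pi * Complex.I)⁻¹ * Q x) :=
      integrable_mul_of_memLp (memLp_schwartz χ) ((Lp.memLp Q).const_mul _)
    rw [hsum, e1, e2, ← integral_add hl1 hl2]
    refine integral_congr_ae (ae_of_all _ fun x => ?_)
    dsimp only
    ring

/-! ### Summation over dyadic scales -/

lemma rpow_mul_min_sq_le_of_ge {s : ℝ} (hs0 : 0 < s) {N : ℕ} {y : ℝ} (hy : 2 ^ N ≤ y) :
    y ^ (-2 * s) * (min 1 y) ^ 2 ≤ ((2 : ℝ) ^ (-2 * s)) ^ N := by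
  have h1 : (1 : ℝ) ≤ y := (one_le_pow₀ one_le_two).trans hy
  rw [min_eq_left h1, one_pow, mul_one, ← Real.rpow_natCast, ← Real.rpow_mul two_pos.le,
    mul_comm (-2 * s), Real.rpow_mul two_pos.le, Real.rpow_natCast]
  exact Real.rpow_le_rpow_of_nonpos (by positivity) hy (by linarith)

lemma rpow_mul_min_sq_le_of_lt {s : ℝ} (hs1 : s < 1) {N : ℕ} {y : ℝ} (hy0 : 0 < y)
    (hy : y ≤ ((2 : ℝ) ^ N)⁻¹) :
    y ^ (-2 * s) * (min 1 y) ^ 2 ≤ ((2 : ℝ) ^ (-(2 - 2 * s))) ^ N := by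
  have h1 : y ≤ 1 := hy.trans (inv_le_one_of_one_le₀ (one_le_pow₀ one_le_two))
  rw [min_eq_right h1, ← Real.rpow_natCast y, ← Real.rpow_add hy0, ← Real.rpow_natCast _ N,
    ← Real.rpow_mul two_pos.le, mul_comm (-(2 - 2 * s)), Real.rpow_mul two_pos.le,
    Real.rpow_natCast, Real.rpow_neg (by positivity), ← Real.inv_rpow (by positivity)]
  calc y ^ (-2 * s + (2 : ℕ)) = y ^ (2 - 2 * s) := by push_cast; congr 1; ring
    _ ≤ _ := Real.rpow_le_rpow hy0.le hy (by linarith)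

lemma tsum_geometric_ne_top {a : ℝ} (ha : a < 1) :
    ∑' n : ℕ, ENNReal.ofReal a ^ n ≠ ⊤ := by
  rw [ENNReal.tsum_geometric]
  refine ENNReal.inv_ne_top.2 (tsub_pos_of_lt ?_).ne'
  exact ENNReal.ofReal_lt_one.2 ha

/-- The dyadic form of `∫₀^∞ y^{-2s} min(1, y)² dy / y < ∞`. -/
lemma exists_tsum_dyadic_le {s : ℝ} (hs0 : 0 < s) (hs1 : s < 1) : ∃ C : ℝ≥0, ∀ x : ℝ, 0 < x →
    ∑' n : ℤ, ENNReal.ofReal (((2 : ℝ) ^ n * x) ^ (-2 * s) * (min 1 ((2 : ℝ) ^ n * x)) ^ 2)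
      ≤ C := by
  have ha : (2 : ℝ) ^ (-2 * s) < 1 := Real.rpow_lt_one_of_one_lt_of_neg one_lt_two (by linarith)
  have hb : (2 : ℝ) ^ (-(2 - 2 * s)) < 1 :=
    Real.rpow_lt_one_of_one_lt_of_neg one_lt_two (by linarith)
  refine ⟨(∑' n : ℕ, ENNReal.ofReal ((2 : ℝ) ^ (-2 * s)) ^ n
    + ∑' n : ℕ, ENNReal.ofReal ((2 : ℝ) ^ (-(2 - 2 * s))) ^ n).toNNReal, fun x hx => ?_⟩
  rw [ENNReal.coe_toNNReal (ENNReal.add_ne_top.2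
    ⟨tsum_geometric_ne_top ha, tsum_geometric_ne_top hb⟩)]
  obtain ⟨j, hj1, hj2⟩ := exists_mem_Ico_zpow hx one_lt_two
  set F : ℤ → ℝ≥0∞ := fun n =>
    ENNReal.ofReal (((2 : ℝ) ^ n * x) ^ (-2 * s) * (min 1 ((2 : ℝ) ^ n * x)) ^ 2) with hF
  have h1 : ∑' n : ℤ, F n = ∑' n : ℤ, F (n - j) := ((Equiv.subRight j).tsum_eq F).symm
  rw [h1, tsum_of_nat_of_neg_add_one ENNReal.summable ENNReal.summable]
  refine add_le_add (ENNReal.tsum_le_tsum fun n => ?_) (ENNReal.tsum_le_tsum fun n => ?_)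
  · rw [hF, ← ENNReal.ofReal_pow (by positivity)]
    refine ENNReal.ofReal_le_ofReal (rpow_mul_min_sq_le_of_ge hs0 ?_)
    calc (2 : ℝ) ^ n = 2 ^ ((n : ℤ) - j) * 2 ^ j := by
          rw [← zpow_add₀ two_ne_zero, sub_add_cancel, zpow_natCast]
      _ ≤ _ := by gcongr
  · rw [hF, ← ENNReal.ofReal_pow (by positivity)]
    refine ENNReal.ofReal_le_ofReal (rpow_mul_min_sq_le_of_lt hs1 (by positivity) ?_)
    calc (2 : ℝ) ^ (-((n : ℤ) + 1) - j) * x ≤ 2 ^ (-((n : ℤ) + 1) - j) * 2 ^ (j + 1) := by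
          gcongr
      _ = ((2 : ℝ) ^ n)⁻¹ := by
          rw [← zpow_add₀ two_ne_zero, ← zpow_natCast, ← zpow_neg]
          congr 1; ring

lemma l2_sq_mul_const (c : ℝ≥0∞) (hc : c ≠ ⊤) (f : E d → ℂ) :
    c * l2 f ^ 2 = ∫⁻ x, c * ‖f x‖ₑ ^ 2 := by
  rw [eLpNorm_two_sq, lintegral_const_mul' _ _ hc]

/-- Summation of the high parts of `|t|^{-s} k` over dyadic scales, pointwise in `x`. -/
lemma exists_tsum_highPart_le {s : ℝ} (hs0 : 0 < s) (hs1 : s < 1) : ∃ C : ℝ≥0,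
    ∀ k : E d → ℂ, MemLp k 2 → ∑' n : ℤ, ENNReal.ofReal (((2 : ℝ) ^ n) ^ (-2 * s))
      * l2 (highPart ((2 : ℝ) ^ n) (wt (-s) k)) ^ 2 ≤ C * l2 k ^ 2 := by
  obtain ⟨C, hC⟩ := exists_tsum_dyadic_le hs0 hs1
  refine ⟨C, fun k hk => ?_⟩
  simp_rw [l2_sq_mul_const _ ENNReal.ofReal_ne_top]
  rw [← lintegral_tsum fun n => (((aestronglyMeasurable_highPart _
    (aestronglyMeasurable_wt _ hk.1)).aemeasurable.enorm.pow_const 2).const_mul _),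
    l2_sq_mul_const _ ENNReal.coe_ne_top]
  refine lintegral_mono_ae ?_
  filter_upwards [ae_tCoord_ne_zero] with x hx
  have hp := abs_pos.2 hx
  refine le_trans (le_of_eq ?_) (mul_le_mul_left (hC _ hp) (‖k x‖ₑ ^ 2))
  rw [← ENNReal.tsum_mul_right]
  refine tsum_congr fun n => ?_
  have h2 : (0 : ℝ) < 2 ^ n := by positivity
  have hm : 0 ≤ min 1 ((2 : ℝ) ^ n * |tCoord x|) := le_min zero_le_one (by positivity)
  rw [← ofReal_norm, ← ofReal_norm, norm_highPart h2, wt, norm_mul, norm_pw _ hx,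
    ← ENNReal.ofReal_pow (by positivity), ← ENNReal.ofReal_pow (by positivity),
    ← ENNReal.ofReal_mul (by positivity), ← ENNReal.ofReal_mul (by positivity)]
  congr 1
  rw [Complex.neg_re, Complex.ofReal_re, Real.mul_rpow h2.le hp.le,
    show -2 * s = -s + -s by ring, Real.rpow_add hp]
  ring

/-- Summation of the low parts of `f` over dyadic scales, pointwise in `x`. -/
lemma exists_tsum_lowPart_le {s : ℝ} (hs0 : 0 < s) (hs1 : s < 1) : ∃ C : ℝ≥0,
    ∀ f : E d → ℂ, AEStronglyMeasurable f → ∑' n : ℤ, ENNReal.ofReal (((2 : ℝ) ^ n) ^ (-2 * s))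
      * l2 (lowPart ((2 : ℝ) ^ n) f) ^ 2 ≤ C * l2 (wt (-s) f) ^ 2 := by
  obtain ⟨C, hC⟩ := exists_tsum_dyadic_le hs0 hs1
  refine ⟨C, fun f hf => ?_⟩
  simp_rw [l2_sq_mul_const _ ENNReal.ofReal_ne_top]
  rw [← lintegral_tsum fun n => ((aestronglyMeasurable_lowPart _ hf).aemeasurable.enorm.pow_const
    2).const_mul _, l2_sq_mul_const _ ENNReal.coe_ne_top]
  refine lintegral_mono_ae ?_
  filter_upwards [ae_tCoord_ne_zero] with x hx
  have hp := abs_pos.2 hx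
  refine le_trans (le_of_eq ?_) (mul_le_mul_left (hC _ (inv_pos.2 hp)) (‖wt (-s) f x‖ₑ ^ 2))
  rw [← ENNReal.tsum_mul_right]
  refine tsum_congr fun n => ?_
  have h2 : (0 : ℝ) < 2 ^ n := by positivity
  have hm : 0 ≤ min 1 ((2 : ℝ) ^ n * |tCoord x|⁻¹) := le_min zero_le_one (by positivity)
  rw [← ofReal_norm, ← ofReal_norm, norm_lowPart h2, wt, norm_mul, norm_pw _ hx, div_eq_mul_inv,
    ← ENNReal.ofReal_pow (by positivity), ← ENNReal.ofReal_pow (by positivity),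
    ← ENNReal.ofReal_mul (by positivity), ← ENNReal.ofReal_mul (by positivity)]
  congr 1
  have h3 : (|tCoord x|⁻¹) ^ (-2 * s) * (|tCoord x| ^ (-s)) ^ 2 = 1 := by
    rw [Real.inv_rpow hp.le, ← Real.rpow_neg hp.le, sq, ← Real.rpow_add hp, ← Real.rpow_add hp]
    ring_nf
    exact Real.rpow_zero _
  rw [Complex.neg_re, Complex.ofReal_re, Real.mul_rpow h2.le (by positivity)]
  linear_combination (-(((2 : ℝ) ^ n) ^ (-2 * s) * (min 1 ((2 : ℝ) ^ n * |tCoord x|⁻¹)) ^ 2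
    * ‖f x‖ ^ 2)) * h3

lemma ennreal_add_sq_le (a b : ℝ≥0∞) : (a + b) ^ 2 ≤ 2 * (a ^ 2 + b ^ 2) := by
  rcases eq_or_ne a ⊤ with rfl | ha
  · simp
  rcases eq_or_ne b ⊤ with rfl | hb
  · simp
  lift a to ℝ≥0 using ha
  lift b to ℝ≥0 using hb
  exact_mod_cast add_sq_le (a := a) (b := b)

lemma integrable_mul_tCoord_add (φ : 𝓢(E d, ℂ)) (c : ℂ) (p q : Lp ℂ 2 (volume : Measure (E d))) :
    Integrable fun x => φ x * (tCoord x * p x + c * q x) := by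
  have h1 := integrable_mul_of_memLp (memLp_schwartz (mulT φ)) (Lp.memLp p)
  have h2 := integrable_mul_of_memLp (memLp_schwartz φ) ((Lp.memLp q).const_mul c)
  refine (h1.add h2).congr (ae_of_all _ fun x => ?_)
  simp only [Pi.add_apply, mulT_apply]; ring

/-- The sign of `t` is a multiplier of `A_s`, in terms of Fourier transforms. On the dyadic band
`|t| ∼ 2^{-n}` the transform of `sgn(t) u` is estimated by the splitting at the scale `2^n`. -/
theorem exists_fourier_sgnMul {s : ℝ} (hs0 : 0 < s) (hs1 : s < 1) : ∃ C : ℝ≥0,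
    ∀ {u w : 𝓢'(E d, ℂ)} {f k : E d → ℂ}, IsRepresentedBy u f → MemLp (wt (-s) f) 2 →
      IsRepresentedBy w (sgnMul f) → MemLp k 2 →
      (∀ φ ∈ annular d, (𝓕 u) φ = ∫ x, φ x * wt (-s) k x) →
      ∃ k' : E d → ℂ, MemLp k' 2 ∧ l2 k' ≤ C * (l2 k + l2 (wt (-s) f)) ∧
        ∀ φ ∈ annular d, (𝓕 w) φ = ∫ x, φ x * wt (-s) k' x := by
  obtain ⟨C₁, hC₁⟩ := exists_tsum_highPart_le (d := d) hs0 hs1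
  obtain ⟨C₂, hC₂⟩ := exists_tsum_lowPart_le (d := d) hs0 hs1
  refine ⟨2048 * (C₁ + C₂ + 1), ?_⟩
  intro u w f k hf hfs hw hk hku
  have h2n : ∀ n : ℤ, (0 : ℝ) < 2 ^ n := fun n => by positivity
  choose p q hp hq hpq using fun n : ℤ =>
    exists_scale_split hs0.le hs1.le hf hfs hw hk hku (h2n n)
  set c : ℂ := (2 * Real.pi * Complex.I)⁻¹ with hc
  have hc1 : ‖c‖ ≤ 1 := by
    rw [hc, norm_inv]
    refine inv_le_one_of_one_le₀ ?_
    simp only [norm_mul, Complex.norm_real, Complex.norm_I, Complex.norm_ofNat,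
      Real.norm_of_nonneg Real.pi_pos.le, mul_one]
    linarith [Real.pi_gt_three]
  set μ : ℤ → E d → ℂ := fun n x => tCoord x * p n x + c * q n x with hμ
  -- the function `t ŵ` does not depend on the scale of the splitting
  have hμeq : ∀ n, μ n =ᵐ[volume] μ 0 := fun n =>
    ae_eq_of_annular (fun φ => integrable_mul_tCoord_add φ c _ _)
      (fun φ => integrable_mul_tCoord_add φ c _ _)
      fun φ _ => (hpq n φ).symm.trans (hpq 0 φ)
  have hμm : AEStronglyMeasurable (μ 0) :=
    ((Complex.measurable_ofReal.comp measurable_tCoord).aestronglyMeasurable.mul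
      (Lp.aestronglyMeasurable _)).add ((Lp.aestronglyMeasurable _).const_mul c)
  set k' : E d → ℂ := fun x => pw s (tCoord x) * ((tCoord x : ℂ)⁻¹ * μ 0 x) with hk'
  have hk'm : AEStronglyMeasurable k' := (aestronglyMeasurable_pw _).mul
    ((Complex.measurable_ofReal.comp measurable_tCoord).inv.aestronglyMeasurable.mul hμm)
  -- the dyadic bands
  set B : ℤ → Set (E d) := fun n => {x | 1 ≤ (2 : ℝ) ^ n * |tCoord x| ∧
    (2 : ℝ) ^ n * |tCoord x| ≤ 2} with hB
  have hBm : ∀ n, MeasurableSet (B n) := fun n =>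
    (measurableSet_le measurable_const (measurable_tCoord.norm.const_mul _)).inter
      (measurableSet_le (measurable_tCoord.norm.const_mul _) measurable_const)
  have hband : ∀ n : ℤ, ∫⁻ x in B n, ‖k' x‖ₑ ^ 2 ≤ 2048 *
      (ENNReal.ofReal (((2 : ℝ) ^ n) ^ (-2 * s)) * l2 (highPart ((2 : ℝ) ^ n) (wt (-s) k)) ^ 2
        + ENNReal.ofReal (((2 : ℝ) ^ n) ^ (-2 * s)) * l2 (lowPart ((2 : ℝ) ^ n) f) ^ 2) := by
    intro n
    set r : ℝ := 2 ^ n with hr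
    have hr0 : 0 < r := h2n n
    set K₁ := l2 (highPart r (wt (-s) k)) with hK₁
    set K₂ := l2 (lowPart r f) with hK₂
    set g : E d → ℂ := fun x => ((‖p n x‖ + r * ‖q n x‖ : ℝ) : ℂ) with hg
    have hl2g : l2 g ≤ 16 * (K₁ + K₂) := by
      have h1 : l2 g ≤ l2 (p n) + ENNReal.ofReal r * l2 (q n) := by
        have h2 : l2 g ≤ eLpNorm (fun x => ‖p n x‖) 2 volume
            + eLpNorm (fun x => r * ‖q n x‖) 2 volume := by
          refine le_trans (le_of_eq ?_) (eLpNorm_add_le (Lp.aestronglyMeasurable (p n)).norm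
            ((Lp.aestronglyMeasurable (q n)).norm.const_mul r) (by norm_num))
          refine eLpNorm_congr_norm_ae (ae_of_all _ fun x => ?_)
          rw [hg, Complex.norm_real]; rfl
        refine h2.trans (add_le_add (eLpNorm_norm _).le (le_of_eq ?_))
        have h3 := eLpNorm_const_smul r (fun x => ‖q n x‖) 2 (volume : Measure (E d))
        rw [eLpNorm_norm, Real.enorm_eq_ofReal hr0.le] at h3
        exact h3
      refine h1.trans ((add_le_add (hp n) (hq n)).trans (le_of_eq ?_))
      rw [← add_mul]; norm_num; rfl
    have hpt : ∀ᵐ x, x ∈ B n →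
        ‖k' x‖ₑ ^ 2 ≤ ENNReal.ofReal (4 * r ^ (-2 * s)) * ‖g x‖ₑ ^ 2 := by
      filter_upwards [hμeq n, ae_tCoord_ne_zero] with x hx hx0 hxB
      have ht := abs_pos.2 hx0
      have hgpos : 0 ≤ ‖p n x‖ + r * ‖q n x‖ := by positivity
      have h1 : |tCoord x|⁻¹ ≤ r := by
        rw [inv_le_iff_one_le_mul₀ ht]; exact hxB.1
      have h2 : |tCoord x| ^ s ≤ 2 * r ^ (-s) := by
        have h3 : |tCoord x| ≤ 2 * r⁻¹ := by
          rw [← div_eq_mul_inv, le_div_iff₀ hr0, mul_comm]; exact hxB.2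
        calc |tCoord x| ^ s ≤ (2 * r⁻¹) ^ s := Real.rpow_le_rpow ht.le h3 hs0.le
          _ = 2 ^ s * r ^ (-s) := by
              rw [Real.mul_rpow two_pos.le (by positivity), Real.inv_rpow hr0.le,
                Real.rpow_neg hr0.le]
          _ ≤ 2 ^ (1 : ℝ) * r ^ (-s) := by
              gcongr
              · exact one_le_two
          _ = _ := by rw [Real.rpow_one]
      have h4 : ‖k' x‖ ≤ 2 * r ^ (-s) * (‖p n x‖ + r * ‖q n x‖) := by
        rw [hk', norm_mul, norm_pw _ hx0, Complex.ofReal_re]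
        refine mul_le_mul h2 ?_ (norm_nonneg _) (by positivity)
        rw [← hx, hμ, norm_mul, norm_inv, Complex.norm_real, Real.norm_eq_abs]
        calc |tCoord x|⁻¹ * ‖tCoord x * p n x + c * q n x‖
            ≤ |tCoord x|⁻¹ * (|tCoord x| * ‖p n x‖ + 1 * ‖q n x‖) := by
              gcongr
              refine (norm_add_le _ _).trans ?_
              rw [norm_mul, norm_mul, Complex.norm_real, Real.norm_eq_abs]
              gcongr
          _ = ‖p n x‖ + |tCoord x|⁻¹ * ‖q n x‖ := by field_simp
          _ ≤ _ := by gcongr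
      have h5 : (2 * r ^ (-s)) ^ 2 = 4 * r ^ (-2 * s) := by
        rw [mul_pow, sq (r ^ (-s)), ← Real.rpow_add hr0]; ring_nf
      rw [← ofReal_norm, ← ofReal_norm, ← ENNReal.ofReal_pow (norm_nonneg _),
        ← ENNReal.ofReal_pow (norm_nonneg _), ← ENNReal.ofReal_mul (by positivity), ← h5,
        ← mul_pow]
      refine ENNReal.ofReal_le_ofReal (pow_le_pow_left₀ (norm_nonneg _) ?_ 2)
      rwa [hg, Complex.norm_real, Real.norm_of_nonneg hgpos]
    calc ∫⁻ x in B n, ‖k' x‖ₑ ^ 2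
        ≤ ∫⁻ x in B n, ENNReal.ofReal (4 * r ^ (-2 * s)) * ‖g x‖ₑ ^ 2 :=
          setLIntegral_mono_ae' (hBm n) hpt
      _ ≤ ∫⁻ x, ENNReal.ofReal (4 * r ^ (-2 * s)) * ‖g x‖ₑ ^ 2 := setLIntegral_le_lintegral _ _
      _ = ENNReal.ofReal (4 * r ^ (-2 * s)) * l2 g ^ 2 :=
          (l2_sq_mul_const _ ENNReal.ofReal_ne_top _).symm
      _ ≤ ENNReal.ofReal (4 * r ^ (-2 * s)) * (16 * (K₁ + K₂)) ^ 2 := by gcongr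
      _ ≤ ENNReal.ofReal (4 * r ^ (-2 * s)) * (256 * (2 * (K₁ ^ 2 + K₂ ^ 2))) := by
          rw [mul_pow]
          gcongr
          · norm_num
          · exact ennreal_add_sq_le K₁ K₂
      _ = _ := by
          rw [ENNReal.ofReal_mul (by norm_num), show ENNReal.ofReal 4 = 4 by simp]
          ring
  have hcover : ∀ᵐ x : E d, x ∈ ⋃ n, B n := by
    filter_upwards [ae_tCoord_ne_zero] with x hx
    obtain ⟨j, hj1, hj2⟩ := exists_mem_Ico_zpow (abs_pos.2 hx) one_lt_two
    refine Set.mem_iUnion.2 ⟨-j, ?_, ?_⟩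
    · rw [zpow_neg, inv_mul_eq_div, one_le_div (h2n j)]; exact hj1
    · rw [zpow_neg, inv_mul_le_iff₀ (h2n j), ← zpow_add_one₀ two_ne_zero]; exact hj2.le
  have hl2 : l2 k' ^ 2 ≤ 2048 * (C₁ * l2 k ^ 2 + C₂ * l2 (wt (-s) f) ^ 2) := by
    have hcov : ∫⁻ x, ‖k' x‖ₑ ^ 2 = ∫⁻ x in ⋃ n, B n, ‖k' x‖ₑ ^ 2 := by
      rw [Measure.restrict_eq_self_of_ae_mem hcover]
    rw [eLpNorm_two_sq, hcov]
    refine (lintegral_iUnion_le _ _).trans ((ENNReal.tsum_le_tsum hband).trans ?_)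
    rw [ENNReal.tsum_mul_left, ENNReal.tsum_add]
    gcongr
    · exact hC₁ k hk
    · exact hC₂ f hf.1
  have hbound : l2 k' ≤ (2048 * (C₁ + C₂ + 1) : ℝ≥0) * (l2 k + l2 (wt (-s) f)) := by
    refine l2_le_of_sq_le (hl2.trans ?_)
    have h1 : (2048 * (C₁ + C₂) : ℝ≥0) ≤ (2048 * (C₁ + C₂ + 1)) ^ 2 := by
      calc (2048 * (C₁ + C₂) : ℝ≥0) ≤ 2048 * (C₁ + C₂ + 1) := mul_le_mul_right le_self_add _
        _ ≤ _ := le_self_pow₀ (by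
            calc (1 : ℝ≥0) ≤ 2048 * 1 := by norm_num
              _ ≤ _ := mul_le_mul_right le_add_self _) two_ne_zero
    calc 2048 * (C₁ * l2 k ^ 2 + C₂ * l2 (wt (-s) f) ^ 2)
        ≤ 2048 * (C₁ * (l2 k + l2 (wt (-s) f)) ^ 2 + C₂ * (l2 k + l2 (wt (-s) f)) ^ 2) := by
          gcongr
          · exact le_self_add
          · exact le_add_self
      _ = (2048 * (C₁ + C₂) : ℝ≥0) * (l2 k + l2 (wt (-s) f)) ^ 2 := by push_cast; ring
      _ ≤ ((2048 * (C₁ + C₂ + 1)) ^ 2 : ℝ≥0) * (l2 k + l2 (wt (-s) f)) ^ 2 := by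
          gcongr
      _ = _ := by push_cast; ring
  refine ⟨k', ⟨hk'm, ?_⟩, hbound, fun φ hφ => ?_⟩
  · exact hbound.trans_lt (ENNReal.mul_lt_top ENNReal.coe_lt_top
      (ENNReal.add_lt_top.2 ⟨hk.2, hfs.2⟩))
  · obtain ⟨n, hn⟩ := exists_annMul_apply_of_annular hφ
    set χ := annMul n (fun t : ℝ => ((t : ℂ))⁻¹) φ with hχ
    have hχx : ∀ x, χ x = (tCoord x : ℂ)⁻¹ * φ x := hn n le_rfl _ contDiffAt_inv_ofReal
    have hφχ : φ = mulT χ := by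
      ext x
      rw [mulT_apply, hχx]
      by_cases hx : tCoord x = 0
      · rw [annular_apply_eq_zero hφ hx]; simp
      · have : (tCoord x : ℂ) ≠ 0 := by exact_mod_cast hx
        field_simp
    have h1 : (𝓕 w) φ = ∫ x, χ x * μ 0 x := by rw [hφχ]; exact hpq 0 χ
    rw [h1]
    refine integral_congr_ae ?_
    filter_upwards [ae_tCoord_ne_zero] with x hx
    rw [hχx, wt, hk']
    linear_combination (-(φ x * ((tCoord x : ℂ)⁻¹ * μ 0 x))) * pw_neg_mul_pw (s : ℂ) hx

/-! ### `A_s` embeds into the interpolation space -/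

lemma synthFamily_self (s : ℝ) (k : E d → ℂ) : synthFamily s k s = wt (-s) k := by
  ext x; rw [synthFamily, multiplier_self, wt]

lemma memLp_lowMul_wt {s : ℝ} (hs0 : 0 ≤ s) (hs1 : s ≤ 1) {k : E d → ℂ} (hk : MemLp k 2) :
    MemLp (lowMul (wt (-s) k)) 2 := by
  rw [← synthFamily_self]
  exact memLp_lowMul_synthFamily hs0 hs1 hk (by simp [strip, hs0, hs1])

/-- The odd synthesis recovers the odd part of a distribution from its Fourier transform: the test
functions `𝓕⁻ ψ` with `ψ` odd vanish on `λ = 0`, where the formula for the Fourier transform says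
nothing. -/
lemma isRepresentedBy_oddDistr {s : ℝ} (hs0 : 0 ≤ s) (hs1 : s ≤ 1) {u : 𝓢'(E d, ℂ)}
    {f k : E d → ℂ} (hf : IsRepresentedBy u f) (hu : IsTame u) (hk : MemLp k 2)
    (hku : ∀ φ ∈ annular d, (𝓕 u) φ = ∫ x, φ x * wt (-s) k x) :
    IsRepresentedBy (oddDistr (wt (-s) k)) (fun x => 2⁻¹ * (f x - f (reflT d x))) := by
  have hfR : AEStronglyMeasurable fun x => f (reflT d x) :=
    hf.1.comp_quasiMeasurePreserving measurePreserving_reflT.quasiMeasurePreserving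
  refine ⟨(hf.1.sub hfR).const_mul _, fun ψ => ?_⟩
  have h1 : Integrable fun x => ψ x * f x := (hf.2 ψ).1
  have h2 : Integrable fun x => ψ x * f (reflT d x) := by
    have := measurePreserving_reflT.integrable_comp_of_integrable (hf.2 (compReflT ψ)).1
    refine this.congr (ae_of_all _ fun x => ?_)
    simp only [Function.comp_apply, compReflT_apply, reflT_reflT]
  have h3 : (fun x => ψ x * (2⁻¹ * (f x - f (reflT d x))))
      = fun x => 2⁻¹ * (ψ x * f x - ψ x * f (reflT d x)) := by
    ext x; ring
  rw [h3]
  refine ⟨(h1.sub h2).const_mul _, ?_⟩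
  have h4 : ∫ x, ψ x * f (reflT d x) = u (compReflT ψ) := by
    rw [(hf.2 _).2, ← integral_comp_reflT]
    simp only [compReflT_apply, reflT_reflT]
  rw [oddDistr_apply (memLp_lowMul_wt hs0 hs1 hk),
    ← fourier_apply_of_vanish hs0 hs1 hu hk hku (oddFourierInv_vanish ψ), integral_const_mul,
    integral_sub h1 h2, h4, ← (hf.2 ψ).2, oddFourierInv_eq]
  change u (𝓕 (𝓕⁻ (oddPart ψ) : 𝓢(E d, ℂ))) = _
  rw [FourierTransform.fourier_fourierInv_eq, oddPart_eq, map_smul, map_sub, smul_eq_mul]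

lemma normA_zero_add_le_two (u v : 𝓢'(E d, ℂ)) :
    normA d 0 (u + v) ≤ 2 * (normA d 0 u + normA d 0 v) :=
  (normA_zero_add_le u v).trans (by gcongr; norm_num)

lemma normA_one_add_le_two (u v : 𝓢'(E d, ℂ)) :
    normA d 1 (u + v) ≤ 2 * (normA d 1 u + normA d 1 v) := by
  simpa using normA_one_add_le u v

/-- The inclusion of `A_s` in the interpolation space. The odd part of `u` is synthesized from
`𝓕 u`, and the even part is the product of `sgn t` and the odd part of `(sgn t) u`. -/
theorem exists_isAdmissible {s : ℝ} (hs0 : 0 < s) (hs1 : s < 1) : ∃ C : ℝ≥0,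
    ∀ {u : 𝓢'(E d, ℂ)} {f : E d → ℂ} {g : Lp ℂ 2 (volume : Measure (E d))},
      IsRepresentedBy u f → MemLp (wt (-s) f) 2 → IsFracDeriv s u g →
      ∃ F : ℂ → 𝓢'(E d, ℂ), IsAdmissible (normA d 0) (normA d 1) F ∧ F s = u ∧
        stripNorm (normA d 0) (normA d 1) F ≤ C * (‖g‖ₑ + l2 (wt (-s) f)) := by
  obtain ⟨C, hC⟩ := exists_fourier_sgnMul (d := d) hs0 hs1
  refine ⟨168 + 336 * C, fun {u f g} hf hfs hg => ?_⟩
  obtain ⟨k, hk, hkg, hku⟩ := exists_of_isFracDeriv hs0 hs1 hg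
  have hfs' : MemLp (wt (-s) (sgnMul f)) 2 := by rw [wt_sgnMul]; exact memLp_sgnMul hfs
  obtain ⟨w, hw⟩ := exists_isRepresentedBy_of_memLp_wt hs0.le hs1.le hfs'
  obtain ⟨k', hk', hkk, hkw⟩ := hC hf hfs hw hk hku
  refine ⟨fun z => oddDistr (synthFamily s k z) + sgnDistr (oddDistr (synthFamily s k' z)),
    IsAdmissible.add normA_zero_add_le_two normA_one_add_le_two
      (isAdmissible_synthFamily isSynthesis_oddDistr hs0.le hs1.le hk)
      (isAdmissible_synthFamily isSynthesis_sgnDistr_oddDistr hs0.le hs1.le hk'), ?_, ?_⟩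
  · have h1 := isRepresentedBy_oddDistr hs0.le hs1.le hf
      (isTame_of_isRepresentedBy hs0.le hs1.le hf hfs) hk hku
    have h2 := isRepresentedBy_oddDistr hs0.le hs1.le hw
      (isTame_of_isRepresentedBy hs0.le hs1.le hw hfs') hk' hkw
    obtain ⟨e, he, hes⟩ := isSgnMul_oddDistr (memLp_lowMul_wt hs0.le hs1.le hk')
    dsimp only
    rw [synthFamily_self, synthFamily_self]
    refine isRepresentedBy_unique (h1.add hes) hf ?_
    filter_upwards [isRepresentedBy_ae_eq he h2, ae_tCoord_ne_zero] with x hx hx0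
    simp only [sgnMul] at hx ⊢
    rw [hx, tCoord_reflT, sgn_neg hx0]
    linear_combination (2⁻¹ * (f x + f (reflT d x))) * sgn_mul_self (tCoord x)
  · refine (stripNorm_add_le normA_zero_add_le_two normA_one_add_le_two _ _).trans ?_
    calc 2 * (stripNorm (normA d 0) (normA d 1) (fun z => oddDistr (synthFamily s k z))
          + stripNorm (normA d 0) (normA d 1) fun z => sgnDistr (oddDistr (synthFamily s k' z)))
        ≤ 2 * (3 * (28 : ℝ≥0) * l2 k + 3 * (56 : ℝ≥0) * l2 k') :=
          mul_le_mul_right (add_le_add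
            (stripNorm_synthFamily_le isSynthesis_oddDistr hs0.le hs1.le hk)
            (stripNorm_synthFamily_le isSynthesis_sgnDistr_oddDistr hs0.le hs1.le hk')) _
      _ ≤ 2 * (3 * (28 : ℝ≥0) * (‖g‖ₑ + l2 (wt (-s) f))
            + 3 * (56 : ℝ≥0) * (C * (‖g‖ₑ + l2 (wt (-s) f)))) := by
          gcongr
          · exact hkg.trans le_self_add
          · refine hkk.trans ?_
            gcongr
      _ = _ := by push_cast; ring

/-- The set and norm form of `exists_isAdmissible`; the norm of `D^s u` is an infimum, whence the
approximation by `M > ‖u‖_s`. -/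
theorem exists_interp_le {s : ℝ} (hs0 : 0 < s) (hs1 : s < 1) : ∃ C : ℝ≥0, ∀ u ∈ A d s,
    u ∈ interpSpace (normA d 0) (normA d 1) s ∧
      interpNorm (normA d 0) (normA d 1) s u ≤ C * normA d s u := by
  obtain ⟨C, hC⟩ := exists_isAdmissible (d := d) hs0 hs1
  refine ⟨2 * C, fun u (hu : normA d s u < ⊤) => ?_⟩
  have hw : weightedSq s u ≠ ⊤ :=
    ((weightedSq_le_normA_sq hs0.ne' u).trans_lt (ENNReal.pow_lt_top hu)).ne
  obtain ⟨f, hf, hfs⟩ := exists_isRepresentedBy_of_weightedSq hw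
  have hfu : l2 (wt (-s) f) ≤ normA d s u := by
    refine l2_le_of_sq_le ?_
    rw [← weightedSq_eq_of_isRepresentedBy s hf]
    exact weightedSq_le_normA_sq hs0.ne' u
  have key : ∀ M > normA d s u, ∃ F : ℂ → 𝓢'(E d, ℂ),
      IsAdmissible (normA d 0) (normA d 1) F ∧ F s = u ∧
        stripNorm (normA d 0) (normA d 1) F ≤ 2 * C * M := by
    intro M hM
    have h1 : fracDerivSq s u < M ^ 2 := (fracDerivSq_le_normA_sq hs0.ne' u).trans_lt
      (ENNReal.pow_lt_pow_left two_ne_zero hM)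
    simp only [fracDerivSq, iInf_lt_iff] at h1
    obtain ⟨g, hg, hgM⟩ := h1
    have hgM' : ‖g‖ₑ ≤ M := (ENNReal.pow_le_pow_left_iff two_ne_zero).1 hgM.le
    obtain ⟨F, hF, hFs, hle⟩ := hC hf hfs hg
    refine ⟨F, hF, hFs, hle.trans ?_⟩
    calc C * (‖g‖ₑ + l2 (wt (-s) f)) ≤ C * (M + M) := by
          gcongr
          exact hfu.trans hM.le
      _ = _ := by ring
  refine ⟨?_, ?_⟩
  · obtain ⟨F, hF, hFs, -⟩ := key ⊤ hu
    exact ⟨F, hF, hFs⟩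
  · have hlim : Tendsto (fun n : ℕ => (2 * C : ℝ≥0∞) * (normA d s u + (n : ℝ≥0∞)⁻¹)) atTop
        (𝓝 (2 * C * (normA d s u + 0))) :=
      ENNReal.Tendsto.const_mul (tendsto_const_nhds.add ENNReal.tendsto_inv_nat_nhds_zero)
        (Or.inr (by finiteness))
    rw [add_zero] at hlim
    push_cast
    refine ge_of_tendsto' hlim fun n => ?_
    obtain ⟨F, hF, hFs, hle⟩ := key _ (ENNReal.lt_add_right hu.ne
      (ENNReal.inv_ne_zero.2 (ENNReal.natCast_ne_top n)))
    exact (iInf₂_le F ⟨hF, hFs⟩).trans hle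

end HardySobolev

/-- For `0 < s < 1`, the complex interpolation space `[A_0, A_1]_s` is `A_s`, with equivalent
norms. -/
theorem theorem3p1 (d : ℕ) (s : ℝ) (hs0 : 0 < s) (hs1 : s < 1) :
    ComplexInterpolation.interpSpace (HardySobolev.normA d 0) (HardySobolev.normA d 1) s =
        HardySobolev.A d s ∧
      ∃ c C : ℝ≥0, 0 < c ∧ 0 < C ∧ ∀ u ∈ HardySobolev.A d s,
        c * HardySobolev.normA d s u ≤
            ComplexInterpolation.interpNorm
              (HardySobolev.normA d 0) (HardySobolev.normA d 1) s u ∧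
          ComplexInterpolation.interpNorm
              (HardySobolev.normA d 0) (HardySobolev.normA d 1) s u ≤
            C * HardySobolev.normA d s u := by
  obtain ⟨C, hC⟩ := HardySobolev.exists_interp_le (d := d) hs0 hs1
  refine ⟨Set.Subset.antisymm ?_ fun u hu => (hC u hu).1,
    14⁻¹, C + 1, by norm_num, by positivity, fun u hu => ⟨?_, (hC u hu).2.trans ?_⟩⟩
  · rintro _ ⟨F, hF, rfl⟩
    exact (HardySobolev.normA_le_of_isAdmissible hs0 hs1 hF).trans_lt
      (ENNReal.mul_lt_top (by finiteness) (HardySobolev.stripNorm_lt_top hF))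
  · refine le_iInf₂ fun F hF => ?_
    obtain ⟨hF, rfl⟩ := hF
    rw [ENNReal.coe_inv (by norm_num), ENNReal.inv_mul_le_iff (by norm_num) (by norm_num)]
    exact_mod_cast HardySobolev.normA_le_of_isAdmissible hs0 hs1 hF
  · gcongr
    exact_mod_cast le_self_add
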